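/- Let $d\ge 1$ and equip $\mathbb{R}^d$ with the Euclidean norm. For a non-empty bounded set $E\subset\mathbb{R}^d$ let $N_r(E)$ be the least number of open balls of radius $r$ needed to cover $E$, and let $$\underline{\dim}_{\mathrm B}E=\liminf_{r\to 0}\frac{\log N_r(E)}{\log(1/r)},\qquad \overline{\dim}_{\mathrm B}E=\limsup_{r\to 0}\frac{\log N_r(E)}{\log(1/r)}$$ be its lower and upper box dimensions; $\dim_{\mathrm H}$ denotes Hausdorff dimension. A CIFS on $\mathbb{R}^d$ consists of a compact connected set $X\subset\mathbb{R}^d$ and a non-empty countable family of injective maps $S_i\colon X\to X$ $(i\in\mathcal I)$ for which there is $0<c<1$ with $\|S_i(x)-S_i(y)\|\le c\|x-y\|$ for all $x,y\in X$ and $i\in\mathcal I$, such that the following hold. (i) Conformality: there is an open, bounded, connected set $V\supset X$ such that each $S_i$ extends to a conformal $C^{1+\varepsilon}$ diffeomorphism of $V$ onto a subset of $V$. (ii) Bounded distortion: there is $K\ge 1$ such that $\|S_{\mathtt i}'(x)\|\le K\|S_{\mathtt i}'(y)\|$ for all $x,y\in V$ and all finite words $\mathtt i=(i_1,\dots,i_n)$,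 where $S_{\mathtt i}=S_{i_1}\circ\cdots\circ S_{i_n}$. (iii) Open set condition: the interior $U$ of $X$ is non-empty, $S_i(U)\subset U$ for all $i$, and $S_i(U)\cap S_j(U)=\varnothing$ for $i\ne j$. (iv) Cone condition: $\inf_{x\in X}\inf_{0<r<1}r^{-d}\mathcal L^d(B(x,r)\cap U)>0$, where $\mathcal L^d$ is Lebesgue measure. Its limit set is $\Lambda=\bigcup_{\gamma\in\mathcal I^{\mathbb N}}\bigcap_{n\ge 1}S_{(\gamma_1,\dots,\gamma_n)}(X)$, and $F\subset X$ denotes the set of fixed points of the maps $S_i$. For $0\le s\le t\le\alpha$ and $0\le h\le\alpha$ put $$\mathcal D(h,s,t,\alpha)=\begin{cases}\{h\}, & t\le h,\\ \left[\max\{h,s\},\ h+\dfrac{(t-h)(\alpha-h)s}{\alpha t-hs}\right], & t>h.\end{cases}$$ Theorem. For every CIFS on $\mathbb{R}^d$, $$\underline{\dim}_{\mathrm B}\Lambda\in\mathcal D\bigl(\dim_{\mathrm H}\Lambda,\ \underline{\dim}_{\mathrm B}F,\ \overline{\dim}_{\mathrm B}F,\ d\bigr).$$ Conversely, these bounds are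 sharp: for all $0<h<d$, $0\le s\le t\le d$ and $\beta\in\mathcal D(h,s,t,d)$ there is a CIFS on $\mathbb{R}^d$ consisting of similarity maps, with limit set $\Lambda$ and fixed point set $F$, such that $\dim_{\mathrm H}\Lambda=h$, $\underline{\dim}_{\mathrm B}F=s$, $\overline{\dim}_{\mathrm B}F=t$ and $\underline{\dim}_{\mathrm B}\Lambda=\beta$. -/

import Mathlib

open scoped NNReal ENNReal Topology

namespace ConformalIFS

/-- `d`-dimensional Euclidean space. -/
abbrev E (d : ℕ) : Type := EuclideanSpace ℝ (Fin d)

/-- The covering number `N_r(A)`: the least number of open balls of radius `r` that cover `A`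
(used for bounded `A` and `r > 0`, where such covers exist). -/
noncomputable def coveringNumber {d : ℕ} (r : ℝ) (A : Set (E d)) : ℕ :=
  sInf {n : ℕ | ∃ c : Finset (E d), c.card = n ∧ A ⊆ ⋃ x ∈ c, Metric.ball x r}

/-- The box dimension estimate `log N_r(A) / log (1/r)` at scale `r`; it is nonnegative for
`0 < r < 1`, so that nothing is lost by reading it in `[0, ∞]`. -/
noncomputable def boxEstimate {d : ℕ} (A : Set (E d)) (r : ℝ) : ℝ≥0∞ :=
  ENNReal.ofReal (Real.log (coveringNumber r A) / Real.log (1 / r))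

/-- The lower box dimension of a nonempty bounded set. -/
noncomputable def lowerBoxDim {d : ℕ} (A : Set (E d)) : ℝ≥0∞ :=
  Filter.liminf (boxEstimate A) (𝓝[>] (0 : ℝ))

/-- The upper box dimension of a nonempty bounded set. -/
noncomputable def upperBoxDim {d : ℕ} (A : Set (E d)) : ℝ≥0∞ :=
  Filter.limsup (boxEstimate A) (𝓝[>] (0 : ℝ))

/-- The composition `S_w = S_{i₁} ∘ ⋯ ∘ S_{iₙ}` along a finite word `w = (i₁, …, iₙ)`. -/
def wordMap {d : ℕ} {ι : Type*} (S : ι → E d → E d) : List ι → E d → E d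
  | [] => id
  | i :: w => S i ∘ wordMap S w

/-- The limit set: the union over infinite words `γ` of the intersections over `n ≥ 1` of the
images of `X` under the compositions along the prefixes of length `n` of `γ`. -/
def limitSet {d : ℕ} {ι : Type*} (S : ι → E d → E d) (X : Set (E d)) : Set (E d) :=
  ⋃ γ : ℕ → ι, ⋂ n : ℕ, wordMap S (List.ofFn fun k : Fin (n + 1) => γ k) '' X

/-- The set of fixed points of the maps `S i : X → X`. -/
def fixedPts {d : ℕ} {ι : Type*} (S : ι → E d → E d) (X : Set (E d)) : Set (E d) :=
  {x | x ∈ X ∧ ∃ i, S i x = x}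

/-- `S` is a conformal iterated function system on `X ⊆ ℝ^d` that satisfies the open set condition
and the cone condition. The function `S i` stands for the `i`-th map `X → X` together with its
extension to the neighbourhood `V` of `X`; its values outside of `V` play no role. -/
structure IsCIFS {d : ℕ} {ι : Type*} (S : ι → E d → E d) (X : Set (E d)) : Prop where
  isCompact : IsCompact X
  isConnected : IsConnected X
  mapsTo : ∀ i, Set.MapsTo (S i) X X
  injOn : ∀ i, Set.InjOn (S i) X
  /-- The maps are uniformly contracting. -/
  contracting : ∃ c : ℝ, 0 < c ∧ c < 1 ∧
    ∀ i, ∀ x ∈ X, ∀ y ∈ X, ‖S i x - S i y‖ ≤ c * ‖x - y‖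
  /-- Conformality: there is an open, bounded, connected `V ⊇ X` such that each map is a conformal
  diffeomorphism of `V` into `V`, with Hölder continuous derivative; and bounded distortion of all
  the compositions on `V`. -/
  conformal : ∃ V : Set (E d), IsOpen V ∧ Bornology.IsBounded V ∧ IsConnected V ∧ X ⊆ V ∧
    (∀ i, Set.MapsTo (S i) V V ∧ Set.InjOn (S i) V ∧ (∀ x ∈ V, ConformalAt (S i) x) ∧
      ∃ C ε : ℝ≥0, 0 < ε ∧ HolderOnWith C ε (fderiv ℝ (S i)) V) ∧
    ∃ K : ℝ, 1 ≤ K ∧ ∀ w : List ι, ∀ x ∈ V, ∀ y ∈ V,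
      ‖fderiv ℝ (wordMap S w) x‖ ≤ K * ‖fderiv ℝ (wordMap S w) y‖
  /-- Open set condition for the interior of `X`. -/
  interior_nonempty : (interior X).Nonempty
  mapsTo_interior : ∀ i, Set.MapsTo (S i) (interior X) (interior X)
  disjoint : ∀ i j, i ≠ j → Disjoint (S i '' interior X) (S j '' interior X)
  /-- Cone condition. -/
  cone : ∃ c : ℝ, 0 < c ∧ ∀ x ∈ X, ∀ r : ℝ, 0 < r → r < 1 →
    ENNReal.ofReal (c * r ^ d) ≤ MeasureTheory.volume (Metric.ball x r ∩ interior X)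

/-- `f` is a similarity map of `ℝ^d` (with positive ratio). -/
def IsSimilarityMap {d : ℕ} (f : E d → E d) : Prop :=
  ∃ c : ℝ, 0 < c ∧ ∀ x y, ‖f x - f y‖ = c * ‖x - y‖

/-- The compact interval `𝒟(h, s, t, α)`. -/
noncomputable def interval (h s t α : ℝ) : Set ℝ :=
  if t ≤ h then {h}
  else Set.Icc (max h s) (h + (t - h) * (α - h) * s / (α * t - h * s))

end ConformalIFS

/-! Write `r = e^{-u}`, let `φ(u) = log N_{e^{-u}}(F)` and `h = dim_H Λ`. The heart of the matter is
that, up to errors `o(v)`, `log N_{e^{-v}}(Λ)` is at most the supremum over `0 ≤ u ≤ v` of `h (v -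
u) + φ(u)` (`ConfSys.exists_logCov_le`). Follow the code of a point of `Λ` until the contraction
ratio first drops below `r`. The word `w` before the last letter has ratio `ρ_w ≥ r`, and the point
lies in the image under `S_w` of an `O(r / ρ_w)`-neighbourhood of `F`. This image needs about
`N_{r/ρ_w}(F)` balls of radius `r`, and the contributions are summed using `∑ ρ_w ^ s < ∞` for `s >
h`. That summability (`ConfSys.summable_ratio`) is a mass distribution argument: a finite family of
incomparable words with `∑ (ρ_w / K) ^ s ≥ 1` carries a Bernoulli measure that forces `dim_H Λ ≥ s`.

For the inclusion, if `t ≤ h` the supremum is at most `(h + ε) v + C`. If `t > h`, then `φ(u)` is at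
most about `t u`, and it is about `s u₁` at arbitrarily large `u₁`. As `φ` is nondecreasing and, up
to a constant, `d`-Lipschitz, it lies below a plateau up to `u₁` and below a line of slope `d` after
it. Choosing `v` so that the candidates `u = s u₁ / t` and `u = v` give equal values bounds the
supremum by the right endpoint of the interval times `v` (`conv_bound_at_valley`). The left endpoint
is monotonicity together with `dim_H ≤ lower box dimension`.

For sharpness, systems of homotheties with separated images satisfy the reverse estimate
(`HomSys.exists_le_logCov`). Every nondecreasing `d`-Lipschitz `f` with `f 0 = 0` is, up to `o(u)`,
the covering function of a bounded set of isolated points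
(`eventually_abs_logCov_blockUnion_sub_le`). A finite grid completes this set to the centres of
homotheties with `∑ c_i ^ h = 1` (`exists_homSys`). Take for `f` a function with slopes between `s`
and `t` that has valleys of relative level `θ ≤ s` at very sparse scales, truncated from below by `s
u`. Then `F` has box dimensions `s` and `t`, while for `t > h` the lower box dimension of `Λ` is the
maximum of `s` and `topDim h θ t d`. As `θ` runs from `0` to `s`, `topDim h θ t d` moves
continuously from `h` to the right endpoint, so every admissible value occurs. -/

namespace ConformalIFS

/-! ### Covering numbers. -/

section Covering

open Metric Bornology

variable {d : ℕ} {A B : Set (E d)} {r r' : ℝ}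

theorem exists_cover (hA : IsBounded A) (hr : 0 < r) :
    ∃ c : Finset (E d), A ⊆ ⋃ x ∈ c, ball x r := by
  have h := Metric.totallyBounded_iff.1
    (hA.isCompact_closure.totallyBounded.subset subset_closure) r hr
  obtain ⟨t, ht, h⟩ := h
  exact ⟨ht.toFinset, by simpa using h⟩

theorem exists_cover_card (hA : IsBounded A) (hr : 0 < r) :
    ∃ c : Finset (E d), c.card = coveringNumber r A ∧ A ⊆ ⋃ x ∈ c, ball x r := by
  obtain ⟨c, hc⟩ := exists_cover hA hr
  exact Nat.sInf_mem (s := {n : ℕ | ∃ c : Finset (E d), c.card = n ∧ A ⊆ ⋃ x ∈ c, ball x r})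
    ⟨c.card, c, rfl, hc⟩

theorem coveringNumber_le_card {c : Finset (E d)} (h : A ⊆ ⋃ x ∈ c, ball x r) :
    coveringNumber r A ≤ c.card :=
  Nat.sInf_le ⟨c, rfl, h⟩

theorem coveringNumber_mono (hB : IsBounded B) (hr : 0 < r) (h : A ⊆ B) :
    coveringNumber r A ≤ coveringNumber r B := by
  obtain ⟨c, hc, hc'⟩ := exists_cover_card hB hr
  exact hc ▸ coveringNumber_le_card (h.trans hc')

theorem coveringNumber_anti (hA : IsBounded A) (hr : 0 < r) (h : r ≤ r') :
    coveringNumber r' A ≤ coveringNumber r A := by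
  obtain ⟨c, hc, hc'⟩ := exists_cover_card hA hr
  refine hc ▸ coveringNumber_le_card (hc'.trans ?_)
  exact Set.iUnion₂_mono fun x _ => ball_subset_ball h

theorem one_le_coveringNumber (hA : IsBounded A) (hr : 0 < r) (hne : A.Nonempty) :
    1 ≤ coveringNumber r A := by
  obtain ⟨c, hc, hc'⟩ := exists_cover_card hA hr
  obtain ⟨a, ha⟩ := hne
  have := hc' ha
  simp only [Set.mem_iUnion] at this
  obtain ⟨x, hx, -⟩ := this
  rw [← hc]
  exact Finset.card_pos.2 ⟨x, hx⟩

theorem coveringNumber_le_sum {κ : Type*} (s : Finset κ) (B : κ → Set (E d)) (hr : 0 < r)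
    (hB : ∀ i ∈ s, IsBounded (B i)) (h : A ⊆ ⋃ i ∈ s, B i) :
    coveringNumber r A ≤ ∑ i ∈ s, coveringNumber r (B i) := by
  classical
  have : ∀ i, ∃ c : Finset (E d), i ∈ s → c.card = coveringNumber r (B i) ∧
      B i ⊆ ⋃ x ∈ c, ball x r := by
    intro i
    by_cases hi : i ∈ s
    · obtain ⟨c, hc⟩ := exists_cover_card (hB i hi) hr
      exact ⟨c, fun _ => hc⟩
    · exact ⟨∅, fun h => absurd h hi⟩
  choose c hc using this
  calc coveringNumber r A ≤ (s.biUnion c).card := by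
        apply coveringNumber_le_card
        intro a ha
        have := h ha
        simp only [Set.mem_iUnion] at this
        obtain ⟨i, hi, hai⟩ := this
        have := (hc i hi).2 hai
        simp only [Set.mem_iUnion] at this ⊢
        obtain ⟨x, hx, hax⟩ := this
        exact ⟨x, Finset.mem_biUnion.2 ⟨i, hi, hx⟩, hax⟩
    _ ≤ ∑ i ∈ s, (c i).card := Finset.card_biUnion_le
    _ = ∑ i ∈ s, coveringNumber r (B i) := Finset.sum_congr rfl fun i hi => (hc i hi).1

theorem coveringNumber_union_le (hr : 0 < r) (hA : IsBounded A) (hB : IsBounded B) :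
    coveringNumber r (A ∪ B) ≤ coveringNumber r A + coveringNumber r B := by
  have := coveringNumber_le_sum (A := A ∪ B) (Finset.univ : Finset Bool)
    (fun b => if b then A else B) hr (by rintro (_ | _) <;> simp [hA, hB])
    (by
      rintro x (hx | hx)
      · simp only [Set.mem_iUnion]; exact ⟨true, Finset.mem_univ _, by simpa using hx⟩
      · simp only [Set.mem_iUnion]; exact ⟨false, Finset.mem_univ _, by simpa using hx⟩)
  simpa using this

theorem coveringNumber_coe_le_card (P : Finset (E d)) (hr : 0 < r) :
    coveringNumber r (P : Set (E d)) ≤ P.card :=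
  coveringNumber_le_card fun x hx => Set.mem_iUnion₂.2 ⟨x, hx, mem_ball_self hr⟩

/-- An open ball of radius `r` contains at most one point of a `2r`-separated set. -/
theorem card_le_coveringNumber (hA : IsBounded A) (hr : 0 < r) {P : Finset (E d)}
    (hP : (P : Set (E d)) ⊆ A) (hsep : ∀ x ∈ P, ∀ y ∈ P, x ≠ y → 2 * r ≤ dist x y) :
    P.card ≤ coveringNumber r A := by
  classical
  obtain ⟨c, hc, hc'⟩ := exists_cover_card hA hr
  rw [← hc]
  have : ∀ x ∈ P, ∃ y ∈ c, x ∈ ball y r := by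
    intro x hx
    have := hc' (hP hx)
    simpa only [Set.mem_iUnion, exists_prop] using this
  choose! g hg hg' using this
  refine Finset.card_le_card_of_injOn g (fun x hx => hg x hx) ?_
  intro x hx y hy hxy
  by_contra hne
  have h1 := hsep x hx y hy hne
  have h2 := mem_ball.1 (hg' x hx)
  have h3 := mem_ball.1 (hg' y hy)
  rw [← hxy] at h3
  have := dist_triangle_right x y (g x)
  linarith

theorem norm_le_sum_abs (x : E d) : ‖x‖ ≤ ∑ i, |x i| := by
  rw [EuclideanSpace.norm_eq]
  refine Real.sqrt_le_iff.2 ⟨Finset.sum_nonneg fun i _ => abs_nonneg _, ?_⟩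
  simp only [Real.norm_eq_abs]
  exact Finset.sum_sq_le_sq_sum_of_nonneg fun i _ => abs_nonneg _

/-- The constant in the comparison of covering numbers at different radii. -/
noncomputable def gridConst (d : ℕ) : ℝ := (2 * d + 5) ^ d

theorem one_le_gridConst (d : ℕ) : 1 ≤ gridConst d :=
  one_le_pow₀ (by have : (0 : ℝ) ≤ d := d.cast_nonneg; linarith)

theorem coveringNumber_ball_le (x : E d) {R : ℝ} (hR : 0 ≤ R) (hr : 0 < r) :
    (coveringNumber r (ball x R) : ℝ) ≤ gridConst d * (max 1 (R / r)) ^ d := by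
  classical
  -- Rounding to the grid of mesh `η` moves each coordinate by at most `η / 2`, hence the point by
  -- at most `d η / 2 < r`. The `+ 1` keeps `η` meaningful when `d = 0`.
  set η : ℝ := r / (d + 1) with hη
  have hd1 : (0 : ℝ) < d + 1 := by positivity
  have hη0 : 0 < η := by positivity
  set m : ℕ := ⌈R / η⌉₊ with hm
  set c : Finset (E d) := (Fintype.piFinset fun _ : Fin d => Finset.Icc (-(m : ℤ)) m).image
    fun j => x + WithLp.toLp 2 (fun i => η * (j i : ℝ)) with hc
  have hcover : ball x R ⊆ ⋃ y ∈ c, ball y r := by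
    intro y hy
    rw [mem_ball, dist_eq_norm] at hy
    set j : Fin d → ℤ := fun i => round ((y i - x i) / η) with hj
    have hcoord : ∀ i, |y i - x i| ≤ R := fun i => by
      have := PiLp.norm_apply_le (y - x) i
      simp only [PiLp.sub_apply, Real.norm_eq_abs] at this
      linarith
    have hmem : ∀ i, j i ∈ Finset.Icc (-(m : ℤ)) m := by
      intro i
      rw [Finset.mem_Icc, ← abs_le]
      have h1 := abs_sub_round ((y i - x i) / η)
      have h2 : |(y i - x i) / η| ≤ R / η := by
        rw [abs_div, abs_of_pos hη0]; gcongr; exact hcoord i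
      have h3 : R / η ≤ m := Nat.le_ceil _
      have h4 : |(j i : ℝ)| ≤ m + 1 / 2 := by
        have := abs_sub_abs_le_abs_sub (j i : ℝ) ((y i - x i) / η)
        rw [abs_sub_comm] at h1
        simp only [hj] at this ⊢
        linarith
      have h5 : ((|j i| : ℤ) : ℝ) < ((m + 1 : ℤ) : ℝ) := by push_cast; linarith
      have := Int.cast_lt.1 h5
      omega
    refine Set.mem_iUnion₂.2 ⟨x + WithLp.toLp 2 (fun i => η * (j i : ℝ)),
      Finset.mem_image.2 ⟨j, Fintype.mem_piFinset.2 hmem, rfl⟩, ?_⟩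
    rw [mem_ball, dist_eq_norm]
    refine (norm_le_sum_abs _).trans_lt ?_
    have : ∀ i, |(y - (x + WithLp.toLp 2 (fun i => η * (j i : ℝ)))) i| ≤ η / 2 := by
      intro i
      have h1 := abs_sub_round ((y i - x i) / η)
      have : (y - (x + WithLp.toLp 2 (fun i => η * (j i : ℝ)))) i
          = η * ((y i - x i) / η - round ((y i - x i) / η)) := by
        simp only [PiLp.sub_apply, PiLp.add_apply, hj]
        field_simp
        ring
      rw [this, abs_mul, abs_of_pos hη0]
      nlinarith
    calc ∑ i, |(y - (x + WithLp.toLp 2 (fun i => η * (j i : ℝ)))) i|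
        ≤ ∑ _i : Fin d, η / 2 := Finset.sum_le_sum fun i _ => this i
      _ = d * (η / 2) := by simp
      _ < r := by
        have : r = (d + 1) * η := by rw [hη]; field_simp
        rw [this]
        have : (0 : ℝ) ≤ d := d.cast_nonneg
        nlinarith
  have hcard : c.card ≤ (2 * m + 1) ^ d := by
    refine Finset.card_image_le.trans ?_
    rw [Fintype.card_piFinset]
    simp only [Int.card_Icc, Finset.prod_const, Finset.card_univ, Fintype.card_fin]
    apply Nat.pow_le_pow_left
    omega
  have h1 : (coveringNumber r (ball x R) : ℝ) ≤ (2 * m + 1) ^ d := by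
    have := (coveringNumber_le_card hcover).trans hcard
    exact_mod_cast this
  refine h1.trans ?_
  rw [gridConst, ← mul_pow]
  apply pow_le_pow_left₀ (by positivity)
  have h2 : (m : ℝ) < R / η + 1 := Nat.ceil_lt_add_one (by positivity)
  have h3 : R / η = (d + 1) * (R / r) := by rw [hη]; field_simp
  have h4 : (1 : ℝ) ≤ max 1 (R / r) := le_max_left _ _
  have h5 : R / r ≤ max 1 (R / r) := le_max_right _ _
  have : (0 : ℝ) ≤ d := d.cast_nonneg
  nlinarith

theorem coveringNumber_le_mul (hA : IsBounded A) (hr : 0 < r) (h : r ≤ r') :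
    (coveringNumber r A : ℝ) ≤ gridConst d * (r' / r) ^ d * coveringNumber r' A := by
  have hr' := hr.trans_le h
  obtain ⟨c, hc, hc'⟩ := exists_cover_card hA hr'
  have h1 := coveringNumber_le_sum c (fun x => ball x r') hr (fun _ _ => isBounded_ball) hc'
  calc (coveringNumber r A : ℝ) ≤ ∑ x ∈ c, (coveringNumber r (ball x r') : ℝ) := by
        exact_mod_cast h1
    _ ≤ ∑ _x ∈ c, gridConst d * (r' / r) ^ d := by
        refine Finset.sum_le_sum fun x _ => ?_
        have := coveringNumber_ball_le x hr'.le hr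
        rwa [max_eq_right ((one_le_div hr).2 h)] at this
    _ = gridConst d * (r' / r) ^ d * coveringNumber r' A := by
        rw [Finset.sum_const, hc, nsmul_eq_mul, mul_comm]

/-- The Lipschitz bound is only available on `A`, so each centre is replaced by a point of `A` in
its ball; this doubles the radius. -/
theorem coveringNumber_image_le (hA : IsBounded A) (hr : 0 < r) {f : E d → E d} {L : ℝ}
    (hL : 0 < L) (hf : ∀ x ∈ A, ∀ y ∈ A, ‖f x - f y‖ ≤ L * ‖x - y‖) :
    coveringNumber (2 * L * r) (f '' A) ≤ coveringNumber r A := by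
  classical
  obtain ⟨c, hc, hc'⟩ := exists_cover_card hA hr
  have : ∀ x : E d, ∃ a, (∃ b ∈ A, b ∈ ball x r) → a ∈ A ∧ a ∈ ball x r := by
    intro x
    by_cases h : ∃ b ∈ A, b ∈ ball x r
    · obtain ⟨b, hb⟩ := h
      exact ⟨b, fun _ => hb⟩
    · exact ⟨0, fun h' => absurd h' h⟩
  choose g hg using this
  rw [← hc]
  refine (coveringNumber_le_card (c := c.image (f ∘ g)) ?_).trans Finset.card_image_le
  rintro _ ⟨b, hb, rfl⟩
  have := hc' hb
  simp only [Set.mem_iUnion, exists_prop] at this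
  obtain ⟨x, hx, hbx⟩ := this
  obtain ⟨h1, h2⟩ := hg x ⟨b, hb, hbx⟩
  refine Set.mem_iUnion₂.2 ⟨f (g x), Finset.mem_image.2 ⟨x, hx, rfl⟩, ?_⟩
  rw [mem_ball, dist_eq_norm]
  have h3 : ‖b - g x‖ < 2 * r := by
    rw [← dist_eq_norm]
    have := dist_triangle_right b (g x) x
    rw [mem_ball] at hbx h2
    linarith
  have := hf b hb _ h1
  nlinarith

end Covering

end ConformalIFS

/-! ### Box dimensions on the logarithmic scale. -/

namespace ConformalIFS

section BoxDim

open Metric Bornology Filter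

variable {d : ℕ} {A B : Set (E d)}

/-- The logarithm of the covering number at scale `exp (-u)`. -/
noncomputable def logCov (A : Set (E d)) (u : ℝ) : ℝ :=
  Real.log (coveringNumber (Real.exp (-u)) A)

theorem nhdsGT_zero_eq_map : 𝓝[>] (0 : ℝ) = map (fun u : ℝ => Real.exp (-u)) atTop := by
  rw [← Real.map_exp_atBot, ← map_neg_atTop, map_map]
  rfl

theorem boxEstimate_exp (A : Set (E d)) (u : ℝ) :
    boxEstimate A (Real.exp (-u)) = ENNReal.ofReal (logCov A u / u) := by
  simp [boxEstimate, logCov, ← Real.exp_neg]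

theorem lowerBoxDim_eq (A : Set (E d)) :
    lowerBoxDim A = liminf (fun u => ENNReal.ofReal (logCov A u / u)) atTop := by
  simp only [lowerBoxDim, nhdsGT_zero_eq_map, ← boxEstimate_exp, liminf, map_map]
  rfl

theorem upperBoxDim_eq (A : Set (E d)) :
    upperBoxDim A = limsup (fun u => ENNReal.ofReal (logCov A u / u)) atTop := by
  simp only [upperBoxDim, nhdsGT_zero_eq_map, ← boxEstimate_exp, limsup, map_map]
  rfl

theorem logCov_nonneg (A : Set (E d)) (u : ℝ) : 0 ≤ logCov A u :=
  Real.log_natCast_nonneg _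

theorem exp_logCov (hA : IsBounded A) (hne : A.Nonempty) (u : ℝ) :
    Real.exp (logCov A u) = coveringNumber (Real.exp (-u)) A := by
  rw [logCov, Real.exp_log]
  have := one_le_coveringNumber hA (Real.exp_pos (-u)) hne
  exact_mod_cast this

theorem logCov_mono_set (hB : IsBounded B) (hne : A.Nonempty) (h : A ⊆ B) (u : ℝ) :
    logCov A u ≤ logCov B u := by
  have h1 := one_le_coveringNumber (hB.subset h) (Real.exp_pos (-u)) hne
  refine Real.log_le_log (by exact_mod_cast h1) ?_
  exact_mod_cast coveringNumber_mono hB (Real.exp_pos (-u)) h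

theorem logCov_mono (hA : IsBounded A) (hne : A.Nonempty) {u v : ℝ} (h : u ≤ v) :
    logCov A u ≤ logCov A v := by
  have h1 := one_le_coveringNumber hA (Real.exp_pos (-u)) hne
  refine Real.log_le_log (by exact_mod_cast h1) ?_
  exact_mod_cast coveringNumber_anti hA (Real.exp_pos (-v)) (Real.exp_le_exp.2 (neg_le_neg h))

/-- A ball of radius `e^{-u}` is covered by a constant times `e^{d (v - u)}` balls of radius
`e^{-v}`. With `logCov_mono`, this is the only regularity of covering functions used for the
inclusion. -/
theorem logCov_le_add (hA : IsBounded A) (hne : A.Nonempty) {u v : ℝ} (h : u ≤ v) :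
    logCov A v ≤ logCov A u + d * (v - u) + Real.log (gridConst d) := by
  have h1 := coveringNumber_le_mul hA (Real.exp_pos (-v))
    (Real.exp_le_exp.2 (neg_le_neg h))
  rw [← exp_logCov hA hne, ← exp_logCov hA hne, ← Real.exp_sub, ← Real.exp_nat_mul] at h1
  have h2 : gridConst d = Real.exp (Real.log (gridConst d)) :=
    (Real.exp_log (by linarith [one_le_gridConst d])).symm
  rw [h2, ← Real.exp_add, ← Real.exp_add, Real.exp_le_exp] at h1
  linarith

theorem log_gridConst_nonneg (d : ℕ) : 0 ≤ Real.log (gridConst d) :=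
  Real.log_nonneg (one_le_gridConst d)

theorem logCov_le_linear (hA : IsBounded A) (hne : A.Nonempty) :
    ∃ C, 0 ≤ C ∧ ∀ u, 0 ≤ u → logCov A u ≤ d * u + C := by
  refine ⟨logCov A 0 + Real.log (gridConst d),
    add_nonneg (logCov_nonneg _ _) (log_gridConst_nonneg d), fun u hu => ?_⟩
  have := logCov_le_add hA hne hu
  linarith

theorem upperBoxDim_le {t : ℝ} (h : ∀ ε > 0, ∀ᶠ u in atTop, logCov A u ≤ (t + ε) * u) :
    upperBoxDim A ≤ ENNReal.ofReal t := by
  rw [upperBoxDim_eq]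
  refine ENNReal.le_of_forall_pos_le_add fun ε hε _ => ?_
  refine limsup_le_of_le (by isBoundedDefault) ?_
  filter_upwards [h ε hε, eventually_gt_atTop 0] with u hu hu0
  calc ENNReal.ofReal (logCov A u / u) ≤ ENNReal.ofReal (t + ε) :=
        ENNReal.ofReal_le_ofReal ((div_le_iff₀ hu0).2 hu)
    _ ≤ ENNReal.ofReal t + ε := by
        simpa using ENNReal.ofReal_add_le (p := t) (q := ε)

theorem le_lowerBoxDim {s : ℝ} (h : ∀ ε > 0, ∀ᶠ u in atTop, (s - ε) * u ≤ logCov A u) :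
    ENNReal.ofReal s ≤ lowerBoxDim A := by
  rw [lowerBoxDim_eq]
  refine ENNReal.le_of_forall_pos_le_add fun ε hε _ => ?_
  have : ENNReal.ofReal (s - ε) ≤ liminf (fun u => ENNReal.ofReal (logCov A u / u)) atTop := by
    refine le_liminf_of_le (by isBoundedDefault) ?_
    filter_upwards [h ε hε, eventually_gt_atTop 0] with u hu hu0
    exact ENNReal.ofReal_le_ofReal ((le_div_iff₀ hu0).2 hu)
  calc ENNReal.ofReal s = ENNReal.ofReal ((s - ε) + ε) := by simp
    _ ≤ ENNReal.ofReal (s - ε) + ENNReal.ofReal ε := ENNReal.ofReal_add_le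
    _ ≤ _ := by rw [ENNReal.ofReal_coe_nnreal]; exact add_le_add_left this _

theorem lowerBoxDim_le {s : ℝ} (h : ∀ ε > 0, ∃ᶠ u in atTop, logCov A u ≤ (s + ε) * u) :
    lowerBoxDim A ≤ ENNReal.ofReal s := by
  rw [lowerBoxDim_eq]
  refine ENNReal.le_of_forall_pos_le_add fun ε hε _ => ?_
  refine liminf_le_of_frequently_le ?_ (by isBoundedDefault)
  refine ((h ε hε).and_eventually (eventually_gt_atTop 0)).mono ?_
  rintro u ⟨hu, hu0⟩
  calc ENNReal.ofReal (logCov A u / u) ≤ ENNReal.ofReal (s + ε) :=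
        ENNReal.ofReal_le_ofReal ((div_le_iff₀ hu0).2 hu)
    _ ≤ ENNReal.ofReal s + ε := by
        simpa using ENNReal.ofReal_add_le (p := s) (q := ε)

theorem le_upperBoxDim {t : ℝ} (h : ∀ ε > 0, ∃ᶠ u in atTop, (t - ε) * u ≤ logCov A u) :
    ENNReal.ofReal t ≤ upperBoxDim A := by
  rw [upperBoxDim_eq]
  refine ENNReal.le_of_forall_pos_le_add fun ε hε _ => ?_
  have : ENNReal.ofReal (t - ε) ≤ limsup (fun u => ENNReal.ofReal (logCov A u / u)) atTop := by
    refine le_limsup_of_frequently_le ?_ (by isBoundedDefault)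
    refine ((h ε hε).and_eventually (eventually_gt_atTop 0)).mono ?_
    rintro u ⟨hu, hu0⟩
    exact ENNReal.ofReal_le_ofReal ((le_div_iff₀ hu0).2 hu)
  calc ENNReal.ofReal t = ENNReal.ofReal ((t - ε) + ε) := by simp
    _ ≤ ENNReal.ofReal (t - ε) + ENNReal.ofReal ε := ENNReal.ofReal_add_le
    _ ≤ _ := by rw [ENNReal.ofReal_coe_nnreal]; exact add_le_add_left this _

theorem lowerBoxDim_le_upperBoxDim (A : Set (E d)) : lowerBoxDim A ≤ upperBoxDim A := by
  rw [lowerBoxDim_eq, upperBoxDim_eq]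
  exact liminf_le_limsup

theorem lowerBoxDim_mono (hB : IsBounded B) (hne : A.Nonempty) (h : A ⊆ B) :
    lowerBoxDim A ≤ lowerBoxDim B := by
  rw [lowerBoxDim_eq, lowerBoxDim_eq]
  refine liminf_le_liminf ?_
  filter_upwards [eventually_gt_atTop 0] with u hu
  apply ENNReal.ofReal_le_ofReal
  gcongr
  exact logCov_mono_set hB hne h u

theorem upperBoxDim_le_dim (hA : IsBounded A) (hne : A.Nonempty) : upperBoxDim A ≤ d := by
  obtain ⟨C, hC0, hC⟩ := logCov_le_linear hA hne
  have := upperBoxDim_le (A := A) (t := d) fun ε hε => by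
    filter_upwards [eventually_ge_atTop 0, eventually_ge_atTop (C / ε)] with u h0 h1
    have := hC u h0
    rw [div_le_iff₀ hε] at h1
    linarith
  simpa using this

theorem eventually_logCov_le {t : ℝ≥0} (h : upperBoxDim A ≤ t) {ε : ℝ} (hε : 0 < ε) :
    ∀ᶠ u in atTop, logCov A u ≤ (t + ε) * u := by
  rw [upperBoxDim_eq] at h
  have h1 : limsup (fun u => ENNReal.ofReal (logCov A u / u)) atTop <
      ENNReal.ofReal (t + ε) := by
    refine h.trans_lt ?_
    rw [← ENNReal.ofReal_coe_nnreal]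
    exact (ENNReal.ofReal_lt_ofReal_iff (by positivity)).2 (by linarith)
  filter_upwards [eventually_lt_of_limsup_lt h1, eventually_gt_atTop 0] with u hu hu0
  have := (ENNReal.ofReal_lt_ofReal_iff (by positivity)).1 hu
  rw [div_lt_iff₀ hu0] at this
  exact this.le

/-- Below the threshold `u₀` of the asymptotic bound, monotonicity bounds the function by its value
at `u₀`, which serves as the additive constant. -/
theorem exists_logCov_le (hA : IsBounded A) (hne : A.Nonempty) {t : ℝ≥0}
    (h : upperBoxDim A ≤ t) {ε : ℝ} (hε : 0 < ε) :
    ∃ C, 0 ≤ C ∧ ∀ u, 0 ≤ u → logCov A u ≤ (t + ε) * u + C := by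
  obtain ⟨u₀, hu₀⟩ := eventually_atTop.1 (eventually_logCov_le h hε)
  refine ⟨logCov A u₀, logCov_nonneg _ _, fun u hu => ?_⟩
  rcases le_total u₀ u with h1 | h1
  · linarith [hu₀ u h1, logCov_nonneg A u₀]
  · have := logCov_mono hA hne h1
    have : 0 ≤ (t + ε) * u := by positivity
    linarith

theorem frequently_logCov_le {s : ℝ≥0} (h : lowerBoxDim A ≤ s) {ε : ℝ} (hε : 0 < ε) :
    ∃ᶠ u in atTop, logCov A u ≤ (s + ε) * u := by
  rw [lowerBoxDim_eq] at h
  have h1 : liminf (fun u => ENNReal.ofReal (logCov A u / u)) atTop <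
      ENNReal.ofReal (s + ε) := by
    refine h.trans_lt ?_
    rw [← ENNReal.ofReal_coe_nnreal]
    exact (ENNReal.ofReal_lt_ofReal_iff (by positivity)).2 (by linarith)
  refine ((frequently_lt_of_liminf_lt (by isBoundedDefault) h1).and_eventually
    (eventually_gt_atTop 0)).mono ?_
  rintro u ⟨hu, hu0⟩
  have := (ENNReal.ofReal_lt_ofReal_iff (by positivity)).1 hu
  rw [div_lt_iff₀ hu0] at this
  exact this.le

theorem dimH_le_lowerBoxDim (hA : IsBounded A) (hne : A.Nonempty) : dimH A ≤ lowerBoxDim A := by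
  refine ENNReal.le_of_forall_pos_le_add fun ε hε hfin => ?_
  lift lowerBoxDim A to ℝ≥0 using hfin.ne with s hs
  rw [← ENNReal.coe_add]
  apply dimH_le_of_hausdorffMeasure_ne_top
  have hfreq := frequently_logCov_le hs.symm.le (NNReal.coe_pos.2 hε)
  -- Restricting `atTop` to the good scales turns the frequent bound into an eventual one; along `l`
  -- the covers by balls of radius `e^{-u}` have bounded sums.
  set l : Filter ℝ := atTop ⊓ 𝓟 {u | logCov A u ≤ (s + ε) * u} with hl
  have : l.NeBot := frequently_iff_neBot.1 hfreq
  have hex : ∀ u : ℝ, ∃ c : Finset (E d), c.card = coveringNumber (Real.exp (-u)) A ∧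
      A ⊆ ⋃ x ∈ c, ball x (Real.exp (-u)) := fun u => exists_cover_card hA (Real.exp_pos _)
  choose c hc hc' using hex
  have hdiam : ∀ (u : ℝ) (x : E d), ediam (ball x (Real.exp (-u))) ≤
      ENNReal.ofReal (2 * Real.exp (-u)) := by
    intro u x
    rw [← Metric.eball_ofReal]
    refine Metric.ediam_eball_le.trans ?_
    rw [ENNReal.ofReal_mul zero_le_two]
    simp
  have key := MeasureTheory.Measure.hausdorffMeasure_le_liminf_sum (ι := fun u => c u)
    (((s + ε : ℝ≥0) : ℝ)) A (l := l)
    (fun u => ENNReal.ofReal (2 * Real.exp (-u))) ?_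
    (fun u x => ball (x : E d) (Real.exp (-u))) (Eventually.of_forall fun u x => hdiam u x)
    (Eventually.of_forall fun u => by simpa [Set.iUnion_subtype] using hc' u)
  · refine ne_top_of_le_ne_top (b := ENNReal.ofReal (2 ^ ((s + ε : ℝ≥0) : ℝ)))
      ENNReal.ofReal_ne_top (key.trans ?_)
    refine (liminf_le_liminf (v := fun _ => ENNReal.ofReal (2 ^ ((s + ε : ℝ≥0) : ℝ))) ?_).trans
      (by rw [liminf_const])
    filter_upwards [mem_inf_of_right (mem_principal_self _)] with u hu
    calc ∑ x : c u, ediam (ball (x : E d) (Real.exp (-u))) ^ ((s + ε : ℝ≥0) : ℝ)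
        ≤ ∑ _x : c u, ENNReal.ofReal (2 * Real.exp (-u)) ^ ((s + ε : ℝ≥0) : ℝ) := by
          refine Finset.sum_le_sum fun x _ => ?_
          gcongr
          exact hdiam u x
      _ = ENNReal.ofReal (Real.exp (logCov A u) *
            (2 ^ ((s + ε : ℝ≥0) : ℝ) * Real.exp (-((s + ε : ℝ≥0) * u)))) := by
          rw [Finset.sum_const, Finset.card_univ, Fintype.card_coe, hc, nsmul_eq_mul,
            exp_logCov hA hne, ENNReal.ofReal_mul (Nat.cast_nonneg _), ENNReal.ofReal_natCast,
            ENNReal.ofReal_rpow_of_nonneg (by positivity) (by positivity),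
            Real.mul_rpow (by positivity) (by positivity), ← Real.exp_mul]
          congr 4
          ring
      _ ≤ ENNReal.ofReal (2 ^ ((s + ε : ℝ≥0) : ℝ)) := by
          apply ENNReal.ofReal_le_ofReal
          rw [mul_left_comm, ← Real.exp_add]
          refine mul_le_of_le_one_right (by positivity) (Real.exp_le_one_iff.2 ?_)
          push_cast
          have : logCov A u ≤ (s + ε) * u := hu
          linarith
  · have : Tendsto (fun u : ℝ => ENNReal.ofReal (2 * Real.exp (-u))) atTop (𝓝 0) := by
      rw [← ENNReal.ofReal_zero]
      apply ENNReal.tendsto_ofReal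
      simpa using (Real.tendsto_exp_neg_atTop_nhds_zero.const_mul 2)
    exact this.mono_left inf_le_left

theorem dimH_le_dim (A : Set (E d)) : dimH A ≤ d := by
  refine (dimH_mono (Set.subset_univ A)).trans ?_
  rw [Real.dimH_univ_eq_finrank]
  simp

end BoxDim

end ConformalIFS

/-! ### Conformal maps: distortion, Lipschitz bounds and volumes. -/

namespace ConformalIFS

section ConformalMap

variable {d : ℕ}

theorem norm_pos_of_isConformalMap [NeZero d] {f : E d →L[ℝ] E d} (hf : IsConformalMap f) :
    0 < ‖f‖ := by
  obtain ⟨c, hc, li, rfl⟩ := hf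
  simpa [norm_smul, LinearIsometry.norm_toContinuousLinearMap] using hc

theorem norm_comp_of_isConformalMap [NeZero d] {f g : E d →L[ℝ] E d} (hf : IsConformalMap f) :
    ‖f.comp g‖ = ‖f‖ * ‖g‖ := by
  obtain ⟨c, -, li, rfl⟩ := hf
  have h : ‖li.toContinuousLinearMap.comp g‖ = ‖g‖ := li.norm_toContinuousLinearMap_comp
  simp [norm_smul, LinearIsometry.norm_toContinuousLinearMap, h]

theorem abs_det_of_isConformalMap [NeZero d] {f : E d →L[ℝ] E d} (hf : IsConformalMap f) :
    |f.det| = ‖f‖ ^ d := by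
  obtain ⟨c, -, li, rfl⟩ := hf
  have h1 : |LinearMap.det (li.toLinearMap)| = 1 := by
    rw [← LinearMap.normDet_eq_abs_det, LinearIsometry.normDet_eq_one]
  have h2 : (c • li.toContinuousLinearMap).det = c ^ d * LinearMap.det li.toLinearMap := by
    rw [ContinuousLinearMap.det, ContinuousLinearMap.toLinearMap_smul, LinearMap.det_smul]
    simp
  rw [h2, abs_mul, h1]
  simp [norm_smul, LinearIsometry.norm_toContinuousLinearMap]

end ConformalMap

/-- The properties of a conformal iterated function system that the estimates below use, with a
base point `x₀` in the interior of `X` and the distortion constant `K` on `V`. -/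
structure ConfSys {d : ℕ} {ι : Type*} (S : ι → E d → E d) (X V : Set (E d)) (x₀ : E d) (K : ℝ) :
    Prop where
  isCompact : IsCompact X
  isPreconnected : IsPreconnected X
  isOpen : IsOpen V
  subset : X ⊆ V
  mapsTo : ∀ i, Set.MapsTo (S i) X X
  injOn : ∀ i, Set.InjOn (S i) X
  mapsTo_nhd : ∀ i, Set.MapsTo (S i) V V
  conformalAt : ∀ i, ∀ x ∈ V, ConformalAt (S i) x
  contracting : ∃ c : ℝ, 0 < c ∧ c < 1 ∧
    ∀ i, ∀ x ∈ X, ∀ y ∈ X, ‖S i x - S i y‖ ≤ c * ‖x - y‖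
  one_le : 1 ≤ K
  distortion : ∀ w : List ι, ∀ x ∈ V, ∀ y ∈ V,
    ‖fderiv ℝ (wordMap S w) x‖ ≤ K * ‖fderiv ℝ (wordMap S w) y‖
  mem_interior : x₀ ∈ interior X
  mapsTo_interior : ∀ i, Set.MapsTo (S i) (interior X) (interior X)
  disjoint : ∀ i j, i ≠ j → Disjoint (S i '' interior X) (S j '' interior X)

theorem IsCIFS.exists_confSys {d : ℕ} {ι : Type*} {S : ι → E d → E d} {X : Set (E d)}
    (h : IsCIFS S X) : ∃ V x₀ K, ConfSys S X V x₀ K := by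
  obtain ⟨V, hV, -, -, hXV, h1, K, hK, h2⟩ := h.conformal
  obtain ⟨x₀, hx₀⟩ := h.interior_nonempty
  exact ⟨V, x₀, K, h.isCompact, h.isConnected.isPreconnected, hV, hXV, h.mapsTo, h.injOn,
    fun i => (h1 i).1, fun i => (h1 i).2.2.1, h.contracting, hK, h2, hx₀, h.mapsTo_interior,
    h.disjoint⟩

/-- The contraction ratio of the map along the word `w`, read off at the point `x₀`. -/
noncomputable def ratio {d : ℕ} {ι : Type*} (S : ι → E d → E d) (x₀ : E d) (w : List ι) : ℝ :=
  ‖fderiv ℝ (wordMap S w) x₀‖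

theorem wordMap_append {d : ℕ} {ι : Type*} (S : ι → E d → E d) (u v : List ι) :
    wordMap S (u ++ v) = wordMap S u ∘ wordMap S v := by
  induction u with
  | nil => rfl
  | cons i u ih => simp only [List.cons_append, wordMap, ih]; rfl

namespace ConfSys

variable {d : ℕ} {ι : Type*} {S : ι → E d → E d} {X V : Set (E d)} {x₀ : E d} {K : ℝ}

theorem mapsTo_word (h : ConfSys S X V x₀ K) (w : List ι) : Set.MapsTo (wordMap S w) X X := by
  induction w with
  | nil => exact Set.mapsTo_id X
  | cons i w ih => exact (h.mapsTo i).comp ih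

theorem mapsTo_nhd_word (h : ConfSys S X V x₀ K) (w : List ι) :
    Set.MapsTo (wordMap S w) V V := by
  induction w with
  | nil => exact Set.mapsTo_id V
  | cons i w ih => exact (h.mapsTo_nhd i).comp ih

theorem mapsTo_interior_word (h : ConfSys S X V x₀ K) (w : List ι) :
    Set.MapsTo (wordMap S w) (interior X) (interior X) := by
  induction w with
  | nil => exact Set.mapsTo_id _
  | cons i w ih => exact (h.mapsTo_interior i).comp ih

theorem injOn_word (h : ConfSys S X V x₀ K) (w : List ι) : Set.InjOn (wordMap S w) X := by
  induction w with
  | nil => exact Set.injOn_id X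
  | cons i w ih => exact (h.injOn i).comp ih (h.mapsTo_word w)

theorem conformalAt_word (h : ConfSys S X V x₀ K) (w : List ι) :
    ∀ x ∈ V, ConformalAt (wordMap S w) x := by
  induction w with
  | nil => exact fun x _ => conformalAt_id x
  | cons i w ih =>
    exact fun x hx => (h.conformalAt i _ (h.mapsTo_nhd_word w hx)).comp x (ih x hx)

theorem differentiableAt_word (h : ConfSys S X V x₀ K) (w : List ι) {x : E d} (hx : x ∈ V) :
    DifferentiableAt ℝ (wordMap S w) x :=
  (h.conformalAt_word w x hx).differentiableAt

theorem isConformalMap_fderiv (h : ConfSys S X V x₀ K) (w : List ι) {x : E d} (hx : x ∈ V) :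
    IsConformalMap (fderiv ℝ (wordMap S w) x) :=
  conformalAt_iff_isConformalMap_fderiv.1 (h.conformalAt_word w x hx)

theorem base_mem (h : ConfSys S X V x₀ K) : x₀ ∈ V := h.subset (interior_subset h.mem_interior)

theorem K_pos (h : ConfSys S X V x₀ K) : 0 < K := zero_lt_one.trans_le h.one_le

theorem norm_fderiv_le (h : ConfSys S X V x₀ K) (w : List ι) {x : E d} (hx : x ∈ V) :
    ‖fderiv ℝ (wordMap S w) x‖ ≤ K * ratio S x₀ w :=
  h.distortion w x hx x₀ h.base_mem

theorem ratio_le_norm_fderiv (h : ConfSys S X V x₀ K) (w : List ι) {x : E d} (hx : x ∈ V) :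
    ratio S x₀ w ≤ K * ‖fderiv ℝ (wordMap S w) x‖ :=
  h.distortion w x₀ h.base_mem x hx

theorem ratio_pos [NeZero d] (h : ConfSys S X V x₀ K) (w : List ι) : 0 < ratio S x₀ w :=
  norm_pos_of_isConformalMap (h.isConformalMap_fderiv w h.base_mem)

theorem norm_fderiv_append [NeZero d] (h : ConfSys S X V x₀ K) (u v : List ι) {x : E d}
    (hx : x ∈ V) : ‖fderiv ℝ (wordMap S (u ++ v)) x‖ =
      ‖fderiv ℝ (wordMap S u) (wordMap S v x)‖ * ‖fderiv ℝ (wordMap S v) x‖ := by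
  have hy := h.mapsTo_nhd_word v hx
  rw [wordMap_append, fderiv_comp x (h.differentiableAt_word u hy) (h.differentiableAt_word v hx),
    norm_comp_of_isConformalMap (h.isConformalMap_fderiv u hy)]

/-- Norms of conformal derivatives multiply exactly in the chain rule, but the outer derivative is
taken at `S_v x₀`; moving it back to `x₀` costs one factor `K`. -/
theorem ratio_mul_le [NeZero d] (h : ConfSys S X V x₀ K) (u v : List ι) :
    ratio S x₀ u * ratio S x₀ v ≤ K * ratio S x₀ (u ++ v) := by
  rw [ratio, ratio, ratio, h.norm_fderiv_append u v h.base_mem, ← mul_assoc]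
  exact mul_le_mul_of_nonneg_right
    (h.ratio_le_norm_fderiv u (h.mapsTo_nhd_word v h.base_mem)) (norm_nonneg _)

theorem ratio_nil [NeZero d] (S : ι → E d → E d) (x₀ : E d) : ratio S x₀ [] = 1 := by
  simp [ratio, wordMap]

theorem norm_word_sub_le (h : ConfSys S X V x₀ K) {c : ℝ} (hc : 0 ≤ c)
    (hS : ∀ i, ∀ x ∈ X, ∀ y ∈ X, ‖S i x - S i y‖ ≤ c * ‖x - y‖) (w : List ι) :
    ∀ x ∈ X, ∀ y ∈ X, ‖wordMap S w x - wordMap S w y‖ ≤ c ^ w.length * ‖x - y‖ := by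
  induction w with
  | nil => intro x _ y _; simp [wordMap]
  | cons i w ih =>
    intro x hx y hy
    calc ‖S i (wordMap S w x) - S i (wordMap S w y)‖
        ≤ c * ‖wordMap S w x - wordMap S w y‖ :=
          hS i _ (h.mapsTo_word w hx) _ (h.mapsTo_word w hy)
      _ ≤ c * (c ^ w.length * ‖x - y‖) := by gcongr; exact ih x hx y hy
      _ = c ^ (i :: w).length * ‖x - y‖ := by rw [List.length_cons, pow_succ]; ring

theorem ratio_le_pow (h : ConfSys S X V x₀ K) {c : ℝ} (hc : 0 ≤ c)
    (hS : ∀ i, ∀ x ∈ X, ∀ y ∈ X, ‖S i x - S i y‖ ≤ c * ‖x - y‖) (w : List ι) :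
    ratio S x₀ w ≤ c ^ w.length := by
  have hlip : LipschitzOnWith ⟨c ^ w.length, by positivity⟩ (wordMap S w) X :=
    LipschitzOnWith.of_dist_le_mul fun x hx y hy => by
      rw [dist_eq_norm, dist_eq_norm]
      exact h.norm_word_sub_le hc hS w x hx y hy
  exact norm_fderiv_le_of_lipschitzOn ℝ (mem_interior_iff_mem_nhds.1 h.mem_interior) hlip

/-- The maps along finite words are Lipschitz on `X`, uniformly in terms of their ratios. -/
theorem exists_lipschitz [NeZero d] (h : ConfSys S X V x₀ K) :
    ∃ C, 0 < C ∧ ∀ w : List ι, ∀ x ∈ X, ∀ y ∈ X,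
      ‖wordMap S w x - wordMap S w y‖ ≤ C * ratio S x₀ w * ‖x - y‖ := by
  obtain ⟨δ, hδ, hδV⟩ := h.isCompact.exists_thickening_subset_open h.isOpen h.subset
  -- `V` need not be convex, so the mean value inequality is applied on balls of the uniform radius
  -- `δ` that fit into `V`.
  have hloc : ∀ w : List ι, ∀ x ∈ X, ∀ y ∈ X, ‖y - x‖ < δ →
      ‖wordMap S w y - wordMap S w x‖ ≤ K * ratio S x₀ w * ‖y - x‖ := by
    intro w x hx y _ hxy
    have hsub : Metric.ball x δ ⊆ V :=
      fun z hz => hδV (Metric.mem_thickening_iff.2 ⟨x, hx, hz⟩)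
    exact (convex_ball x δ).norm_image_sub_le_of_norm_fderiv_le (𝕜 := ℝ)
      (fun z hz => h.differentiableAt_word w (hsub hz))
      (fun z hz => h.norm_fderiv_le w (hsub hz)) (Metric.mem_ball_self hδ)
      (by rwa [Metric.mem_ball, dist_eq_norm])
  -- Connectedness of `X` chains the local estimates. The constant depends on the pair of points but
  -- not on the word.
  have hchain : ∀ x ∈ X, ∀ y ∈ X, ∃ C, ∀ w : List ι,
      ‖wordMap S w y - wordMap S w x‖ ≤ C * ratio S x₀ w := by
    intro x hx y hy
    refine h.isPreconnected.induction₂ (fun x y => ∃ C, ∀ w : List ι,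
      ‖wordMap S w y - wordMap S w x‖ ≤ C * ratio S x₀ w) ?_ ?_ ?_ hx hy
    · intro x hx
      filter_upwards [self_mem_nhdsWithin, mem_nhdsWithin_of_mem_nhds (Metric.ball_mem_nhds x hδ)]
        with y hyX hy
      rw [Metric.mem_ball, dist_eq_norm] at hy
      refine ⟨K * ‖y - x‖, fun w => ?_⟩
      have := hloc w x hx y hyX hy
      linarith
    · rintro x y z - - - ⟨C, hC⟩ ⟨C', hC'⟩
      refine ⟨C + C', fun w => ?_⟩
      have := norm_sub_le_norm_sub_add_norm_sub (wordMap S w z) (wordMap S w y) (wordMap S w x)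
      linarith [hC w, hC' w]
    · rintro x y - - ⟨C, hC⟩
      exact ⟨C, fun w => by rw [norm_sub_rev]; exact hC w⟩
  have hx₀ : x₀ ∈ X := interior_subset h.mem_interior
  -- Compactness removes the dependence on the points: finitely many centres have a common constant
  -- `M`, and the last step to `x` is local.
  obtain ⟨t, htX, ht, hXt⟩ := h.isCompact.finite_cover_balls hδ
  have : ∀ y, ∃ C, y ∈ X → ∀ w : List ι,
      ‖wordMap S w y - wordMap S w x₀‖ ≤ C * ratio S x₀ w := fun y => by
    by_cases hy : y ∈ X
    · obtain ⟨C, hC⟩ := hchain x₀ hx₀ y hy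
      exact ⟨C, fun _ => hC⟩
    · exact ⟨0, fun h => absurd h hy⟩
  choose g hg using this
  obtain ⟨M, hM⟩ := (ht.image g).bddAbove
  have hbound : ∀ w : List ι, ∀ x ∈ X,
      ‖wordMap S w x - wordMap S w x₀‖ ≤ (|M| + K * δ) * ratio S x₀ w := by
    intro w x hx
    have hL := h.ratio_pos w
    obtain ⟨y, hy, hxy⟩ := Set.mem_iUnion₂.1 (hXt hx)
    rw [Metric.mem_ball, dist_eq_norm] at hxy
    have h1 := hloc w y (htX hy) x hx hxy
    have h2 := hg y (htX hy) w
    have h3 : g y ≤ |M| := (hM (Set.mem_image_of_mem g hy)).trans (le_abs_self M)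
    have := norm_sub_le_norm_sub_add_norm_sub (wordMap S w x) (wordMap S w y) (wordMap S w x₀)
    have h4 : K * ratio S x₀ w * ‖x - y‖ ≤ K * ratio S x₀ w * δ := by
      have := h.K_pos
      gcongr
    have h5 : g y * ratio S x₀ w ≤ |M| * ratio S x₀ w := by gcongr
    linarith
  have hK := h.K_pos
  -- The first summand serves pairs closer than `δ`. For the others, the detour through `x₀` costs
  -- `2 (|M| + K δ)` times the ratio, and `1 ≤ ‖x - y‖ / δ`.
  refine ⟨K + 2 * (|M| + K * δ) / δ, by positivity, fun w x hx y hy => ?_⟩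
  have hL := h.ratio_pos w
  rcases lt_or_ge ‖x - y‖ δ with hlt | hge
  · refine (hloc w y hy x hx hlt).trans ?_
    gcongr
    have : 0 ≤ 2 * (|M| + K * δ) / δ := by positivity
    linarith
  · have h1 := norm_sub_le_norm_sub_add_norm_sub (wordMap S w x) (wordMap S w x₀) (wordMap S w y)
    have h2 := hbound w x hx
    have h3 := hbound w y hy
    rw [norm_sub_rev] at h3
    calc ‖wordMap S w x - wordMap S w y‖ ≤ 2 * (|M| + K * δ) / δ * ratio S x₀ w * δ := by
          have : 2 * (|M| + K * δ) / δ * ratio S x₀ w * δ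
            = 2 * ((|M| + K * δ) * ratio S x₀ w) := by field_simp
          linarith
      _ ≤ (K + 2 * (|M| + K * δ) / δ) * ratio S x₀ w * ‖x - y‖ := by
          gcongr
          linarith

/-- Words that are not comparable give disjoint images of the interior of `X`. -/
theorem disjoint_word (h : ConfSys S X V x₀ K) :
    ∀ u v : List ι, ¬ u <+: v → ¬ v <+: u →
      Disjoint (wordMap S u '' interior X) (wordMap S v '' interior X)
  | [], v, hu, _ => absurd (List.nil_prefix) hu
  | i :: u, [], _, hv => absurd (List.nil_prefix) hv
  | i :: u, j :: v, hu, hv => by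
    simp only [wordMap, Set.image_comp]
    by_cases hij : i = j
    · subst hij
      have := h.disjoint_word u v (fun h' => hu (by simpa using h')) (fun h' => hv (by simpa using h'))
      refine Set.disjoint_image_image fun b hb c hc hbc => ?_
      have hmem := fun w => (h.mapsTo_interior_word w).image_subset.trans (interior_subset (s := X))
      have := h.injOn i (hmem u hb) (hmem v hc) hbc
      subst this
      exact (Set.disjoint_left.1 ‹_› hb) hc
    · exact (h.disjoint i j hij).mono (Set.image_mono (h.mapsTo_interior_word u).image_subset)
        (Set.image_mono (h.mapsTo_interior_word v).image_subset)

/-- The image of the interior of `X` along a word has volume comparable to the `d`-th power of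
the ratio of the word. -/
theorem volume_word_ge [NeZero d] (h : ConfSys S X V x₀ K) (w : List ι) :
    ENNReal.ofReal ((ratio S x₀ w / K) ^ d) * MeasureTheory.volume (interior X) ≤
      MeasureTheory.volume (wordMap S w '' interior X) := by
  have hsub : interior X ⊆ V := interior_subset.trans h.subset
  rw [← MeasureTheory.lintegral_abs_det_fderiv_eq_addHaar_image _ isOpen_interior.measurableSet
    (fun x hx => (h.differentiableAt_word w (hsub hx)).hasFDerivAt.hasFDerivWithinAt)
    ((h.injOn_word w).mono interior_subset), ← MeasureTheory.setLIntegral_const]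
  refine MeasureTheory.setLIntegral_mono' isOpen_interior.measurableSet fun x hx => ?_
  apply ENNReal.ofReal_le_ofReal
  rw [abs_det_of_isConformalMap (h.isConformalMap_fderiv w (hsub hx))]
  have := h.K_pos
  have := h.ratio_pos w
  gcongr
  rw [div_le_iff₀' ‹0 < K›]
  exact h.ratio_le_norm_fderiv w (hsub hx)

end ConfSys

end ConformalIFS

/-! ### Coding of the limit set and counting of words. -/

namespace ConformalIFS

section Coding

variable {ι : Type*}

/-- The prefix of length `n` of an infinite word. -/
def pref (γ : ℕ → ι) (n : ℕ) : List ι := List.ofFn fun k : Fin n => γ k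

@[simp] theorem length_pref (γ : ℕ → ι) (n : ℕ) : (pref γ n).length = n := by simp [pref]

@[simp] theorem pref_zero (γ : ℕ → ι) : pref γ 0 = [] := by simp [pref]

theorem pref_succ (γ : ℕ → ι) (n : ℕ) : pref γ (n + 1) = pref γ n ++ [γ n] := by
  rw [pref, List.ofFn_succ_last]
  rfl

theorem pref_succ' (γ : ℕ → ι) (n : ℕ) :
    pref γ (n + 1) = γ 0 :: pref (fun k => γ (k + 1)) n := by
  simp [pref, List.ofFn_succ]

theorem pref_inj {γ γ' : ℕ → ι} {n : ℕ} : pref γ n = pref γ' n ↔ ∀ k < n, γ k = γ' k := by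
  rw [pref, pref, List.ofFn_inj, funext_iff]
  exact ⟨fun h k hk => h ⟨k, hk⟩, fun h k => h k k.2⟩

theorem pref_prefix (γ : ℕ → ι) {m n : ℕ} (h : m ≤ n) : pref γ m <+: pref γ n := by
  induction n, h using Nat.le_induction with
  | base => exact List.prefix_rfl
  | succ n _ ih => exact ih.trans (pref_succ γ n ▸ List.prefix_append _ _)

theorem eq_pref_of_prefix {γ : ℕ → ι} {n : ℕ} {w : List ι} (h : w <+: pref γ n) :
    w = pref γ w.length ∧ w.length ≤ n := by
  have hl : w.length ≤ n := by simpa using h.length_le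
  refine ⟨?_, hl⟩
  have h2 := pref_prefix γ hl
  exact (List.prefix_of_prefix_length_le h h2 (by simp)).eq_of_length (by simp)

variable {d : ℕ} {S : ι → E d → E d} {X : Set (E d)}

theorem mem_limitSet {x : E d} :
    x ∈ limitSet S X ↔ ∃ γ : ℕ → ι, ∀ n, x ∈ wordMap S (pref γ (n + 1)) '' X := by
  simp only [limitSet, Set.mem_iUnion, Set.mem_iInter, pref]

/-- Every set which is covered by the images of itself is contained in the limit set. -/
theorem subset_limitSet {A : Set (E d)} (hA : A ⊆ X) (h : ∀ a ∈ A, ∃ i, ∃ b ∈ A, S i b = a) :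
    A ⊆ limitSet S X := by
  intro a ha
  have : Nonempty ι := (h a ha).nonempty
  choose! i b hb hi using h
  -- The code is read off by iterating the chosen preimage `b`, which never leaves `A`.
  refine mem_limitSet.2 ⟨fun n => i (b^[n] a), fun n => ?_⟩
  have key : ∀ n, b^[n] a ∈ A ∧ wordMap S (pref (fun n => i (b^[n] a)) n) (b^[n] a) = a := by
    intro n
    induction n with
    | zero => exact ⟨ha, by simp [wordMap]⟩
    | succ n ih =>
      rw [Function.iterate_succ_apply', pref_succ, wordMap_append]
      refine ⟨hb _ ih.1, ?_⟩
      simp only [Function.comp_apply, wordMap, id, hi _ ih.1]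
      exact ih.2
  exact ⟨_, hA (key (n + 1)).1, (key (n + 1)).2⟩

namespace ConfSys

variable {V : Set (E d)} {x₀ : E d} {K : ℝ}

theorem limitSet_subset (h : ConfSys S X V x₀ K) : limitSet S X ⊆ X := by
  intro x hx
  obtain ⟨γ, hγ⟩ := mem_limitSet.1 hx
  exact (h.mapsTo_word _).image_subset (hγ 0)

theorem exists_code (h : ConfSys S X V x₀ K) {x : E d} (hx : x ∈ limitSet S X) :
    ∃ γ : ℕ → ι, ∀ n, x ∈ wordMap S (pref γ n) '' X := by
  obtain ⟨γ, hγ⟩ := mem_limitSet.1 hx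
  refine ⟨γ, fun n => ?_⟩
  cases n with
  | zero => exact ⟨x, h.limitSet_subset hx, by simp [wordMap]⟩
  | succ n => exact hγ n

/-- The point is the image under the first map of some point in each cylinder of the shifted code.
Injectivity makes all these points equal. -/
theorem exists_map_eq (h : ConfSys S X V x₀ K) {x : E d} (hx : x ∈ limitSet S X) :
    ∃ i, ∃ y ∈ limitSet S X, S i y = x := by
  obtain ⟨γ, hγ⟩ := mem_limitSet.1 hx
  have : ∀ n, ∃ y ∈ wordMap S (pref (fun k => γ (k + 1)) n) '' X, S (γ 0) y = x := by
    intro n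
    obtain ⟨z, hz, rfl⟩ := hγ n
    rw [pref_succ']
    exact ⟨_, ⟨z, hz, rfl⟩, rfl⟩
  choose y hy hyx using this
  refine ⟨γ 0, y 0, mem_limitSet.2 ⟨fun k => γ (k + 1), fun n => ?_⟩, hyx 0⟩
  have : y 0 = y (n + 1) :=
    h.injOn (γ 0) ((h.mapsTo_word _).image_subset (hy 0))
      ((h.mapsTo_word _).image_subset (hy (n + 1))) ((hyx 0).trans (hyx _).symm)
  rw [this]
  exact hy (n + 1)

/-- Adjoining `S i x` to the limit set keeps the property that each point is an image of a point of
the set. -/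
theorem map_mem_limitSet (h : ConfSys S X V x₀ K) (i : ι) {x : E d} (hx : x ∈ limitSet S X) :
    S i x ∈ limitSet S X := by
  refine subset_limitSet (A := insert (S i x) (limitSet S X))
    (Set.insert_subset (h.mapsTo i (h.limitSet_subset hx)) h.limitSet_subset) ?_
    (Set.mem_insert _ _)
  rintro a (rfl | ha)
  · exact ⟨i, x, Set.mem_insert_of_mem _ hx, rfl⟩
  · obtain ⟨j, y, hy, hj⟩ := h.exists_map_eq ha
    exact ⟨j, y, Set.mem_insert_of_mem _ hy, hj⟩

theorem continuousOn_word (h : ConfSys S X V x₀ K) (w : List ι) :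
    ContinuousOn (wordMap S w) X := fun _ hx =>
  (h.differentiableAt_word w (h.subset hx)).continuousAt.continuousWithinAt

theorem exists_point (h : ConfSys S X V x₀ K) (γ : ℕ → ι) :
    ∃ x, ∀ n, x ∈ wordMap S (pref γ n) '' X := by
  have hc : ∀ n, IsCompact (wordMap S (pref γ n) '' X) :=
    fun n => h.isCompact.image_of_continuousOn (h.continuousOn_word _)
  have := IsCompact.nonempty_iInter_of_sequence_nonempty_isCompact_isClosed
    (fun n => wordMap S (pref γ n) '' X)
    (fun n => by
      rw [pref_succ, wordMap_append, Set.image_comp]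
      exact Set.image_mono (h.mapsTo_word _).image_subset)
    (fun n => ⟨_, Set.mem_image_of_mem _ (interior_subset h.mem_interior)⟩)
    (hc 0) (fun n => (hc n).isClosed)
  simpa [Set.Nonempty] using this

theorem limitSet_nonempty [hι : Nonempty ι] (h : ConfSys S X V x₀ K) :
    (limitSet S X).Nonempty := by
  obtain ⟨x, hx⟩ := h.exists_point fun _ => Classical.arbitrary ι
  exact ⟨x, mem_limitSet.2 ⟨_, fun n => hx (n + 1)⟩⟩

theorem isBounded_limitSet (h : ConfSys S X V x₀ K) : Bornology.IsBounded (limitSet S X) :=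
  h.isCompact.isBounded.subset h.limitSet_subset

/-- A positive bound for the diameter of `X`. -/
theorem exists_diam_le (h : ConfSys S X V x₀ K) :
    ∃ D, 0 < D ∧ ∀ x ∈ X, ∀ y ∈ X, ‖x - y‖ ≤ D := by
  obtain ⟨D, hD⟩ := Metric.isBounded_iff.1 h.isCompact.isBounded
  refine ⟨max D 1, by positivity, fun x hx y hy => ?_⟩
  rw [← dist_eq_norm]
  exact (hD hx hy).trans (le_max_left _ _)

theorem exists_ratio_lt [NeZero d] (h : ConfSys S X V x₀ K) (γ : ℕ → ι) {r : ℝ} (hr : 0 < r) :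
    ∃ n, ratio S x₀ (pref γ n) < r := by
  obtain ⟨c, hc, hc1, hS⟩ := h.contracting
  obtain ⟨n, hn⟩ := exists_pow_lt_of_lt_one hr hc1
  exact ⟨n, (h.ratio_le_pow hc.le hS _).trans_lt (by simpa using hn)⟩

/-- The first prefix at which the ratio drops below `r`. -/
theorem exists_first_ratio_lt [NeZero d] (h : ConfSys S X V x₀ K) (γ : ℕ → ι) {r : ℝ}
    (hr : 0 < r) (hr1 : r ≤ 1) :
    ∃ n, ratio S x₀ (pref γ (n + 1)) < r ∧ ∀ m ≤ n, r ≤ ratio S x₀ (pref γ m) := by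
  classical
  have hex := h.exists_ratio_lt γ hr
  -- The empty word has ratio `1 ≥ r`, so the first drop happens at a positive length.
  obtain ⟨n, hn⟩ : ∃ n, Nat.find hex = n + 1 := by
    refine Nat.exists_eq_succ_of_ne_zero fun h0 => ?_
    have := Nat.find_spec hex
    rw [h0, pref_zero, ratio_nil] at this
    linarith
  refine ⟨n, hn ▸ Nat.find_spec hex, fun m hm => ?_⟩
  exact not_lt.1 (Nat.find_min hex (by omega))

/-- A finite family of pairwise incomparable words whose ratios are at least `a` and whose maps
send `X` into a common ball has bounded cardinality. -/
theorem card_mul_le [NeZero d] (h : ConfSys S X V x₀ K) {F : Finset (List ι)}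
    (hF : ∀ u ∈ F, ∀ v ∈ F, u ≠ v → ¬ u <+: v) {a R : ℝ} (ha : 0 ≤ a) {x : E d} (hR : 0 ≤ R)
    (hFa : ∀ w ∈ F, a ≤ ratio S x₀ w)
    (hFR : ∀ w ∈ F, wordMap S w '' X ⊆ Metric.closedBall x R) :
    F.card * ((a / K) ^ d * MeasureTheory.volume.real (interior X)) ≤
      R ^ d * MeasureTheory.volume.real (Metric.ball (0 : E d) 1) := by
  have hK := h.K_pos
  have hfin : MeasureTheory.volume (interior X) ≠ ∞ :=
    ((MeasureTheory.measure_mono interior_subset).trans_lt h.isCompact.measure_lt_top).ne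
  have hopen : ∀ w, MeasurableSet (wordMap S w '' interior X) := fun w =>
    isOpen_interior.measurableSet.image_of_continuousOn_injOn
      ((h.continuousOn_word w).mono interior_subset) ((h.injOn_word w).mono interior_subset)
  -- Incomparable words give disjoint images of the interior, each of volume at least a constant
  -- times `a ^ d`, all inside one ball.
  have h1 : MeasureTheory.volume (⋃ w ∈ F, wordMap S w '' interior X) ≤
      MeasureTheory.volume (Metric.closedBall x R) :=
    MeasureTheory.measure_mono (Set.iUnion₂_subset fun w hw =>
      (Set.image_mono interior_subset).trans (hFR w hw))
  rw [MeasureTheory.measure_biUnion_finset (fun u hu v hv huv =>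
      h.disjoint_word u v (hF u hu v hv huv) (hF v hv u hu huv.symm)) (fun w _ => hopen w),
    MeasureTheory.Measure.addHaar_closedBall _ _ hR, finrank_euclideanSpace, Fintype.card_fin] at h1
  have h2 : F.card • (ENNReal.ofReal ((a / K) ^ d) * MeasureTheory.volume (interior X)) ≤
      ∑ w ∈ F, MeasureTheory.volume (wordMap S w '' interior X) := by
    rw [← Finset.sum_const]
    refine Finset.sum_le_sum fun w hw => (le_trans ?_ (h.volume_word_ge w))
    gcongr
    exact hFa w hw
  have h3 := ENNReal.toReal_mono (ENNReal.mul_ne_top ENNReal.ofReal_ne_top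
    MeasureTheory.measure_ball_lt_top.ne) (h2.trans h1)
  rw [nsmul_eq_mul, ENNReal.toReal_mul, ENNReal.toReal_mul, ENNReal.toReal_mul,
    ENNReal.toReal_ofReal (by positivity), ENNReal.toReal_ofReal (by positivity),
    ENNReal.toReal_natCast] at h3
  exact h3

end ConfSys

end Coding

end ConformalIFS

/-! ### Mass distribution on finite systems. -/

namespace ConformalIFS

section MassDistribution

open MeasureTheory

theorem exists_pmf_le {κ : Type*} [Fintype κ] {a : κ → ℝ} (ha : ∀ i, 0 ≤ a i)
    (hsum : 1 ≤ ∑ i, a i) : ∃ p : PMF κ, ∀ i, p i ≤ ENNReal.ofReal (a i) := by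
  have hpos : 0 < ∑ i, a i := by linarith
  refine ⟨PMF.ofFintype (fun i => ENNReal.ofReal (a i / ∑ j, a j)) ?_, fun i => ?_⟩
  · rw [← ENNReal.ofReal_sum_of_nonneg fun i _ => div_nonneg (ha i) hpos.le, ← Finset.sum_div,
      div_self hpos.ne', ENNReal.ofReal_one]
  · rw [PMF.ofFintype_apply]
    exact ENNReal.ofReal_le_ofReal (div_le_self (ha i) hsum)

/-- The mass of a cylinder with respect to a Bernoulli measure. -/
theorem infinitePi_cylinder_eq {κ : Type*} [MeasurableSpace κ] [MeasurableSingletonClass κ]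
    (p : PMF κ) (γ₀ : ℕ → κ) (n : ℕ) :
    Measure.infinitePi (fun _ : ℕ => p.toMeasure) {γ | pref γ n = pref γ₀ n} =
      ∏ k ∈ Finset.range n, p (γ₀ k) := by
  have : {γ | pref γ n = pref γ₀ n} =
      ((Finset.range n : Finset ℕ) : Set ℕ).pi fun k => {γ₀ k} := by
    ext γ
    simp [pref_inj]
  rw [this, Measure.infinitePi_pi _ fun k _ => measurableSet_singleton _]
  exact Finset.prod_congr rfl fun k _ =>
    p.toMeasure_apply_singleton _ (measurableSet_singleton _)

namespace ConfSys

variable {κ : Type*} {d : ℕ} {S : κ → E d → E d} {X V : Set (E d)} {x₀ : E d} {K : ℝ}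

/-- Dividing every letter's ratio by `K` pays in advance for the distortion factor of each
concatenation. -/
theorem prod_ratio_le [NeZero d] (h : ConfSys S X V x₀ K) (γ : ℕ → κ) (n : ℕ) :
    ∏ k ∈ Finset.range n, (ratio S x₀ [γ k] / K) ≤ ratio S x₀ (pref γ n) := by
  have hK := h.K_pos
  induction n with
  | zero => simp [ratio_nil]
  | succ n ih =>
    rw [Finset.prod_range_succ, pref_succ, mul_div_assoc', div_le_iff₀' hK]
    refine le_trans ?_ (h.ratio_mul_le (pref γ n) [γ n])
    have := h.ratio_pos [γ n]
    gcongr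

/-- Points whose codes share a long prefix are close. -/
theorem continuous_code (h : ConfSys S X V x₀ K) [TopologicalSpace κ] [DiscreteTopology κ]
    {π : (ℕ → κ) → E d} (hπ : ∀ γ n, π γ ∈ wordMap S (pref γ n) '' X) : Continuous π := by
  obtain ⟨c, hc, hc1, hS⟩ := h.contracting
  obtain ⟨D, hD, hXD⟩ := h.exists_diam_le
  refine Metric.continuous_iff'.2 fun γ ε hε => ?_
  obtain ⟨n, hn⟩ := exists_pow_lt_of_lt_one (div_pos hε hD) hc1
  have : ∀ᶠ γ' in 𝓝 γ, ∀ k ∈ Finset.range n, γ' k = γ k := by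
    rw [Filter.eventually_all_finset]
    intro k _
    exact ((continuous_apply k).tendsto γ).eventually ((isOpen_discrete {γ k}).mem_nhds rfl)
  filter_upwards [this] with γ' hγ'
  have heq : pref γ' n = pref γ n := pref_inj.2 fun k hk => hγ' k (Finset.mem_range.2 hk)
  obtain ⟨x, hx, hx'⟩ := hπ γ' n
  obtain ⟨y, hy, hy'⟩ := hπ γ n
  rw [← hx', ← hy', heq, dist_eq_norm]
  calc _ ≤ c ^ (pref γ n).length * ‖x - y‖ := h.norm_word_sub_le hc.le hS _ x hx y hy
    _ ≤ c ^ n * D := by rw [length_pref]; gcongr; exact hXD x hx y hy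
    _ < ε := (lt_div_iff₀ hD).1 hn

/-- The Bernoulli measure of the codes of the points of a small set, when the weights are
dominated by powers of the contraction ratios. -/
theorem exists_bernoulli_le [NeZero d] [Finite κ] [Nonempty κ] [MeasurableSpace κ]
    [MeasurableSingletonClass κ] (h : ConfSys S X V x₀ K) {s : ℝ} (hs : 0 ≤ s) (p : PMF κ)
    (hp : ∀ i, p i ≤ ENNReal.ofReal ((ratio S x₀ [i] / K) ^ s))
    {π : (ℕ → κ) → E d} (hπ : ∀ γ n, π γ ∈ wordMap S (pref γ n) '' X) :
    ∃ Q : ℝ, 0 < Q ∧ ∀ (r : ℝ) (A : Set (E d)), 0 < r → r ≤ 1 →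
      (∀ x ∈ A, ∀ y ∈ A, ‖x - y‖ ≤ r) →
      Measure.infinitePi (fun _ : ℕ => p.toMeasure) (π ⁻¹' A) ≤ ENNReal.ofReal (Q * r ^ s) := by
  obtain ⟨C, hC, hlip⟩ := h.exists_lipschitz
  obtain ⟨D, hD, hXD⟩ := h.exists_diam_le
  have hK := h.K_pos
  obtain ⟨i₀, hi₀⟩ := Finite.exists_min fun i => ratio S x₀ [i]
  set ρ := ratio S x₀ [i₀] with hρ
  have hρ0 : 0 < ρ := h.ratio_pos _
  set vU := volume.real (interior X) with hvU
  set vB := volume.real (Metric.ball (0 : E d) 1) with hvB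
  have hvU0 : 0 < vU := by
    refine ENNReal.toReal_pos (isOpen_interior.measure_pos _ ⟨x₀, h.mem_interior⟩).ne' ?_
    exact ((measure_mono interior_subset).trans_lt h.isCompact.measure_lt_top).ne
  have hvB0 : 0 < vB := ENNReal.toReal_pos
    (Metric.isOpen_ball.measure_pos _ ⟨0, by simp⟩).ne' measure_ball_lt_top.ne
  refine ⟨(1 + C * D) ^ d * vB / ((ρ / K / K) ^ d * vU), by positivity, ?_⟩
  intro r A hr hr1 hA
  rcases (π ⁻¹' A).eq_empty_or_nonempty with hemp | ⟨γA, hγA⟩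
  · rw [hemp, measure_empty]; exact zero_le
  -- Stopping words of the points of `A`: the codes are cut at the first time the ratio falls below
  -- `r`. Each such cylinder has mass at most `r ^ s`, so it remains to bound their number.
  set W : Set (List κ) := {w | ∃ γ n, π γ ∈ A ∧ w = pref γ (n + 1) ∧ ratio S x₀ w < r ∧
    ∀ m ≤ n, r ≤ ratio S x₀ (pref γ m)} with hW
  have hcover : π ⁻¹' A ⊆ ⋃ w ∈ W, {γ | pref γ w.length = w} := by
    intro γ hγ
    obtain ⟨n, hn, hm⟩ := h.exists_first_ratio_lt γ hr hr1
    exact Set.mem_iUnion₂.2 ⟨pref γ (n + 1), ⟨γ, n, hγ, rfl, hn, hm⟩, by simp⟩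
  have hmass : ∀ w ∈ W, Measure.infinitePi (fun _ : ℕ => p.toMeasure)
      {γ | pref γ w.length = w} ≤ ENNReal.ofReal (r ^ s) := by
    rintro _ ⟨γ, n, -, rfl, hn, -⟩
    rw [length_pref, infinitePi_cylinder_eq]
    calc ∏ k ∈ Finset.range (n + 1), p (γ k)
        ≤ ∏ k ∈ Finset.range (n + 1), ENNReal.ofReal ((ratio S x₀ [γ k] / K) ^ s) :=
          Finset.prod_le_prod' fun k _ => hp (γ k)
      _ = ENNReal.ofReal ((∏ k ∈ Finset.range (n + 1), (ratio S x₀ [γ k] / K)) ^ s) := by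
          have h0 : ∀ k, 0 ≤ ratio S x₀ [γ k] / K := fun k => by
            have := h.ratio_pos [γ k]; positivity
          rw [← Real.finsetProd_rpow _ _ fun k _ => h0 k, ENNReal.ofReal_prod_of_nonneg]
          intro k _
          have := h0 k
          positivity
      _ ≤ ENNReal.ofReal (r ^ s) := by
          apply ENNReal.ofReal_le_ofReal
          refine Real.rpow_le_rpow (Finset.prod_nonneg fun k _ => ?_)
            ((h.prod_ratio_le γ (n + 1)).trans hn.le) hs
          have := h.ratio_pos [γ k]; positivity
  refine (measure_mono hcover).trans ((measure_biUnion_le _ W.to_countable _).trans ?_)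
  rw [ENNReal.tsum_eq_iSup_sum]
  refine iSup_le fun F => (Finset.sum_le_sum fun (w : W) _ => hmass w w.2).trans ?_
  rw [Finset.sum_const, nsmul_eq_mul, ← ENNReal.ofReal_natCast, ← ENNReal.ofReal_mul (by positivity)]
  apply ENNReal.ofReal_le_ofReal
  gcongr
  have hsub : ∀ w ∈ F.map (Function.Embedding.subtype _), w ∈ W := by
    intro w hw
    obtain ⟨w, -, rfl⟩ := Finset.mem_map.1 hw
    exact w.2
  -- One letter before stopping the ratio was still at least `r`, so it is at least `r ρ / K`
  -- afterwards. The images have diameter at most `C D r` and meet `A`, so they lie in a ball of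
  -- radius `(1 + C D) r`.
  have hcard := h.card_mul_le (F := F.map (Function.Embedding.subtype _)) (a := r * ρ / K)
    (R := (1 + C * D) * r) (x := π γA) ?_ (by positivity) (by positivity) ?_ ?_
  · rw [Finset.card_map] at hcard
    rw [le_div_iff₀ (by positivity)]
    have hrd : 0 < r ^ d := by positivity
    refine le_of_mul_le_mul_right ?_ hrd
    calc _ = F.card * ((r * ρ / K / K) ^ d * vU) := by
          rw [show r * ρ / K / K = (ρ / K / K) * r by ring, mul_pow _ r]; ring
      _ ≤ _ := hcard
      _ = _ := by rw [mul_pow]; ring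
  -- A proper prefix of a stopping word still has ratio at least `r`, so it is not a stopping word.
  · intro u hu v hv huv hpre
    obtain ⟨γ, n, -, rfl, hn, -⟩ := hsub u hu
    obtain ⟨γ', n', -, rfl, -, hm'⟩ := hsub v hv
    obtain ⟨h1, h2⟩ := eq_pref_of_prefix hpre
    rw [length_pref] at h1 h2
    rcases h2.eq_or_lt with h3 | h3
    · rw [h3] at h1
      rw [h3] at huv
      exact huv h1
    · have := hm' (n + 1) (by omega)
      rw [← h1] at this
      linarith
  · intro w hw
    obtain ⟨γ, n, -, rfl, -, hm⟩ := hsub w hw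
    rw [div_le_iff₀' hK, pref_succ]
    refine le_trans ?_ (h.ratio_mul_le (pref γ n) [γ n])
    exact mul_le_mul (hm n le_rfl) (hi₀ (γ n)) hρ0.le (h.ratio_pos _).le
  · intro w hw
    obtain ⟨γ, n, hγ, rfl, hn, -⟩ := hsub w hw
    obtain ⟨x, hx, hx'⟩ := hπ γ (n + 1)
    rintro _ ⟨y, hy, rfl⟩
    rw [Metric.mem_closedBall, dist_eq_norm]
    have h1 := norm_sub_le_norm_sub_add_norm_sub (wordMap S (pref γ (n + 1)) y) (π γ) (π γA)
    have h2 : ‖wordMap S (pref γ (n + 1)) y - π γ‖ ≤ C * r * D := by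
      rw [← hx']
      refine (hlip _ y hy x hx).trans ?_
      have := hXD y hy x hx
      gcongr
    have h3 := hA _ hγ _ hγA
    linarith

/-- Lower bound for the Hausdorff dimension of the limit set of a finite system. -/
theorem le_dimH_of_fintype [NeZero d] [Fintype κ] (h : ConfSys S X V x₀ K) {s : ℝ≥0}
    (hs : 1 ≤ ∑ i, (ratio S x₀ [i] / K) ^ (s : ℝ)) : s ≤ dimH (limitSet S X) := by
  rcases eq_zero_or_pos s with rfl | hs0
  · simp
  have hne : Nonempty κ := by
    by_contra hemp
    rw [not_nonempty_iff] at hemp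
    simp at hs
    linarith
  have hK := h.K_pos
  obtain ⟨p, hp⟩ := exists_pmf_le
    (fun i => Real.rpow_nonneg (div_nonneg (h.ratio_pos [i]).le hK.le) _) hs
  choose π hπ using h.exists_point
  let _ : TopologicalSpace κ := ⊥
  have : DiscreteTopology κ := ⟨rfl⟩
  let _ : MeasurableSpace κ := ⊤
  have : BorelSpace κ := ⟨borel_eq_top_of_discrete.symm⟩
  have : MeasurableSingletonClass κ := ⟨fun _ => trivial⟩
  have hmeas : Measurable π := (h.continuous_code hπ).measurable
  obtain ⟨Q, hQ, hbound⟩ := h.exists_bernoulli_le s.2 p hp hπ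
  set P := Measure.infinitePi (fun _ : ℕ => p.toMeasure) with hP
  have hclosed : ∀ A : Set (E d), IsClosed A → P.map π A = P (π ⁻¹' A) :=
    fun A hA => Measure.map_apply hmeas hA.measurableSet
  have hle : ENNReal.ofReal Q⁻¹ • P.map π ≤ μH[(s : ℝ)] := by
    refine Measure.le_hausdorffMeasure _ _ 1 one_pos fun A hA => ?_
    have hb : ∀ r : ℝ, 0 < r → r ≤ 1 → Metric.ediam A ≤ ENNReal.ofReal r →
        (ENNReal.ofReal Q⁻¹ • P.map π) A ≤ ENNReal.ofReal r ^ (s : ℝ) := by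
      intro r hr hr1 hAr
      have h1 : P.map π A ≤ ENNReal.ofReal (Q * r ^ (s : ℝ)) := by
        -- `A` need not be measurable; its closure is, and has the same diameter.
        refine (measure_mono subset_closure).trans ?_
        rw [hclosed _ isClosed_closure]
        refine hbound r _ hr hr1 fun x hx y hy => ?_
        have := Metric.edist_le_ediam_of_mem hx hy
        rw [Metric.ediam_closure, edist_dist] at this
        have := (ENNReal.ofReal_le_ofReal_iff hr.le).1 (this.trans hAr)
        rwa [← dist_eq_norm]
      rw [Measure.smul_apply, smul_eq_mul]
      calc _ ≤ ENNReal.ofReal Q⁻¹ * ENNReal.ofReal (Q * r ^ (s : ℝ)) := by gcongr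
        _ = ENNReal.ofReal r ^ (s : ℝ) := by
          rw [← ENNReal.ofReal_mul (by positivity), inv_mul_cancel_left₀ hQ.ne',
            ENNReal.ofReal_rpow_of_pos hr]
    obtain ⟨δ, hδ⟩ : ∃ δ : ℝ≥0, Metric.ediam A = δ :=
      ⟨_, (ENNReal.coe_toNNReal (hA.trans_lt ENNReal.one_lt_top).ne).symm⟩
    have hδ1 : (δ : ℝ) ≤ 1 := by rw [hδ] at hA; exact_mod_cast hA
    rw [hδ] at hb ⊢
    -- A set of diameter zero is only covered by the bounds at positive `r`, so let `r` tend to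
    -- zero.
    rcases eq_zero_or_pos δ with rfl | hpos
    · have hlim : Filter.Tendsto (fun r : ℝ => ENNReal.ofReal r ^ (s : ℝ)) (𝓝[>] 0)
          (𝓝 (ENNReal.ofReal 0 ^ (s : ℝ))) :=
        ((ENNReal.continuous_rpow_const.comp ENNReal.continuous_ofReal).tendsto 0).mono_left
          nhdsWithin_le_nhds
      rw [ENNReal.ofReal_zero] at hlim
      refine ge_of_tendsto hlim ?_
      filter_upwards [Ioc_mem_nhdsGT (zero_lt_one' ℝ)] with r hr
      exact hb r hr.1 hr.2 (by simp)
    · have := hb δ (by exact_mod_cast hpos) hδ1 (by simp)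
      simpa using this
  apply le_dimH_of_hausdorffMeasure_ne_zero
  have h1 : ENNReal.ofReal Q⁻¹ ≤ (ENNReal.ofReal Q⁻¹ • P.map π) (limitSet S X) := by
    have : (1 : ℝ≥0∞) ≤ P.map π (limitSet S X) := by
      refine le_trans ?_ (Measure.le_map_apply hmeas.aemeasurable _)
      have : π ⁻¹' limitSet S X = Set.univ :=
        Set.eq_univ_of_forall fun γ => mem_limitSet.2 ⟨γ, fun n => hπ γ (n + 1)⟩
      rw [this, measure_univ]
    rw [Measure.smul_apply, smul_eq_mul]
    exact le_mul_of_one_le_right' this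
  have h2 : 0 < ENNReal.ofReal Q⁻¹ := ENNReal.ofReal_pos.2 (inv_pos.2 hQ)
  exact (h2.trans_le (h1.trans (hle _))).ne'

end ConfSys

end MassDistribution

end ConformalIFS

/-! ### Subsystems of words and summability of the ratios. -/

namespace ConformalIFS

namespace ConfSys

variable {ι : Type*} {d : ℕ} {S : ι → E d → E d} {X V : Set (E d)} {x₀ : E d} {K : ℝ}

theorem wordMap_wordMap {κ : Type*} (S : ι → E d → E d) (g : κ → List ι) (w : List κ) :
    wordMap (fun a => wordMap S (g a)) w = wordMap S (w.flatMap g) := by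
  induction w with
  | nil => rfl
  | cons a w ih => rw [wordMap, ih, List.flatMap_cons, wordMap_append]

/-- The system of the maps along pairwise incomparable words. -/
theorem wordSys (h : ConfSys S X V x₀ K) {κ : Type*} {g : κ → List ι}
    (hg : ∀ a b, a ≠ b → ¬ g a <+: g b) (hne : ∀ a, g a ≠ []) :
    ConfSys (fun a => wordMap S (g a)) X V x₀ K where
  isCompact := h.isCompact
  isPreconnected := h.isPreconnected
  isOpen := h.isOpen
  subset := h.subset
  mapsTo a := h.mapsTo_word (g a)
  injOn a := h.injOn_word (g a)
  mapsTo_nhd a := h.mapsTo_nhd_word (g a)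
  conformalAt a := h.conformalAt_word (g a)
  contracting := by
    obtain ⟨c, hc, hc1, hS⟩ := h.contracting
    refine ⟨c, hc, hc1, fun a x hx y hy => (h.norm_word_sub_le hc.le hS (g a) x hx y hy).trans ?_⟩
    gcongr
    exact pow_le_of_le_one hc.le hc1.le (fun h0 => hne a (List.length_eq_zero_iff.1 h0))
  one_le := h.one_le
  distortion w := by rw [wordMap_wordMap]; exact h.distortion _
  mem_interior := h.mem_interior
  mapsTo_interior a := h.mapsTo_interior_word (g a)
  disjoint a b hab := h.disjoint_word _ _ (hg a b hab) (hg b a hab.symm)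

/-- The points `S_v y`, with `v` non-empty and `y` in the smaller limit set, form a set each of
whose points is an image of another under a single map of `S`. When `v` is exhausted, `y` is
expanded once more. -/
theorem limitSet_wordSys_subset (h : ConfSys S X V x₀ K) {κ : Type*} {g : κ → List ι}
    (hg : ∀ a b, a ≠ b → ¬ g a <+: g b) (hne : ∀ a, g a ≠ []) :
    limitSet (fun a => wordMap S (g a)) X ⊆ limitSet S X := by
  have hT := h.wordSys hg hne
  set T := fun a => wordMap S (g a) with hTdef
  have h1 : limitSet T X ⊆ {x | ∃ v ≠ [], ∃ y ∈ limitSet T X, wordMap S v y = x} := by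
    intro x hx
    obtain ⟨a, y, hy, hyx⟩ := hT.exists_map_eq hx
    exact ⟨g a, hne a, y, hy, hyx⟩
  refine h1.trans (subset_limitSet ?_ ?_)
  · rintro _ ⟨v, -, y, hy, rfl⟩
    exact h.mapsTo_word v (hT.limitSet_subset hy)
  · rintro _ ⟨v, hv, y, hy, rfl⟩
    obtain ⟨i, v, rfl⟩ := List.exists_cons_of_ne_nil hv
    refine ⟨i, wordMap S v y, ?_, rfl⟩
    rcases eq_or_ne v [] with rfl | hv'
    · exact h1 hy
    · exact ⟨v, hv', y, hy, rfl⟩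

/-- Otherwise the finite subsystem of these words would have a limit set of dimension at least `s`
inside the original one. -/
theorem sum_ratio_lt [NeZero d] (h : ConfSys S X V x₀ K) {s : ℝ≥0}
    (hs : dimH (limitSet S X) < s) {F : Finset (List ι)}
    (hF : ∀ u ∈ F, ∀ v ∈ F, u ≠ v → ¬ u <+: v) (hne : ∀ u ∈ F, u ≠ []) :
    ∑ w ∈ F, (ratio S x₀ w / K) ^ (s : ℝ) < 1 := by
  by_contra! hge
  have hg : ∀ a b : F, a ≠ b → ¬ (a : List ι) <+: b :=
    fun a b hab => hF a a.2 b b.2 fun h' => hab (Subtype.ext h')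
  have hne' : ∀ a : F, (a : List ι) ≠ [] := fun a => hne a a.2
  have h1 := (h.wordSys hg hne').le_dimH_of_fintype (s := s) (by
    rw [← Finset.sum_coe_sort F] at hge
    exact hge)
  exact absurd (h1.trans (dimH_mono (h.limitSet_wordSys_subset hg hne'))) (not_le.2 hs)

/-- Above the Hausdorff dimension of the limit set, the powers of the ratios of all finite words
are summable. -/
theorem summable_ratio [NeZero d] (h : ConfSys S X V x₀ K) {s : ℝ}
    (hs : dimH (limitSet S X) < ENNReal.ofReal s) :
    Summable fun w : List ι => ratio S x₀ w ^ s := by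
  classical
  obtain ⟨s', hs', hs's⟩ := ENNReal.lt_iff_exists_nnreal_btwn.1 hs
  have hlt : (s' : ℝ) < s := by
    rw [← ENNReal.ofReal_coe_nnreal] at hs's
    exact (ENNReal.ofReal_lt_ofReal_iff_of_nonneg s'.2).1 hs's
  obtain ⟨c, hc, hc1, hS⟩ := h.contracting
  have hK := h.K_pos
  set q := c ^ (s - s') with hq
  have hq0 : 0 < q := by positivity
  have hq1 : q < 1 := Real.rpow_lt_one hc.le hc1 (by linarith)
  have hpos := fun w => h.ratio_pos w
  -- The surplus exponent `s - s'` gains a factor geometric in the length, because ratios are at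
  -- most `c ^ length`. This makes the levelwise bounds summable.
  have hterm : ∀ w : List ι, ratio S x₀ w ^ s ≤ q ^ w.length * ratio S x₀ w ^ (s' : ℝ) := by
    intro w
    have h1 : ratio S x₀ w ^ s = ratio S x₀ w ^ (s - s') * ratio S x₀ w ^ (s' : ℝ) := by
      rw [← Real.rpow_add (hpos w)]; congr 1; ring
    rw [h1]
    have := hpos w
    gcongr
    calc ratio S x₀ w ^ (s - s') ≤ (c ^ w.length) ^ (s - s') :=
          Real.rpow_le_rpow (hpos w).le (h.ratio_le_pow hc.le hS w) (by linarith)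
      _ = q ^ w.length := by
        rw [hq, ← Real.rpow_natCast, ← Real.rpow_natCast, ← Real.rpow_mul hc.le,
          ← Real.rpow_mul hc.le, mul_comm]
  -- Distinct words of equal length are incomparable. The empty word is excluded from
  -- `sum_ratio_lt`, so level zero is treated separately.
  have hlevel : ∀ (F : Finset (List ι)) (n : ℕ), (∀ w ∈ F, w.length = n) →
      ∑ w ∈ F, ratio S x₀ w ^ (s' : ℝ) ≤ K ^ (s' : ℝ) := by
    intro F n hF
    rcases Nat.eq_zero_or_pos n with rfl | hn
    · have : F ⊆ {[]} := fun w hw => by simpa using hF w hw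
      calc ∑ w ∈ F, ratio S x₀ w ^ (s' : ℝ) ≤ ∑ w ∈ {[]}, ratio S x₀ w ^ (s' : ℝ) :=
            Finset.sum_le_sum_of_subset_of_nonneg this fun w _ _ => by
              have := hpos w; positivity
        _ = 1 := by simp [ratio_nil]
        _ ≤ K ^ (s' : ℝ) := Real.one_le_rpow h.one_le s'.2
    · have h1 := h.sum_ratio_lt hs' (F := F)
        (fun u hu v hv huv hpre => huv (hpre.eq_of_length (by rw [hF u hu, hF v hv])))
        (fun u hu h0 => by have := hF u hu; simp [h0] at this; omega)
      have h2 : ∀ w, (ratio S x₀ w / K) ^ (s' : ℝ) = ratio S x₀ w ^ (s' : ℝ) / K ^ (s' : ℝ) :=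
        fun w => Real.div_rpow (hpos w).le hK.le _
      simp only [h2, ← Finset.sum_div] at h1
      rw [div_lt_one (by positivity)] at h1
      exact h1.le
  refine summable_of_sum_le (c := K ^ (s' : ℝ) * (1 - q)⁻¹)
    (fun w => by have := hpos w; positivity) fun F => ?_
  set N := F.sup List.length + 1 with hN
  have hmaps : ∀ w ∈ F, w.length ∈ Finset.range N := fun w hw =>
    Finset.mem_range.2 (Nat.lt_succ_of_le (Finset.le_sup (f := List.length) hw))
  calc ∑ w ∈ F, ratio S x₀ w ^ s
      ≤ ∑ w ∈ F, q ^ w.length * ratio S x₀ w ^ (s' : ℝ) := Finset.sum_le_sum fun w _ => hterm w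
    _ = ∑ n ∈ Finset.range N, ∑ w ∈ F with w.length = n,
          q ^ w.length * ratio S x₀ w ^ (s' : ℝ) := (Finset.sum_fiberwise_of_maps_to hmaps _).symm
    _ ≤ ∑ n ∈ Finset.range N, q ^ n * K ^ (s' : ℝ) := by
        refine Finset.sum_le_sum fun n _ => ?_
        calc _ = ∑ w ∈ F with w.length = n, q ^ n * ratio S x₀ w ^ (s' : ℝ) :=
              Finset.sum_congr rfl fun w hw => by rw [(Finset.mem_filter.1 hw).2]
          _ = q ^ n * ∑ w ∈ F with w.length = n, ratio S x₀ w ^ (s' : ℝ) :=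
              (Finset.mul_sum _ _ _).symm
          _ ≤ q ^ n * K ^ (s' : ℝ) := by
              gcongr
              exact hlevel _ n fun w hw => (Finset.mem_filter.1 hw).2
    _ = K ^ (s' : ℝ) * ∑ n ∈ Finset.range N, q ^ n := by rw [← Finset.sum_mul, mul_comm]
    _ ≤ K ^ (s' : ℝ) * (1 - q)⁻¹ := by
        gcongr
        rw [← tsum_geometric_of_lt_one hq0.le hq1]
        exact (summable_geometric_of_lt_one hq0.le hq1).sum_le_tsum _ fun _ _ => by positivity

end ConfSys

end ConformalIFS

/-! ### Upper estimate for the covering numbers of the limit set. -/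

namespace ConformalIFS

theorem coveringNumber_thickening_le {d : ℕ} {A F : Set (E d)} (hF : Bornology.IsBounded F)
    {a r : ℝ} (hr : 0 < r) (hA : ∀ x ∈ A, ∃ y ∈ F, ‖x - y‖ ≤ a) :
    coveringNumber (a + r) A ≤ coveringNumber r F := by
  obtain ⟨c, hc, hc'⟩ := exists_cover_card hF hr
  rw [← hc]
  refine coveringNumber_le_card fun x hx => ?_
  obtain ⟨y, hy, hxy⟩ := hA x hx
  obtain ⟨z, hz, hyz⟩ := Set.mem_iUnion₂.1 (hc' hy)
  refine Set.mem_iUnion₂.2 ⟨z, hz, ?_⟩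
  rw [Metric.mem_ball] at hyz ⊢
  rw [← dist_eq_norm] at hxy
  linarith [dist_triangle x y z]

namespace ConfSys

variable {ι : Type*} {d : ℕ} {S : ι → E d → E d} {X V : Set (E d)} {x₀ : E d} {K : ℝ}

/-- A minimiser of the displacement `‖S i x - x‖` on `X` is fixed, since applying `S i` once more
would decrease it. -/
theorem exists_fixedPt (h : ConfSys S X V x₀ K) (i : ι) : ∃ x ∈ X, S i x = x := by
  obtain ⟨c, hc, hc1, hS⟩ := h.contracting
  have hcont : ContinuousOn (fun x => ‖S i x - x‖) X :=
    ((h.continuousOn_word [i]).sub continuousOn_id).norm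
  obtain ⟨x, hx, hmin⟩ := h.isCompact.exists_isMinOn ⟨x₀, interior_subset h.mem_interior⟩ hcont
  refine ⟨x, hx, ?_⟩
  have h1 : ‖S i x - x‖ ≤ ‖S i (S i x) - S i x‖ := hmin (h.mapsTo i hx)
  have h2 := hS i _ (h.mapsTo i hx) x hx
  have h3 : ‖S i x - x‖ ≤ 0 := by nlinarith [norm_nonneg (S i x - x)]
  exact sub_eq_zero.1 (norm_le_zero_iff.1 h3)

theorem fixedPts_nonempty [hι : Nonempty ι] (h : ConfSys S X V x₀ K) :
    (fixedPts S X).Nonempty := by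
  obtain ⟨x, hx, hx'⟩ := h.exists_fixedPt (Classical.arbitrary ι)
  exact ⟨x, hx, _, hx'⟩

theorem fixedPts_subset_limitSet : fixedPts S X ⊆ limitSet S X :=
  subset_limitSet (fun _ hx => hx.1) fun a ha => by
    obtain ⟨i, hi⟩ := ha.2
    exact ⟨i, a, ha, hi⟩

theorem isBounded_fixedPts (h : ConfSys S X V x₀ K) : Bornology.IsBounded (fixedPts S X) :=
  h.isCompact.isBounded.subset fun _ hx => hx.1

theorem finite_ratio_ge {s : ℝ} (hs0 : 0 < s)
    (hs : Summable fun w : List ι => ratio S x₀ w ^ s) {r : ℝ} (hr : 0 < r) :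
    {w : List ι | r ≤ ratio S x₀ w}.Finite := by
  have h1 := hs.tendsto_cofinite_zero.eventually_lt_const (Real.rpow_pos_of_pos hr s)
  refine (Filter.eventually_cofinite.1 h1).subset fun w hw => ?_
  exact not_lt.2 (Real.rpow_le_rpow hr.le hw hs0.le)

/-- If the ratio along the code first falls below `r` after the letter `i` following `w`, then the
ratio of `i` is at most `K r / ρ_w`. So `S_i X` lies within a constant times `r / ρ_w` of the fixed
point of `S_i`. -/
theorem limitSet_subset_iUnion [NeZero d] (h : ConfSys S X V x₀ K) :
    ∃ a, 0 < a ∧ ∀ r, 0 < r → r ≤ 1 → limitSet S X ⊆ ⋃ w ∈ {w : List ι | r ≤ ratio S x₀ w},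
      wordMap S w '' {x ∈ X | ∃ y ∈ fixedPts S X, ‖x - y‖ ≤ a * (r / ratio S x₀ w)} := by
  obtain ⟨C, hC, hlip⟩ := h.exists_lipschitz
  obtain ⟨D, hD, hXD⟩ := h.exists_diam_le
  have hK := h.K_pos
  refine ⟨C * K * D, by positivity, fun r hr hr1 x hx => ?_⟩
  obtain ⟨γ, hγ⟩ := h.exists_code hx
  obtain ⟨n, hn, hm⟩ := h.exists_first_ratio_lt γ hr hr1
  obtain ⟨z, hz, hzx⟩ := hγ (n + 1)
  rw [pref_succ, wordMap_append] at hzx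
  refine Set.mem_iUnion₂.2 ⟨pref γ n, hm n le_rfl, S (γ n) z, ⟨h.mapsTo _ hz, ?_⟩, hzx⟩
  obtain ⟨y, hy, hy'⟩ := h.exists_fixedPt (γ n)
  refine ⟨y, ⟨hy, _, hy'⟩, ?_⟩
  have h1 := hlip [γ n] z hz y hy
  change ‖S (γ n) z - S (γ n) y‖ ≤ _ at h1
  rw [hy'] at h1
  refine h1.trans ?_
  have h2 := h.ratio_mul_le (pref γ n) [γ n]
  rw [← pref_succ] at h2
  have h3 : ratio S x₀ [γ n] ≤ K * (r / ratio S x₀ (pref γ n)) := by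
    rw [mul_div_assoc', le_div_iff₀' (h.ratio_pos _)]
    exact h2.trans (by gcongr)
  have h0 := h.ratio_pos [γ n]
  calc C * ratio S x₀ [γ n] * ‖z - y‖ ≤ C * (K * (r / ratio S x₀ (pref γ n))) * D :=
        mul_le_mul (by gcongr) (hXD z hz y hy) (norm_nonneg _)
          (mul_nonneg hC.le (h0.le.trans h3))
    _ = C * K * D * (r / ratio S x₀ (pref γ n)) := by ring

/-- The covering numbers of the limit set in terms of those of the set of fixed points. -/
theorem exists_logCov_le [NeZero d] [Nonempty ι] (h : ConfSys S X V x₀ K) {s : ℝ}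
    (hs : dimH (limitSet S X) < ENNReal.ofReal s) :
    ∃ C, 0 ≤ C ∧ ∀ v, 0 ≤ v → ∀ B,
      (∀ u, 0 ≤ u → u ≤ v → s * (v - u) + logCov (fixedPts S X) u ≤ B) →
      logCov (limitSet S X) v ≤ B + C := by
  have hs0 : 0 < s := ENNReal.ofReal_pos.1 (bot_le.trans_lt hs)
  have hsum := h.summable_ratio hs
  obtain ⟨C₁, hC₁, hlip⟩ := h.exists_lipschitz
  obtain ⟨a, ha, hcover⟩ := h.limitSet_subset_iUnion
  obtain ⟨c, hc, hc1, hS⟩ := h.contracting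
  have hFb := h.isBounded_fixedPts
  have hFne := h.fixedPts_nonempty
  have hΛb := h.isBounded_limitSet
  have hΛne := h.limitSet_nonempty
  set M := ∑' w : List ι, ratio S x₀ w ^ s with hM
  have hM1 : 1 ≤ M := by
    have := hsum.le_tsum [] fun w _ => by have := h.ratio_pos w; positivity
    simpa [ratio_nil] using this
  -- The neighbourhood raises the radius `r / ρ_w` to `(a + 1) r / ρ_w`, and the Lipschitz image
  -- multiplies it by `2 C₁ ρ_w`. The maximum with `1` allows the return from `A r` to `r` at the
  -- end.
  set A := max 1 (2 * C₁ * (a + 1)) with hA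
  have hA1 : 1 ≤ A := le_max_left _ _
  set G := gridConst d * A ^ d * M with hG
  have hG1 : 1 ≤ G := by
    have h1 := one_le_gridConst d
    have h2 : 1 ≤ A ^ d := one_le_pow₀ hA1
    exact one_le_mul_of_one_le_of_one_le (one_le_mul_of_one_le_of_one_le h1 h2) hM1
  refine ⟨Real.log G, Real.log_nonneg hG1, fun v hv B hB => ?_⟩
  set r := Real.exp (-v) with hr
  have hr0 : 0 < r := Real.exp_pos _
  have hr1 : r ≤ 1 := Real.exp_le_one_iff.2 (by linarith)
  have hfin := finite_ratio_ge hs0 hsum hr0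
  set W := hfin.toFinset with hW
  have hWmem : ∀ w, w ∈ W ↔ r ≤ ratio S x₀ w := fun w => by simp [hW]
  set Y : List ι → Set (E d) := fun w =>
    {x ∈ X | ∃ y ∈ fixedPts S X, ‖x - y‖ ≤ a * (r / ratio S x₀ w)} with hY
  have hYX : ∀ w, Y w ⊆ X := fun w x hx => hx.1
  have hterm : ∀ w ∈ W, (coveringNumber (A * r) (wordMap S w '' Y w) : ℝ) ≤
      Real.exp B * ratio S x₀ w ^ s := by
    intro w hw
    have hL := h.ratio_pos w
    have hrL := (hWmem w).1 hw
    have hρ : 0 < r / ratio S x₀ w := by positivity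
    have hL1 : ratio S x₀ w ≤ 1 := (h.ratio_le_pow hc.le hS w).trans (pow_le_one₀ hc.le hc1.le)
    have h1 : coveringNumber (a * (r / ratio S x₀ w) + r / ratio S x₀ w) (Y w) ≤
        coveringNumber (r / ratio S x₀ w) (fixedPts S X) :=
      coveringNumber_thickening_le hFb hρ fun x hx => hx.2
    have h2 := coveringNumber_image_le (f := wordMap S w) (L := C₁ * ratio S x₀ w)
      (h.isCompact.isBounded.subset (hYX w))
      (r := a * (r / ratio S x₀ w) + r / ratio S x₀ w) (by positivity) (by positivity)
      fun x hx y hy => hlip w x hx.1 y hy.1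
    have h3 : 2 * (C₁ * ratio S x₀ w) * (a * (r / ratio S x₀ w) + r / ratio S x₀ w)
        = 2 * C₁ * (a + 1) * r := by field_simp
    rw [h3] at h2
    have h4 : coveringNumber (A * r) (wordMap S w '' Y w) ≤
        coveringNumber (2 * C₁ * (a + 1) * r) (wordMap S w '' Y w) := by
      refine coveringNumber_anti (h.isCompact.isBounded.subset
        ((Set.image_mono (hYX w)).trans (h.mapsTo_word w).image_subset)) (by positivity) ?_
      gcongr
      exact le_max_right _ _
    -- The scale at which `F` is seen through `w`: `e^{-u} = r / ρ_w`. Then `e^{-s (v - u)} = ρ_w ^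
    -- s` is exactly the weight to be summed.
    set u := v + Real.log (ratio S x₀ w) with hu
    have hru : r / ratio S x₀ w = Real.exp (-u) := by
      rw [hu, neg_add, Real.exp_add, Real.exp_neg (Real.log _), Real.exp_log hL, ← hr,
        div_eq_mul_inv]
    have hu0 : 0 ≤ u := by
      have : -v ≤ Real.log (ratio S x₀ w) := (Real.le_log_iff_exp_le hL).2 hrL
      linarith
    have huv : u ≤ v := by
      have := Real.log_nonpos hL.le hL1
      linarith
    have h5 : (coveringNumber (A * r) (wordMap S w '' Y w) : ℝ) ≤
        coveringNumber (r / ratio S x₀ w) (fixedPts S X) := by exact_mod_cast h4.trans (h2.trans h1)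
    refine h5.trans ?_
    rw [hru, ← exp_logCov hFb hFne, Real.rpow_def_of_pos hL, ← Real.exp_add, Real.exp_le_exp]
    have := hB u hu0 huv
    have h6 : v - u = -Real.log (ratio S x₀ w) := by rw [hu]; ring
    rw [h6] at this
    linarith
  have hsumW : (coveringNumber (A * r) (limitSet S X) : ℝ) ≤ Real.exp B * M := by
    have h1 : coveringNumber (A * r) (limitSet S X) ≤
        ∑ w ∈ W, coveringNumber (A * r) (wordMap S w '' Y w) := by
      refine coveringNumber_le_sum W _ (by positivity) (fun w _ => h.isCompact.isBounded.subset
        ((Set.image_mono (hYX w)).trans (h.mapsTo_word w).image_subset)) ?_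
      refine (hcover r hr0 hr1).trans ?_
      simp only [hWmem]
      rfl
    calc (coveringNumber (A * r) (limitSet S X) : ℝ)
        ≤ ∑ w ∈ W, (coveringNumber (A * r) (wordMap S w '' Y w) : ℝ) := by exact_mod_cast h1
      _ ≤ ∑ w ∈ W, Real.exp B * ratio S x₀ w ^ s := Finset.sum_le_sum hterm
      _ = Real.exp B * ∑ w ∈ W, ratio S x₀ w ^ s := (Finset.mul_sum _ _ _).symm
      _ ≤ Real.exp B * M := by
        gcongr
        exact hsum.sum_le_tsum _ fun w _ => by have := h.ratio_pos w; positivity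
  have hfinal : Real.exp (logCov (limitSet S X) v) ≤ Real.exp B * G := by
    rw [exp_logCov hΛb hΛne]
    calc (coveringNumber r (limitSet S X) : ℝ)
        ≤ gridConst d * (A * r / r) ^ d * coveringNumber (A * r) (limitSet S X) :=
          coveringNumber_le_mul hΛb hr0 (le_mul_of_one_le_left hr0.le hA1)
      _ ≤ gridConst d * A ^ d * (Real.exp B * M) := by
          rw [mul_div_cancel_right₀ _ hr0.ne']
          have := one_le_gridConst d
          gcongr
      _ = Real.exp B * G := by rw [hG]; ring
  rw [← Real.exp_log (zero_lt_one.trans_le hG1), ← Real.exp_add, Real.exp_le_exp] at hfinal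
  exact hfinal

end ConfSys

end ConformalIFS

/-! ### Optimising the scale, and the inclusion. -/

namespace ConformalIFS

open Filter

/-- The right endpoint of the interval `𝒟(h, s, t, α)` in the case `h < t`. -/
noncomputable def topDim (h s t α : ℝ) : ℝ := h + (t - h) * (α - h) * s / (α * t - h * s)

theorem topDim_denom_pos {h s t α : ℝ} (h0 : 0 ≤ h) (hα : h < α) (ht : h < t) (hst : s ≤ t) :
    0 < α * t - h * s := by nlinarith

theorem le_topDim {h s t α : ℝ} (h0 : 0 ≤ h) (hα : h < α) (ht : h < t) (hs : 0 ≤ s)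
    (hst : s ≤ t) : h ≤ topDim h s t α := by
  have := topDim_denom_pos h0 hα ht hst
  have h1 : 0 ≤ (t - h) * (α - h) * s / (α * t - h * s) :=
    div_nonneg (mul_nonneg (mul_nonneg (by linarith) (by linarith)) hs) this.le
  unfold topDim
  linarith

theorem tendsto_topDim {h s t α : ℝ} (h0 : 0 ≤ h) (hα : h < α) (ht : h < t) (hst : s ≤ t) :
    Tendsto (fun ε => topDim (h + ε) (s + ε) (t + ε) α) (𝓝[>] 0) (𝓝 (topDim h s t α)) := by
  have hne := (topDim_denom_pos h0 hα ht hst).ne'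
  have : ContinuousAt (fun ε => topDim (h + ε) (s + ε) (t + ε) α) 0 := by
    unfold topDim
    refine ContinuousAt.add (by fun_prop) (ContinuousAt.div (by fun_prop) (by fun_prop) ?_)
    simpa using hne
  have h1 := this.tendsto
  simp only [add_zero] at h1
  exact h1.mono_left nhdsWithin_le_nhds

/-- The scale `v` in `hv` equalises the candidates `u = θ u₁ / t`, where the line of slope `t`
reaches the plateau `θ u₁`, and `u = v` on the line of slope `α` beyond `u₁`. The slope `σ` admits a
linear lower truncation of the profile. -/
theorem conv_bound_at_valley {h t θ σ α C u₁ v u y : ℝ} (h0 : 0 ≤ h) (hα : h < α) (ht : h < t)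
    (hθt : θ ≤ t) (hθ : 0 ≤ θ) (hu : 0 ≤ u) (huv : u ≤ v)
    (hv : v * (t * (α - h)) = u₁ * (α * t - h * θ))
    (h1 : y ≤ t * u + C) (h2 : y ≤ max (σ * u) (max (θ * u₁) (θ * u₁ + α * (u - u₁))) + C) :
    h * (v - u) + y ≤ max σ (topDim h θ t α) * v + C := by
  have htop := le_topDim h0 hα ht hθ hθt
  have hden := topDim_denom_pos h0 hα ht hθt
  have ht0 : 0 < t := by linarith
  have hv0 : 0 ≤ v := hu.trans huv
  have hm1 := le_max_left σ (topDim h θ t α)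
  have hm2 := le_max_right σ (topDim h θ t α)
  -- The right side is the value of `h (v - u) + θ u₁` at `u = θ u₁ / t`.
  have key : topDim h θ t α * v = h * v + θ * u₁ - h * (θ * u₁) / t := by
    have : v = u₁ * (α * t - h * θ) / (t * (α - h)) := by
      rw [eq_div_iff (by nlinarith)]; exact hv
    have h3 : α - h ≠ 0 := by linarith
    have h4 : α * t - h * θ ≠ 0 := hden.ne'
    rw [topDim, this]
    generalize α * t - h * θ = D at h4
    field_simp
    ring
  have hz : max σ (topDim h θ t α) * v ≥ h * v + θ * u₁ - h * (θ * u₁) / t := by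
    rw [← key]; gcongr
  rcases le_max_iff.1 (sub_le_iff_le_add.2 h2) with h3 | h3
  · have : h * (v - u) + σ * u ≤ max σ (topDim h θ t α) * (v - u)
        + max σ (topDim h θ t α) * u := by
      have : 0 ≤ v - u := by linarith
      gcongr
      linarith
    linarith
  · rcases le_max_iff.1 h3 with h4 | h4
    -- On the plateau, combine `y ≤ θ u₁ + C` and `y ≤ t u + C` with weights `1 - h / t` and `h /
    -- t`, so that the terms `h u` cancel.
    · have h5 : (1 - h / t) * (y - C) + h / t * (y - C) ≤
          (1 - h / t) * (θ * u₁) + h / t * (t * u) := by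
        have : 0 ≤ 1 - h / t := by rw [sub_nonneg, div_le_one ht0]; exact ht.le
        gcongr
        linarith
      have h6 : h / t * (t * u) = h * u := by field_simp
      have h7 : h * (θ * u₁) / t = h / t * (θ * u₁) := by ring
      rw [h6] at h5
      rw [h7] at hz
      linarith
    · have h5 : (α - h) * u ≤ (α - h) * v := by gcongr
      have h6 : (α - h) * v = α * u₁ - h * (θ * u₁) / t := by
        field_simp
        linarith
      linarith

/-- Each valley `u₁` yields the good scale `v = l u₁`. Since `l ≤ α / (α - h)`, the shape of `φ`
only matters on a window proportional to `u₁`, which makes errors linear in `u` harmless. -/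
theorem frequently_le_of_valleys {φ g : ℝ → ℝ} {h θ t σ α C C' : ℝ} (h0 : 0 ≤ h) (hα : h < α)
    (ht : h < t) (hθ : 0 ≤ θ) (hθt : θ ≤ t)
    (hg : ∀ v, 0 ≤ v → ∀ B, (∀ u, 0 ≤ u → u ≤ v → h * (v - u) + φ u ≤ B) → g v ≤ B + C')
    (hφ : ∀ u, 0 ≤ u → φ u ≤ t * u + C)
    (hfreq : ∃ᶠ u₁ in atTop, ∀ u, 0 ≤ u → u ≤ α / (α - h) * u₁ →
      φ u ≤ max (σ * u) (max (θ * u₁) (θ * u₁ + α * (u - u₁))) + C)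
    {ε : ℝ} (hε : 0 < ε) :
    ∃ᶠ v in atTop, g v ≤ (max σ (topDim h θ t α) + ε) * v := by
  have hden := topDim_denom_pos h0 hα ht hθt
  have ht0 : 0 < t := by linarith
  have hαh : 0 < α - h := by linarith
  set l := (α * t - h * θ) / (t * (α - h)) with hl
  have hl0 : 0 < l := by positivity
  have hlle : l ≤ α / (α - h) := by
    rw [hl, div_le_div_iff₀ (by positivity) hαh]
    have : 0 ≤ h * θ * (α - h) := by positivity
    nlinarith
  have htend : Tendsto (fun u₁ => l * u₁) atTop atTop := tendsto_id.const_mul_atTop hl0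
  refine htend.frequently ((hfreq.and_eventually ((eventually_ge_atTop 0).and
    (htend.eventually (eventually_ge_atTop ((C + C') / ε))))).mono ?_)
  rintro u₁ ⟨h1, h2, h3⟩
  have hv : l * u₁ * (t * (α - h)) = u₁ * (α * t - h * θ) := by rw [hl]; field_simp
  have hB := hg (l * u₁) (by positivity) (max σ (topDim h θ t α) * (l * u₁) + C)
    fun u hu huv => conv_bound_at_valley h0 hα ht hθt hθ hu huv hv (hφ u hu)
      (h1 u hu (huv.trans (by gcongr)))
  rw [div_le_iff₀ hε] at h3
  linarith

namespace ConfSys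

variable {ι : Type*} {d : ℕ} {S : ι → E d → E d} {X V : Set (E d)} {x₀ : E d} {K : ℝ}

theorem upperBoxDim_limitSet_le [NeZero d] [Nonempty ι] (h : ConfSys S X V x₀ K) {a t : ℝ≥0}
    (ha : dimH (limitSet S X) = a) (ht : upperBoxDim (fixedPts S X) = t) (hta : t ≤ a) :
    upperBoxDim (limitSet S X) ≤ a := by
  rw [← ENNReal.ofReal_coe_nnreal]
  refine upperBoxDim_le fun ε hε => ?_
  have hs : dimH (limitSet S X) < ENNReal.ofReal (a + ε / 2) := by
    rw [ha, ← ENNReal.ofReal_coe_nnreal]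
    exact (ENNReal.ofReal_lt_ofReal_iff (by positivity)).2 (by linarith)
  obtain ⟨C', hC', hg⟩ := h.exists_logCov_le hs
  obtain ⟨C, hC, hF⟩ := ConformalIFS.exists_logCov_le h.isBounded_fixedPts h.fixedPts_nonempty
    ht.le (half_pos hε)
  filter_upwards [eventually_ge_atTop 0, eventually_ge_atTop ((C + C') / (ε / 2))] with v hv hv'
  have := hg v hv ((a + ε / 2) * v + C) fun u hu huv => by
    have h1 := hF u hu
    have h2 : (t : ℝ) ≤ a := by exact_mod_cast hta
    have h3 : (t + ε / 2) * u ≤ (a + ε / 2) * u := by gcongr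
    linarith
  rw [div_le_iff₀ (by positivity)] at hv'
  linarith

/-- The scales where `φ(u₁) ≤ (s + ε) u₁` serve as valleys: before them monotonicity gives the
plateau, after them the `d`-Lipschitz bound gives the line. Continuity of `topDim` then removes `ε`.
-/
theorem lowerBoxDim_limitSet_le [NeZero d] [Nonempty ι] (h : ConfSys S X V x₀ K) {a s t : ℝ≥0}
    (ha : dimH (limitSet S X) = a) (hs : lowerBoxDim (fixedPts S X) = s)
    (ht : upperBoxDim (fixedPts S X) = t) (had : (a : ℝ) < d) (hat : a < t) (hst : s ≤ t) :
    lowerBoxDim (limitSet S X) ≤ ENNReal.ofReal (topDim a s t d) := by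
  have hst' : (s : ℝ) ≤ t := by exact_mod_cast hst
  have hat' : (a : ℝ) < t := by exact_mod_cast hat
  refine ge_of_tendsto (ENNReal.tendsto_ofReal (tendsto_topDim a.2 had hat' hst')) ?_
  filter_upwards [Ioo_mem_nhdsGT (sub_pos.2 had)] with ε hε
  obtain ⟨hε0, hεd⟩ := hε
  have hs' : dimH (limitSet S X) < ENNReal.ofReal (a + ε) := by
    rw [ha, ← ENNReal.ofReal_coe_nnreal]
    exact (ENNReal.ofReal_lt_ofReal_iff (by positivity)).2 (by linarith)
  obtain ⟨C', hC', hg⟩ := h.exists_logCov_le hs'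
  obtain ⟨C, hC, hF⟩ := ConformalIFS.exists_logCov_le h.isBounded_fixedPts h.fixedPts_nonempty
    ht.le hε0
  have ha0 : (0 : ℝ) ≤ a + ε := by positivity
  have hs0 : (0 : ℝ) ≤ s + ε := by positivity
  have htop := le_topDim ha0 (by linarith : (a : ℝ) + ε < d) (by linarith : (a : ℝ) + ε < t + ε)
    hs0 (by linarith)
  refine lowerBoxDim_le fun δ hδ => ?_
  -- No truncation is needed here, so its slope is set to zero and drops out of the maximum.
  have := frequently_le_of_valleys (φ := logCov (fixedPts S X)) (σ := 0) (C' := C')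
    (C := max C (Real.log (gridConst d)))
    ha0 (by linarith : (a : ℝ) + ε < d) (by linarith : (a : ℝ) + ε < t + ε) hs0 (by linarith) hg
    (fun u hu => (hF u hu).trans (by gcongr; exact le_max_left _ _))
    ((frequently_logCov_le hs.le hε0).mono fun u₁ hu₁ u _ _ => ?_) hδ
  · rwa [max_eq_right (ha0.trans htop)] at this
  · rcases le_total u u₁ with hle | hle
    · have h1 := logCov_mono h.isBounded_fixedPts h.fixedPts_nonempty hle
      have h2 : 0 ≤ max C (Real.log (gridConst d)) := hC.trans (le_max_left _ _)
      have h3 := (le_max_left ((s + ε) * u₁) ((s + ε) * u₁ + d * (u - u₁))).trans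
        (le_max_right (0 * u) _)
      linarith
    · have h1 := logCov_le_add h.isBounded_fixedPts h.fixedPts_nonempty hle
      have h2 := le_max_right C (Real.log (gridConst d))
      have h3 := (le_max_right ((s + ε) * u₁) ((s + ε) * u₁ + d * (u - u₁))).trans
        (le_max_right (0 * u) _)
      linarith

end ConfSys

/-- The dimensions of a conformal iterated function system satisfy the asserted inclusion. -/
theorem IsCIFS.exists_dims_mem_interval {d : ℕ} [NeZero d] {ι : Type*} [Nonempty ι]
    {S : ι → E d → E d} {X : Set (E d)} (hS : IsCIFS S X) :
    ∃ h s t β : ℝ≥0, dimH (limitSet S X) = h ∧ lowerBoxDim (fixedPts S X) = s ∧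
      upperBoxDim (fixedPts S X) = t ∧ lowerBoxDim (limitSet S X) = β ∧
      (β : ℝ) ∈ interval h s t d := by
  obtain ⟨V, x₀, K, h⟩ := hS.exists_confSys
  have hFb := h.isBounded_fixedPts
  have hFne := h.fixedPts_nonempty
  have hΛb := h.isBounded_limitSet
  have hΛne := h.limitSet_nonempty
  have htop : (d : ℝ≥0∞) ≠ ∞ := ENNReal.natCast_ne_top d
  have hh := dimH_le_dim (limitSet S X)
  have ht := upperBoxDim_le_dim hFb hFne
  have hst := lowerBoxDim_le_upperBoxDim (fixedPts S X)
  have hβ := (lowerBoxDim_le_upperBoxDim (limitSet S X)).trans (upperBoxDim_le_dim hΛb hΛne)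
  have hhβ := dimH_le_lowerBoxDim hΛb hΛne
  have hsβ := lowerBoxDim_mono hΛb hFne (ConfSys.fixedPts_subset_limitSet (S := S) (X := X))
  have hlift : ∀ x : ℝ≥0∞, x ≠ ∞ → ∃ y : ℝ≥0, (y : ℝ≥0∞) = x :=
    fun x hx => ⟨x.toNNReal, ENNReal.coe_toNNReal hx⟩
  obtain ⟨a, ha⟩ := hlift _ (ne_top_of_le_ne_top htop hh)
  obtain ⟨t, ht'⟩ := hlift _ (ne_top_of_le_ne_top htop ht)
  obtain ⟨s, hs'⟩ := hlift _ (ne_top_of_le_ne_top htop (hst.trans ht))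
  obtain ⟨β, hβ'⟩ := hlift _ (ne_top_of_le_ne_top htop hβ)
  refine ⟨a, s, t, β, ha.symm, hs'.symm, ht'.symm, hβ'.symm, ?_⟩
  have hab : a ≤ β := by rw [← ha, ← hβ'] at hhβ; exact_mod_cast hhβ
  have hsb : s ≤ β := by rw [← hs', ← hβ'] at hsβ; exact_mod_cast hsβ
  have hst' : s ≤ t := by rw [← hs', ← ht'] at hst; exact_mod_cast hst
  have htd : (t : ℝ) ≤ d := by rw [← ht'] at ht; exact_mod_cast ht
  unfold interval
  split_ifs with hta
  · have hta' : t ≤ a := by exact_mod_cast hta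
    have h1 := (lowerBoxDim_le_upperBoxDim _).trans
      (h.upperBoxDim_limitSet_le ha.symm ht'.symm hta')
    rw [← hβ'] at h1
    have h2 : β = a := le_antisymm (by exact_mod_cast h1) hab
    rw [h2]
    rfl
  · rw [not_le] at hta
    have h1 := h.lowerBoxDim_limitSet_le ha.symm hs'.symm ht'.symm (hta.trans_le htd)
      (by exact_mod_cast hta) hst'
    refine ⟨max_le (by exact_mod_cast hab) (by exact_mod_cast hsb), ?_⟩
    rw [← hβ', ← ENNReal.ofReal_coe_nnreal] at h1
    refine (ENNReal.ofReal_le_ofReal_iff ?_).1 h1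
    exact a.2.trans (le_topDim a.2 (hta.trans_le htd) hta s.2 (by exact_mod_cast hst'))

end ConformalIFS

/-! ### Systems of homotheties. -/

namespace ConformalIFS

open MeasureTheory Filter

/-- A ball of radius `r` cannot meet two pieces at mutual distance at least `2r`, so a cover of `B`
splits into disjoint covers of the pieces. -/
theorem sum_coveringNumber_le {d : ℕ} {κ : Type*} (J : Finset κ) {A : κ → Set (E d)}
    {B : Set (E d)} {r : ℝ} (hB : Bornology.IsBounded B) (hr : 0 < r)
    (hAB : ∀ i ∈ J, A i ⊆ B)
    (hsep : ∀ i ∈ J, ∀ j ∈ J, i ≠ j → ∀ x ∈ A i, ∀ y ∈ A j, 2 * r ≤ dist x y) :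
    ∑ i ∈ J, coveringNumber r (A i) ≤ coveringNumber r B := by
  classical
  obtain ⟨c, hc, hc'⟩ := exists_cover_card hB hr
  set f : κ → Finset (E d) := fun i => {x ∈ c | (Metric.ball x r ∩ A i).Nonempty} with hf
  have h1 : ∀ i ∈ J, coveringNumber r (A i) ≤ (f i).card := by
    refine fun i hi => coveringNumber_le_card fun a ha => ?_
    obtain ⟨x, hx, hax⟩ := Set.mem_iUnion₂.1 (hc' (hAB i hi ha))
    exact Set.mem_iUnion₂.2 ⟨x, Finset.mem_filter.2 ⟨hx, a, hax, ha⟩, hax⟩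
  have h2 : (J : Set κ).PairwiseDisjoint f := by
    intro i hi j hj hij
    refine Finset.disjoint_left.2 fun x hx hx' => ?_
    obtain ⟨a, ha, hai⟩ := (Finset.mem_filter.1 hx).2
    obtain ⟨b, hb, hbj⟩ := (Finset.mem_filter.1 hx').2
    have := hsep i hi j hj hij a hai b hbj
    rw [Metric.mem_ball] at ha hb
    linarith [dist_triangle_right a b x]
  calc ∑ i ∈ J, coveringNumber r (A i) ≤ ∑ i ∈ J, (f i).card := Finset.sum_le_sum h1
    _ = (J.biUnion f).card := (Finset.card_biUnion h2).symm
    _ ≤ c.card := Finset.card_le_card (Finset.biUnion_subset.2 fun i _ => Finset.filter_subset _ _)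
    _ = coveringNumber r B := hc

/-- As `g` is a similarity of the whole space, the centres themselves can be mapped and no factor
`2` is lost, so the bound can be iterated. -/
theorem coveringNumber_image_similarity_le {d : ℕ} {B : Set (E d)} {r k : ℝ}
    (hB : Bornology.IsBounded B) (hr : 0 < r) (hk : 0 < k) {g : E d → E d}
    (hg : ∀ x y, ‖g x - g y‖ = k * ‖x - y‖) :
    coveringNumber (k * r) (g '' B) ≤ coveringNumber r B := by
  classical
  obtain ⟨c, hc, hc'⟩ := exists_cover_card hB hr
  rw [← hc]
  refine (coveringNumber_le_card (c := c.image g) ?_).trans Finset.card_image_le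
  rintro _ ⟨b, hb, rfl⟩
  obtain ⟨x, hx, hbx⟩ := Set.mem_iUnion₂.1 (hc' hb)
  refine Set.mem_iUnion₂.2 ⟨g x, Finset.mem_image_of_mem g hx, ?_⟩
  rw [Metric.mem_ball, dist_eq_norm] at hbx ⊢
  rw [hg]
  gcongr

theorem tsum_prod_eq_pow {ι : Type*} (g : ι → ℝ≥0∞) (n : ℕ) :
    ∑' f : Fin n → ι, ∏ k, g (f k) = (∑' i, g i) ^ n := by
  induction n with
  | zero => simp
  | succ n ih =>
    rw [← (Fin.consEquiv fun _ : Fin (n + 1) => ι).tsum_eq, ENNReal.tsum_prod', pow_succ', ← ih,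
      ← ENNReal.tsum_mul_right]
    refine tsum_congr fun i => ?_
    rw [← ENNReal.tsum_mul_left]
    refine tsum_congr fun f => ?_
    rw [Fin.prod_univ_succ]
    rfl

/-- The homotheties with centres `a i` and ratios `c i`. -/
def hom {d : ℕ} {ι : Type*} (a : ι → E d) (c : ι → ℝ) (i : ι) (x : E d) : E d :=
  a i + c i • (x - a i)

theorem hom_sub {d : ℕ} {ι : Type*} (a : ι → E d) (c : ι → ℝ) (i : ι) (x y : E d) :
    hom a c i x - hom a c i y = c i • (x - y) := by
  simp only [hom, add_sub_add_left_eq_sub, ← smul_sub, sub_sub_sub_cancel_right]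

/-- Centres in the unit ball and ratios such that the images of the unit ball under the
homotheties are disjoint. -/
structure HomSys {d : ℕ} {ι : Type*} (a : ι → E d) (c : ι → ℝ) : Prop where
  norm_le : ∀ i, ‖a i‖ ≤ 1
  pos : ∀ i, 0 < c i
  le_half : ∀ i, c i ≤ 1 / 2
  separated : ∀ i j, i ≠ j → 2 * (c i + c j) < ‖a i - a j‖

namespace HomSys

variable {d : ℕ} {ι : Type*} {a : ι → E d} {c : ι → ℝ}

theorem hom_eq (a : ι → E d) (c : ι → ℝ) (i : ι) (x : E d) :
    hom a c i x = (1 - c i) • a i + c i • x := by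
  rw [hom]; module

theorem norm_hom_sub (h : HomSys a c) (i : ι) (x y : E d) :
    ‖hom a c i x - hom a c i y‖ = c i * ‖x - y‖ := by
  rw [hom_sub, norm_smul, Real.norm_of_nonneg (h.pos i).le]

theorem norm_hom_sub_center_le (h : HomSys a c) (i : ι) {x : E d} (hx : ‖x‖ ≤ 1) :
    ‖hom a c i x - a i‖ ≤ 2 * c i := by
  rw [hom, add_sub_cancel_left, norm_smul, Real.norm_of_nonneg (h.pos i).le]
  have := norm_sub_le x (a i)
  have := h.norm_le i
  have := h.pos i
  nlinarith

theorem hasFDerivAt_word (w : List ι) (x : E d) :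
    HasFDerivAt (wordMap (hom a c) w) ((w.map c).prod • ContinuousLinearMap.id ℝ (E d)) x := by
  induction w with
  | nil => simpa [wordMap] using hasFDerivAt_id x
  | cons i w ih =>
    have h1 : HasFDerivAt (hom a c i) (c i • ContinuousLinearMap.id ℝ (E d))
        (wordMap (hom a c) w x) :=
      (((hasFDerivAt_id _).sub_const (a i)).const_smul (c i)).const_add (a i)
    have := h1.comp x ih
    have heq : ((i :: w).map c).prod • ContinuousLinearMap.id ℝ (E d) =
        (c i • ContinuousLinearMap.id ℝ (E d)).comp
          ((w.map c).prod • ContinuousLinearMap.id ℝ (E d)) := by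
      ext v
      simp only [List.map_cons, List.prod_cons, _root_.smul_apply,
        ContinuousLinearMap.comp_apply, ContinuousLinearMap.id_apply, mul_smul]
    rw [heq]
    exact this

theorem ratio_eq [NeZero d] (h : HomSys a c) (x₀ : E d) (w : List ι) :
    ratio (hom a c) x₀ w = (w.map c).prod := by
  have h0 : 0 ≤ (w.map c).prod := List.prod_nonneg fun x hx => by
    obtain ⟨i, -, rfl⟩ := List.mem_map.1 hx
    exact (h.pos i).le
  rw [ratio, (hasFDerivAt_word w x₀).fderiv, norm_smul, ContinuousLinearMap.norm_id, mul_one,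
    Real.norm_of_nonneg h0]

theorem mapsTo_ball (h : HomSys a c) (i : ι) {R : ℝ} (hR : 1 ≤ R) :
    Set.MapsTo (hom a c i) (Metric.ball 0 R) (Metric.ball 0 R) := by
  intro x hx
  rw [mem_ball_zero_iff] at hx ⊢
  rw [hom_eq]
  have h1 := h.pos i
  have h2 := h.le_half i
  calc _ ≤ ‖(1 - c i) • a i‖ + ‖c i • x‖ := norm_add_le _ _
    _ = (1 - c i) * ‖a i‖ + c i * ‖x‖ := by
      rw [norm_smul, norm_smul, Real.norm_of_nonneg h1.le, Real.norm_of_nonneg (by linarith)]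
    _ < R := by nlinarith [h.norm_le i, norm_nonneg (a i)]

theorem mapsTo_closedBall (h : HomSys a c) (i : ι) :
    Set.MapsTo (hom a c i) (Metric.closedBall 0 1) (Metric.closedBall 0 1) := by
  intro x hx
  rw [mem_closedBall_zero_iff] at hx ⊢
  rw [hom_eq]
  have h1 := h.pos i
  have h2 := h.le_half i
  calc _ ≤ ‖(1 - c i) • a i‖ + ‖c i • x‖ := norm_add_le _ _
    _ = (1 - c i) * ‖a i‖ + c i * ‖x‖ := by
      rw [norm_smul, norm_smul, Real.norm_of_nonneg h1.le, Real.norm_of_nonneg (by linarith)]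
    _ ≤ 1 := by nlinarith [h.norm_le i, norm_nonneg (a i)]

theorem injective (h : HomSys a c) (i : ι) : Function.Injective (hom a c i) := by
  intro x y hxy
  have h1 := h.norm_hom_sub i x y
  rw [hxy, sub_self, norm_zero, eq_comm, mul_eq_zero] at h1
  exact sub_eq_zero.1 (norm_eq_zero.1 (h1.resolve_left (h.pos i).ne'))

theorem le_dist_image (h : HomSys a c) (i j : ι) {x y : E d} (hx : ‖x‖ ≤ 1) (hy : ‖y‖ ≤ 1) :
    ‖a i - a j‖ - 2 * (c i + c j) ≤ dist (hom a c i x) (hom a c j y) := by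
  have h1 := h.norm_hom_sub_center_le i hx
  have h2 := h.norm_hom_sub_center_le j hy
  rw [← dist_eq_norm] at h1 h2 ⊢
  have h3 := dist_triangle4 (a i) (hom a c i x) (hom a c j y) (a j)
  rw [dist_comm] at h1
  linarith

theorem conformalAt (h : HomSys a c) (i : ι) (x : E d) : ConformalAt (hom a c i) x :=
  ⟨c i • ContinuousLinearMap.id ℝ (E d), by simpa [wordMap] using hasFDerivAt_word [i] x,
    isConformalMap_const_smul (h.pos i).ne'⟩

theorem confSys (h : HomSys a c) :
    ConfSys (hom a c) (Metric.closedBall 0 1) (Metric.ball 0 2) 0 1 where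
  isCompact := isCompact_closedBall _ _
  isPreconnected := (convex_closedBall _ _).isPreconnected
  isOpen := Metric.isOpen_ball
  subset := Metric.closedBall_subset_ball one_lt_two
  mapsTo := h.mapsTo_closedBall
  injOn i := (h.injective i).injOn
  mapsTo_nhd i := h.mapsTo_ball i one_le_two
  conformalAt i x _ := h.conformalAt i x
  contracting := ⟨1 / 2, by norm_num, by norm_num, fun i x _ y _ => by
    rw [h.norm_hom_sub]
    have := h.le_half i
    gcongr⟩
  one_le := le_rfl
  distortion w x _ y _ := by
    rw [(hasFDerivAt_word w x).fderiv, (hasFDerivAt_word w y).fderiv, one_mul]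
  mem_interior := by rw [interior_closedBall _ one_ne_zero]; simp
  mapsTo_interior i := by
    rw [interior_closedBall _ one_ne_zero]
    exact h.mapsTo_ball i le_rfl
  disjoint i j hij := by
    refine Set.disjoint_image_image fun x hx y hy hxy => ?_
    have h1 := h.le_dist_image i j (mem_closedBall_zero_iff.1 (interior_subset hx))
      (mem_closedBall_zero_iff.1 (interior_subset hy))
    rw [hxy, dist_self] at h1
    linarith [h.separated i j hij]

/-- The ball of radius `r / 2` about `(1 - r / 2) x` lies in both balls. -/
theorem volume_ball_inter_ge [NeZero d] {x : E d} (hx : ‖x‖ ≤ 1) {r : ℝ} (hr : 0 < r)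
    (hr1 : r < 1) : ENNReal.ofReal ((1 / 2) ^ d * volume.real (Metric.ball (0 : E d) 1) * r ^ d) ≤
      volume (Metric.ball x r ∩ Metric.ball 0 1) := by
  have hsub : Metric.ball ((1 - r / 2) • x) (r / 2) ⊆ Metric.ball x r ∩ Metric.ball 0 1 := by
    intro y hy
    rw [Metric.mem_ball, dist_eq_norm] at hy
    constructor
    · rw [Metric.mem_ball, dist_eq_norm]
      have h1 : y - x = (y - (1 - r / 2) • x) - (r / 2) • x := by module
      have h2 : ‖(r / 2) • x‖ ≤ r / 2 := by
        rw [norm_smul, Real.norm_of_nonneg (by positivity)]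
        nlinarith
      rw [h1]
      linarith [norm_sub_le (y - (1 - r / 2) • x) ((r / 2) • x)]
    · rw [mem_ball_zero_iff]
      have h2 : ‖(1 - r / 2) • x‖ ≤ 1 - r / 2 := by
        rw [norm_smul, Real.norm_of_nonneg (by linarith)]
        nlinarith
      have := norm_sub_norm_le y ((1 - r / 2) • x)
      linarith
  refine le_trans ?_ (measure_mono hsub)
  rw [Measure.addHaar_ball _ _ (by positivity), finrank_euclideanSpace, Fintype.card_fin,
    mul_right_comm, ENNReal.ofReal_mul (by positivity), ← mul_pow, one_div_mul_eq_div,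
    Measure.real, ENNReal.ofReal_toReal measure_ball_lt_top.ne]

theorem isCIFS [NeZero d] (h : HomSys a c) : IsCIFS (hom a c) (Metric.closedBall 0 1) where
  isCompact := h.confSys.isCompact
  isConnected := ⟨⟨0, by simp⟩, h.confSys.isPreconnected⟩
  mapsTo := h.confSys.mapsTo
  injOn := h.confSys.injOn
  contracting := h.confSys.contracting
  conformal := by
    refine ⟨Metric.ball 0 2, Metric.isOpen_ball, Metric.isBounded_ball,
      ⟨⟨0, by simp⟩, (convex_ball _ _).isPreconnected⟩, h.confSys.subset, fun i =>
      ⟨h.confSys.mapsTo_nhd i, (h.injective i).injOn, h.confSys.conformalAt i, 0, 1, one_pos, ?_⟩,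
      1, le_rfl, h.confSys.distortion⟩
    intro x _ y _
    have h1 : ∀ z, fderiv ℝ (hom a c i) z = (([i].map c).prod • ContinuousLinearMap.id ℝ (E d)) :=
      fun z => (hasFDerivAt_word [i] z).fderiv
    simp [h1]
  interior_nonempty := ⟨0, h.confSys.mem_interior⟩
  mapsTo_interior := h.confSys.mapsTo_interior
  disjoint := h.confSys.disjoint
  cone := by
    rw [interior_closedBall _ one_ne_zero]
    refine ⟨(1 / 2) ^ d * volume.real (Metric.ball (0 : E d) 1), ?_, fun x hx r hr hr1 =>
      volume_ball_inter_ge (mem_closedBall_zero_iff.1 hx) hr hr1⟩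
    have : 0 < volume.real (Metric.ball (0 : E d) 1) := ENNReal.toReal_pos
      (Metric.isOpen_ball.measure_pos _ ⟨0, by simp⟩).ne' measure_ball_lt_top.ne
    positivity

theorem isSimilarityMap (h : HomSys a c) (i : ι) : IsSimilarityMap (hom a c i) :=
  ⟨c i, h.pos i, h.norm_hom_sub i⟩

theorem fixedPts_eq (h : HomSys a c) :
    fixedPts (hom a c) (Metric.closedBall 0 1) = Set.range a := by
  ext x
  constructor
  · rintro ⟨-, i, hi⟩
    refine ⟨i, ?_⟩
    have h1 : (1 - c i) • (x - a i) = 0 := by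
      rw [hom_eq] at hi
      have : (1 - c i) • (x - a i) = x - ((1 - c i) • a i + c i • x) := by module
      rw [this, hi, sub_self]
    have h2 : 1 - c i ≠ 0 := by linarith [h.le_half i]
    exact (sub_eq_zero.1 ((smul_eq_zero.1 h1).resolve_left h2)).symm
  · rintro ⟨i, rfl⟩
    exact ⟨mem_closedBall_zero_iff.2 (h.norm_le i), i, by simp [hom]⟩

/-- Lowering the exponent multiplies every term by at least `2 ^ (s - s')`, because all ratios are
at most `1 / 2`; a partial sum close to `1` then exceeds `1`. -/
theorem exists_finset_one_le (h : HomSys a c) {s s' : ℝ} (hs : HasSum (fun i => c i ^ s) 1)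
    (hss' : s' < s) : ∃ J : Finset ι, 1 ≤ ∑ i ∈ J, c i ^ s' := by
  have h1 : (2 : ℝ) ^ (s' - s) < 1 := Real.rpow_lt_one_of_one_lt_of_neg one_lt_two (by linarith)
  obtain ⟨J, hJ⟩ := (hs.eventually_const_lt h1).exists
  refine ⟨J, ?_⟩
  have h2 : ∀ i, (2 : ℝ) ^ (s - s') * c i ^ s ≤ c i ^ s' := by
    intro i
    have hc := h.pos i
    have h3 : c i ^ s = c i ^ (s - s') * c i ^ s' := by rw [← Real.rpow_add hc]; congr 1; ring
    rw [h3, ← mul_assoc, ← Real.mul_rpow zero_le_two hc.le]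
    refine mul_le_of_le_one_left (by positivity) (Real.rpow_le_one (by positivity) ?_ (by linarith))
    linarith [h.le_half i]
  calc (1 : ℝ) = 2 ^ (s - s') * 2 ^ (s' - s) := by
        rw [← Real.rpow_add zero_lt_two]; simp
    _ ≤ 2 ^ (s - s') * ∑ i ∈ J, c i ^ s := by gcongr
    _ ≤ ∑ i ∈ J, c i ^ s' := by rw [Finset.mul_sum]; exact Finset.sum_le_sum fun i _ => h2 i

theorem le_dimH_limitSet [NeZero d] (h : HomSys a c) {s : ℝ}
    (hs : HasSum (fun i => c i ^ s) 1) :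
    ENNReal.ofReal s ≤ dimH (limitSet (hom a c) (Metric.closedBall 0 1)) := by
  classical
  by_contra! hlt
  obtain ⟨s', hs', hs's⟩ := ENNReal.lt_iff_exists_nnreal_btwn.1 hlt
  have hlt' : (s' : ℝ) < s := by
    rw [← ENNReal.ofReal_coe_nnreal] at hs's
    exact (ENNReal.ofReal_lt_ofReal_iff_of_nonneg s'.2).1 hs's
  obtain ⟨J, hJ⟩ := h.exists_finset_one_le hs hlt'
  have h1 := h.confSys.sum_ratio_lt hs' (F := J.map ⟨fun i => [i], List.singleton_injective⟩)
    (by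
      simp only [Finset.mem_map, Function.Embedding.coeFn_mk]
      rintro _ ⟨i, -, rfl⟩ _ ⟨j, -, rfl⟩ hne hpre
      exact hne (hpre.eq_of_length rfl))
    (by
      simp only [Finset.mem_map, Function.Embedding.coeFn_mk]
      rintro _ ⟨i, -, rfl⟩
      simp)
  rw [Finset.sum_map] at h1
  simp only [Function.Embedding.coeFn_mk, h.ratio_eq, List.map_cons, List.map_nil,
    List.prod_singleton, div_one] at h1
  linarith

/-- The cylinders of length `n` cover the limit set, and their `s`-sums are at most `2 ^ s (∑ c_i ^
s) ^ n = 2 ^ s`. -/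
theorem dimH_limitSet_le [NeZero d] [Countable ι] (h : HomSys a c) {s : ℝ} (hs0 : 0 < s)
    (hs : HasSum (fun i => c i ^ s) 1) :
    dimH (limitSet (hom a c) (Metric.closedBall 0 1)) ≤ ENNReal.ofReal s := by
  have hcs := h.confSys
  lift s to ℝ≥0 using hs0.le
  rw [ENNReal.ofReal_coe_nnreal]
  apply dimH_le_of_hausdorffMeasure_ne_top
  have hdist : ∀ (w : List ι) (x y : E d),
      ‖wordMap (hom a c) w x - wordMap (hom a c) w y‖ = (w.map c).prod * ‖x - y‖ := by
    intro w x y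
    induction w with
    | nil => simp [wordMap]
    | cons i w ih =>
      rw [List.map_cons, List.prod_cons, mul_assoc, ← ih]
      exact h.norm_hom_sub i _ _
  have hprod : ∀ (n : ℕ) (f : Fin n → ι), ((List.ofFn f).map c).prod = ∏ k, c (f k) := by
    intro n f
    rw [List.map_ofFn, List.prod_ofFn]
    rfl
  have hdiam : ∀ (n : ℕ) (f : Fin n → ι),
      Metric.ediam (wordMap (hom a c) (List.ofFn f) '' Metric.closedBall 0 1) ≤
        ENNReal.ofReal (2 * ∏ k, c (f k)) := by
    intro n f
    refine Metric.ediam_image_le_iff.2 fun x hx y hy => ?_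
    rw [edist_dist, dist_eq_norm, hdist, hprod]
    apply ENNReal.ofReal_le_ofReal
    have h1 : ‖x - y‖ ≤ 2 := by
      have := norm_sub_le x y
      rw [mem_closedBall_zero_iff] at hx hy
      linarith
    have : 0 ≤ ∏ k, c (f k) := Finset.prod_nonneg fun k _ => (h.pos _).le
    nlinarith
  have key := Measure.hausdorffMeasure_le_liminf_tsum (ι := fun n : ℕ => Fin n → ι) (s : ℝ)
    (limitSet (hom a c) (Metric.closedBall 0 1)) (l := atTop)
    (fun n => ENNReal.ofReal (2 * (1 / 2) ^ n)) ?_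
    (fun n f => wordMap (hom a c) (List.ofFn f) '' Metric.closedBall 0 1)
    (Eventually.of_forall fun n f => (hdiam n f).trans (ENNReal.ofReal_le_ofReal ?_))
    (Eventually.of_forall fun n x hx => ?_)
  · refine ne_top_of_le_ne_top (b := ENNReal.ofReal (2 ^ (s : ℝ))) ENNReal.ofReal_ne_top
      (key.trans ?_)
    refine (liminf_le_liminf (v := fun _ => ENNReal.ofReal (2 ^ (s : ℝ)))
      (Eventually.of_forall fun n => ?_)).trans (by rw [liminf_const])
    calc ∑' f : Fin n → ι, Metric.ediam
          (wordMap (hom a c) (List.ofFn f) '' Metric.closedBall 0 1) ^ (s : ℝ)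
        ≤ ∑' f : Fin n → ι, ENNReal.ofReal (2 ^ (s : ℝ)) *
            ∏ k, ENNReal.ofReal (c (f k) ^ (s : ℝ)) := by
          refine ENNReal.tsum_le_tsum fun f => ?_
          refine (ENNReal.rpow_le_rpow (hdiam n f) s.2).trans_eq ?_
          have h0 : 0 ≤ ∏ k, c (f k) := Finset.prod_nonneg fun k _ => (h.pos _).le
          rw [ENNReal.ofReal_rpow_of_nonneg (by positivity) s.2, Real.mul_rpow zero_le_two h0,
            ENNReal.ofReal_mul (by positivity), ← Real.finsetProd_rpow _ _ fun k _ => (h.pos _).le,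
            ENNReal.ofReal_prod_of_nonneg fun k _ => Real.rpow_nonneg (h.pos _).le _]
          rfl
      _ = ENNReal.ofReal (2 ^ (s : ℝ)) := by
          rw [ENNReal.tsum_mul_left, tsum_prod_eq_pow (fun i => ENNReal.ofReal (c i ^ (s : ℝ))),
            ← ENNReal.ofReal_tsum_of_nonneg (fun i => Real.rpow_nonneg (h.pos i).le _) hs.summable,
            hs.tsum_eq]
          simp
  · rw [← ENNReal.ofReal_zero]
    apply ENNReal.tendsto_ofReal
    simpa using (tendsto_pow_atTop_nhds_zero_of_lt_one (r := (1 / 2 : ℝ)) (by norm_num)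
      (by norm_num)).const_mul 2
  · gcongr
    calc ∏ k, c (f k) ≤ ∏ _k : Fin n, (1 / 2 : ℝ) :=
          Finset.prod_le_prod (fun k _ => (h.pos _).le) fun k _ => h.le_half _
      _ = (1 / 2) ^ n := by simp
  · obtain ⟨γ, hγ⟩ := hcs.exists_code hx
    exact Set.mem_iUnion.2 ⟨fun k => γ k, hγ n⟩

theorem dimH_limitSet [NeZero d] [Countable ι] (h : HomSys a c) {s : ℝ} (hs0 : 0 < s)
    (hs : HasSum (fun i => c i ^ s) 1) :
    dimH (limitSet (hom a c) (Metric.closedBall 0 1)) = ENNReal.ofReal s :=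
  le_antisymm (h.dimH_limitSet_le hs0 hs) (h.le_dimH_limitSet hs)

theorem coveringNumber_limitSet_ge (h : HomSys a c) (i : ι) {r : ℝ} (hr : 0 < r) :
    coveringNumber (r / c i) (limitSet (hom a c) (Metric.closedBall 0 1)) ≤
      coveringNumber r (hom a c i '' limitSet (hom a c) (Metric.closedBall 0 1)) := by
  have hc := h.pos i
  set Λ := limitSet (hom a c) (Metric.closedBall 0 1) with hΛ
  have hsub : hom a c i '' Λ ⊆ Λ := by
    rintro _ ⟨x, hx, rfl⟩
    exact h.confSys.map_mem_limitSet i hx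
  have h1 := coveringNumber_image_similarity_le (k := (c i)⁻¹)
    (g := fun x => a i + (c i)⁻¹ • (x - a i)) (h.confSys.isBounded_limitSet.subset hsub) hr
    (inv_pos.2 hc) fun x y => by
      rw [add_sub_add_left_eq_sub, ← smul_sub, sub_sub_sub_cancel_right, norm_smul,
        Real.norm_of_nonneg (inv_pos.2 hc).le]
  have h2 : (fun x => a i + (c i)⁻¹ • (x - a i)) '' (hom a c i '' Λ) = Λ := by
    rw [← Set.image_comp]
    convert Set.image_id Λ using 2
    ext1 x
    simp [hom, inv_smul_smul₀ hc.ne']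
  rw [h2, inv_mul_eq_div] at h1
  exact h1

/-- Lower bound for the covering numbers of the limit set in terms of those of the set of fixed
points. -/
theorem exists_le_logCov [NeZero d] [Nonempty ι] (h : HomSys a c) {s s' : ℝ} (hs0 : 0 ≤ s')
    (hs : HasSum (fun i => c i ^ s) 1) (hss' : s' < s) :
    ∃ C u₀, ∀ u v, u₀ ≤ u → u ≤ v → s' * (v - u) + logCov (Set.range a) u ≤
      logCov (limitSet (hom a c) (Metric.closedBall 0 1)) v + C := by
  classical
  have hΛb := h.confSys.isBounded_limitSet
  have hΛne := h.confSys.limitSet_nonempty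
  have hFsub : Set.range a ⊆ limitSet (hom a c) (Metric.closedBall 0 1) := by
    rw [← h.fixedPts_eq]
    exact ConfSys.fixedPts_subset_limitSet
  have hFne : (Set.range a).Nonempty := Set.range_nonempty a
  set Λ := limitSet (hom a c) (Metric.closedBall 0 1) with hΛ
  have hΛ1 : ∀ x ∈ Λ, ‖x‖ ≤ 1 := fun x hx =>
    mem_closedBall_zero_iff.1 (h.confSys.limitSet_subset hx)
  obtain ⟨J, hJ⟩ := h.exists_finset_one_le hs hss'
  have hJne : J.Nonempty := by
    rw [Finset.nonempty_iff_ne_empty]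
    rintro rfl
    simp at hJ
    linarith
  -- The smallest ratio of the finite subfamily bounds how far a scale can jump in one step of the
  -- induction.
  obtain ⟨i₀, -, hi₀⟩ := J.exists_min_image c hJne
  have hm := h.pos i₀
  have hev : ∀ᶠ u in atTop, ∀ i ∈ J, ∀ j ∈ J, i ≠ j →
      2 * Real.exp (-u) ≤ ‖a i - a j‖ - 2 * (c i + c j) := by
    rw [eventually_all_finset]
    intro i _
    rw [eventually_all_finset]
    intro j _
    by_cases hij : i = j
    · simp [hij]
    · have h1 : Tendsto (fun u : ℝ => 2 * Real.exp (-u)) atTop (𝓝 0) := by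
        simpa using Real.tendsto_exp_neg_atTop_nhds_zero.const_mul 2
      filter_upwards [h1.eventually_le_const (sub_pos.2 (h.separated i j hij))] with u hu _
      exact hu
  obtain ⟨u₀, hu₀⟩ := eventually_atTop.1 hev
  -- The finitely many images have a positive mutual gap, so below a fixed scale their covering
  -- numbers add up. This is the origin of `u₀`.
  have hsum : ∀ r, 0 < r → r ≤ Real.exp (-u₀) →
      ∑ i ∈ J, coveringNumber (r / c i) Λ ≤ coveringNumber r Λ := by
    intro r hr hru
    refine (Finset.sum_le_sum fun i _ => h.coveringNumber_limitSet_ge i hr).trans ?_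
    refine sum_coveringNumber_le J hΛb hr (fun i _ => ?_) fun i hi j hj hij => ?_
    · rintro _ ⟨x, hx, rfl⟩
      exact h.confSys.map_mem_limitSet i hx
    · rintro _ ⟨x, hx, rfl⟩ _ ⟨y, hy, rfl⟩
      refine le_trans ?_ (h.le_dist_image i j (hΛ1 x hx) (hΛ1 y hy))
      refine le_trans ?_ (hu₀ u₀ le_rfl i hi j hj hij)
      gcongr
  refine ⟨-(s' * Real.log (c i₀)), u₀, fun u v hu huv => ?_⟩
  set ρ := Real.exp (-u) with hρ
  have hρ0 : 0 < ρ := Real.exp_pos _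
  have hρu : ρ ≤ Real.exp (-u₀) := Real.exp_le_exp.2 (by linarith)
  set N : ℝ := ((coveringNumber ρ (Set.range a) : ℕ) : ℝ) with hN
  have hN0 : 0 ≤ N := Nat.cast_nonneg _
  -- For `r` between `c i₀ * ρ` and `ρ`, the inclusion of the centres in the limit set already
  -- suffices.
  have hbase : ∀ r, 0 < r → c i₀ * ρ ≤ r → r ≤ ρ →
      N * (c i₀ * ρ / r) ^ s' ≤ coveringNumber r Λ := by
    intro r hr hr1 hr2
    have h1 : (c i₀ * ρ / r) ^ s' ≤ 1 :=
      Real.rpow_le_one (by positivity) ((div_le_one hr).2 hr1) hs0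
    have h2 : N ≤ coveringNumber r Λ := by
      have h3 := coveringNumber_mono hΛb hρ0 hFsub
      have h4 := coveringNumber_anti hΛb hr hr2
      rw [hN]
      exact_mod_cast h3.trans h4
    nlinarith
  -- Passing from `r` to `r / c i` at least doubles `r` but keeps it at most `ρ` when `r ≤ c i₀ *
  -- ρ`. The lower bound reproduces itself since `∑ c i ^ s' ≥ 1`.
  have hind : ∀ n : ℕ, ∀ r, 0 < r → (1 / 2) ^ n * (c i₀ * ρ) ≤ r → r ≤ ρ →
      N * (c i₀ * ρ / r) ^ s' ≤ coveringNumber r Λ := by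
    intro n
    induction n with
    | zero =>
      intro r hr hr1 hr2
      exact hbase r hr (by simpa using hr1) hr2
    | succ n ih =>
      intro r hr hr1 hr2
      rcases le_total (c i₀ * ρ) r with h1 | h1
      · exact hbase r hr h1 hr2
      have h2 : ∀ i ∈ J, N * (c i₀ * ρ / r) ^ s' * c i ^ s' ≤ coveringNumber (r / c i) Λ := by
        intro i hi
        have hci := h.pos i
        have h3 := ih (r / c i) (by positivity) (by
          rw [le_div_iff₀ hci]
          have := h.le_half i
          have h4 : 0 ≤ (1 / 2 : ℝ) ^ n * (c i₀ * ρ) := by positivity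
          rw [pow_succ] at hr1
          nlinarith) (by
          rw [div_le_iff₀ hci]
          have := hi₀ i hi
          nlinarith)
        refine le_trans (le_of_eq ?_) h3
        rw [mul_assoc, ← Real.mul_rpow (by positivity) hci.le]
        congr 2
        field_simp
      calc N * (c i₀ * ρ / r) ^ s' ≤ N * (c i₀ * ρ / r) ^ s' * ∑ i ∈ J, c i ^ s' :=
            le_mul_of_one_le_right (by positivity) hJ
        _ ≤ ∑ i ∈ J, (coveringNumber (r / c i) Λ : ℝ) := by
            rw [Finset.mul_sum]
            exact Finset.sum_le_sum h2
        _ ≤ coveringNumber r Λ := by exact_mod_cast hsum r hr (hr2.trans hρu)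
  obtain ⟨n, hn⟩ := exists_pow_lt_of_lt_one
    (show 0 < Real.exp (-v) / (c i₀ * ρ) by positivity) (one_half_lt_one (α := ℝ))
  have hfin := hind n (Real.exp (-v)) (Real.exp_pos _) ((lt_div_iff₀ (by positivity)).1 hn).le
    (Real.exp_le_exp.2 (by linarith))
  have hFb : Bornology.IsBounded (Set.range a) := hΛb.subset hFsub
  have h5 : c i₀ * ρ / Real.exp (-v) = Real.exp (Real.log (c i₀) + (v - u)) := by
    rw [Real.exp_add, Real.exp_log hm, hρ, mul_div_assoc, ← Real.exp_sub]
    congr 2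
    ring
  rw [h5, hN, ← exp_logCov hFb hFne, ← exp_logCov hΛb hΛne, ← Real.exp_mul, ← Real.exp_add,
    Real.exp_le_exp] at hfin
  linarith

end HomSys

end ConformalIFS

/-! ### Sets with a prescribed covering function. -/

namespace ConformalIFS

open Filter

/-- A cubical grid of `m ^ d` points with spacing `η` and corner `w`. -/
noncomputable def gridSet {d : ℕ} (w : E d) (η : ℝ) (m : ℕ) : Finset (E d) := by
  classical
  exact (Fintype.piFinset fun _ : Fin d => Finset.range m).image
    fun j => w + WithLp.toLp 2 fun i => η * (j i : ℝ)

section Grid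

variable {d : ℕ} {w x y : E d} {η : ℝ} {m : ℕ}

theorem mem_gridSet : x ∈ gridSet w η m ↔
    ∃ j : Fin d → ℕ, (∀ i, j i < m) ∧ x = w + WithLp.toLp 2 fun i => η * (j i : ℝ) := by
  simp only [gridSet, Finset.mem_image, Fintype.mem_piFinset, Finset.mem_range]
  exact exists_congr fun j => and_congr_right fun _ => eq_comm

theorem gridSet_separated (hη : 0 ≤ η) (hx : x ∈ gridSet w η m) (hy : y ∈ gridSet w η m)
    (hxy : x ≠ y) : η ≤ ‖x - y‖ := by
  obtain ⟨j, -, rfl⟩ := mem_gridSet.1 hx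
  obtain ⟨l, -, rfl⟩ := mem_gridSet.1 hy
  obtain ⟨i, hi⟩ : ∃ i, j i ≠ l i := by
    by_contra! h
    exact hxy (by rw [funext h])
  refine le_trans ?_ (PiLp.norm_apply_le _ i)
  have h1 : (1 : ℝ) ≤ |(j i : ℝ) - l i| := by
    have : (1 : ℤ) ≤ |(j i : ℤ) - l i| := Int.one_le_abs (sub_ne_zero.2 (by exact_mod_cast hi))
    exact_mod_cast this
  simp only [PiLp.sub_apply, add_sub_add_left_eq_sub, ← mul_sub, norm_mul,
    Real.norm_eq_abs, abs_of_nonneg hη]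
  nlinarith

theorem card_gridSet (hη : 0 < η) : (gridSet w η m).card = m ^ d := by
  classical
  rw [gridSet, Finset.card_image_of_injective, Fintype.card_piFinset]
  · simp
  · intro j l hjl
    have h1 := WithLp.toLp_injective 2 (add_left_cancel hjl)
    funext i
    have h2 := congrFun h1 i
    exact_mod_cast mul_left_cancel₀ hη.ne' h2

theorem gridSet_nonempty (hm : 0 < m) : (gridSet w η m).Nonempty :=
  ⟨_, mem_gridSet.2 ⟨fun _ => 0, fun _ => hm, rfl⟩⟩

theorem norm_sub_le_of_mem_gridSet (hη : 0 ≤ η) (hx : x ∈ gridSet w η m) :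
    ‖x - w‖ ≤ d * (η * m) := by
  obtain ⟨j, hj, rfl⟩ := mem_gridSet.1 hx
  rw [add_sub_cancel_left]
  refine (norm_le_sum_abs _).trans ?_
  calc ∑ i, |η * (j i : ℝ)| ≤ ∑ _i : Fin d, η * m := by
        refine Finset.sum_le_sum fun i _ => ?_
        rw [abs_of_nonneg (by positivity)]
        gcongr
        exact (hj i).le
    _ = d * (η * m) := by simp

theorem le_apply_of_mem_gridSet (hη : 0 ≤ η) (hx : x ∈ gridSet w η m) (i : Fin d) :
    w i ≤ x i := by
  obtain ⟨j, -, rfl⟩ := mem_gridSet.1 hx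
  simp only [PiLp.add_apply]
  have : 0 ≤ η * (j i : ℝ) := by positivity
  linarith

end Grid

section Realization

variable {d : ℕ} [NeZero d] {f : ℝ → ℝ}

/-- The number of points per direction in the `k`-th block. -/
noncomputable def blockSize (d : ℕ) (f : ℝ → ℝ) (k : ℕ) : ℕ :=
  ⌊Real.exp (f ((k : ℝ) ^ 2) / d)⌋₊

/-- The spacing of the points in the `k`-th block. -/
noncomputable def blockSpacing (d : ℕ) (k : ℕ) : ℝ :=
  (1 / 2) ^ k * (Real.exp (-(k : ℝ) ^ 2) / (8 * d))

/-- The corner of the `k`-th block. -/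
noncomputable def blockCorner (d : ℕ) [NeZero d] (k : ℕ) : E d :=
  ((1 / 2) ^ k * (1 / 2) : ℝ) • EuclideanSpace.single (0 : Fin d) (1 : ℝ)

/-- The `k`-th block: a grid at distance about `2 ^ (-k)` from the origin. -/
noncomputable def block (d : ℕ) [NeZero d] (f : ℝ → ℝ) (k : ℕ) : Finset (E d) :=
  gridSet (blockCorner d k) (blockSpacing d k) (blockSize d f k)

/-- The union of all blocks. -/
def blockUnion (d : ℕ) [NeZero d] (f : ℝ → ℝ) : Set (E d) := ⋃ k, (block d f k : Set (E d))

theorem dim_pos : (0 : ℝ) < d := by exact_mod_cast Nat.pos_of_neZero d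

theorem blockSpacing_pos (k : ℕ) : 0 < blockSpacing d k := by
  have := dim_pos (d := d)
  unfold blockSpacing
  positivity

theorem norm_blockCorner (k : ℕ) : ‖blockCorner d k‖ = (1 / 2) ^ k * (1 / 2) := by
  rw [blockCorner, norm_smul, PiLp.norm_single, Real.norm_of_nonneg (by positivity)]
  simp

theorem blockCorner_apply (k : ℕ) : blockCorner d k 0 = (1 / 2) ^ k * (1 / 2) := by
  simp [blockCorner]

theorem nonneg_of_mono (hf0 : f 0 = 0) (hmono : ∀ u v, 0 ≤ u → u ≤ v → f u ≤ f v) {u : ℝ}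
    (hu : 0 ≤ u) : 0 ≤ f u := hf0 ▸ hmono 0 u le_rfl hu

theorem norm_sub_corner_le (k : ℕ) {x : E d} (hx : x ∈ block d f k) :
    ‖x - blockCorner d k‖ ≤
      (1 / 2) ^ k * (Real.exp (f ((k : ℝ) ^ 2) / d - (k : ℝ) ^ 2) / 8) := by
  have hd := dim_pos (d := d)
  refine (norm_sub_le_of_mem_gridSet (blockSpacing_pos k).le hx).trans ?_
  have h1 : (blockSize d f k : ℝ) ≤ Real.exp (f ((k : ℝ) ^ 2) / d) :=
    Nat.floor_le (Real.exp_pos _).le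
  have h2 := blockSpacing_pos (d := d) k
  calc d * (blockSpacing d k * blockSize d f k)
      ≤ d * (blockSpacing d k * Real.exp (f ((k : ℝ) ^ 2) / d)) := by gcongr
    _ = _ := by
      rw [blockSpacing, sub_eq_add_neg, Real.exp_add]
      field_simp

/-- As `f u ≤ d u`, the block has radius at most `2^{-k} / 8` about its corner of norm `2^{-k} / 2`.
So different blocks lie in separated shells. -/
theorem norm_mem_block (hf0 : f 0 = 0) (hlip : ∀ u v, 0 ≤ u → u ≤ v → f v ≤ f u + d * (v - u))
    (k : ℕ) {x : E d} (hx : x ∈ block d f k) :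
    (1 / 2) ^ k * (3 / 8) ≤ ‖x‖ ∧ ‖x‖ ≤ (1 / 2) ^ k * (5 / 8) := by
  have hd := dim_pos (d := d)
  have h1 := norm_sub_corner_le k hx
  have h2 : Real.exp (f ((k : ℝ) ^ 2) / d - (k : ℝ) ^ 2) ≤ 1 := by
    rw [Real.exp_le_one_iff, sub_nonpos, div_le_iff₀ hd]
    have := hlip 0 ((k : ℝ) ^ 2) le_rfl (by positivity)
    rw [hf0] at this
    linarith
  have h3 : ‖x - blockCorner d k‖ ≤ (1 / 2) ^ k * (1 / 8) := h1.trans (by gcongr)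
  have h4 := norm_blockCorner (d := d) k
  have h5 := norm_sub_norm_le x (blockCorner d k)
  have h6 := norm_sub_norm_le (blockCorner d k) x
  rw [norm_sub_rev] at h6
  constructor <;> linarith

theorem blockUnion_isolated (hf0 : f 0 = 0)
    (hlip : ∀ u v, 0 ≤ u → u ≤ v → f v ≤ f u + d * (v - u)) {x : E d} (hx : x ∈ blockUnion d f) :
    ∃ δ > 0, ∀ y ∈ blockUnion d f, y ≠ x → δ ≤ ‖x - y‖ := by
  obtain ⟨k, hk⟩ := Set.mem_iUnion.1 hx
  have hp : (0 : ℝ) < (1 / 2) ^ k := by positivity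
  refine ⟨min (blockSpacing d k) ((1 / 2) ^ k * (1 / 16)),
    lt_min (blockSpacing_pos k) (by positivity), fun y hy hyx => ?_⟩
  obtain ⟨l, hl⟩ := Set.mem_iUnion.1 hy
  have hxn := norm_mem_block hf0 hlip k hk
  have hyn := norm_mem_block hf0 hlip l hl
  rcases lt_trichotomy k l with h | h | h
  · refine (min_le_right _ _).trans ?_
    have h1 : (1 / 2 : ℝ) ^ l ≤ (1 / 2) ^ (k + 1) :=
      pow_le_pow_of_le_one (by norm_num) (by norm_num) h
    rw [pow_succ] at h1
    linarith [norm_sub_norm_le x y]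
  · subst h
    exact (min_le_left _ _).trans (gridSet_separated (blockSpacing_pos k).le hk hl hyx.symm)
  · refine (min_le_right _ _).trans ?_
    have h1 : (1 / 2 : ℝ) ^ k ≤ (1 / 2) ^ (l + 1) :=
      pow_le_pow_of_le_one (by norm_num) (by norm_num) h
    rw [pow_succ] at h1
    rw [norm_sub_rev]
    linarith [norm_sub_norm_le y x]

theorem blockUnion_norm_le (hf0 : f 0 = 0)
    (hlip : ∀ u v, 0 ≤ u → u ≤ v → f v ≤ f u + d * (v - u)) {x : E d} (hx : x ∈ blockUnion d f) :
    ‖x‖ ≤ 1 := by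
  obtain ⟨k, hk⟩ := Set.mem_iUnion.1 hx
  have h1 := (norm_mem_block hf0 hlip k hk).2
  have : (1 / 2 : ℝ) ^ k ≤ 1 := pow_le_one₀ (by norm_num) (by norm_num)
  linarith

theorem blockUnion_apply_nonneg {x : E d} (hx : x ∈ blockUnion d f) : 0 ≤ x 0 := by
  obtain ⟨k, hk⟩ := Set.mem_iUnion.1 hx
  refine le_trans ?_ (le_apply_of_mem_gridSet (blockSpacing_pos k).le hk 0)
  rw [blockCorner_apply]
  positivity

theorem isBounded_blockUnion (hf0 : f 0 = 0)
    (hlip : ∀ u v, 0 ≤ u → u ≤ v → f v ≤ f u + d * (v - u)) :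
    Bornology.IsBounded (blockUnion d f) :=
  Metric.isBounded_closedBall.subset fun _ hx =>
    mem_closedBall_zero_iff.2 (blockUnion_norm_le hf0 hlip hx)

theorem one_le_exp_block (hf0 : f 0 = 0) (hmono : ∀ u v, 0 ≤ u → u ≤ v → f u ≤ f v) (k : ℕ) :
    1 ≤ Real.exp (f ((k : ℝ) ^ 2) / d) :=
  Real.one_le_exp (div_nonneg (nonneg_of_mono hf0 hmono (by positivity)) dim_pos.le)

theorem blockUnion_nonempty (hf0 : f 0 = 0) (hmono : ∀ u v, 0 ≤ u → u ≤ v → f u ≤ f v) :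
    (blockUnion d f).Nonempty := by
  have : 0 < blockSize d f 0 := Nat.floor_pos.2 (one_le_exp_block hf0 hmono 0)
  obtain ⟨x, hx⟩ := gridSet_nonempty (w := blockCorner d 0) (η := blockSpacing d 0) this
  exact ⟨x, Set.mem_iUnion.2 ⟨0, hx⟩⟩

theorem exp_div_pow (y : ℝ) : Real.exp (y / d) ^ d = Real.exp y := by
  have := dim_pos (d := d)
  rw [← Real.exp_nat_mul, mul_div_cancel₀ _ this.ne']

/-- If `k ^ 2 ≤ u`, count points: there are at most `e^{f(k ^ 2)} ≤ e^{f u}`. Otherwise cover the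
surrounding ball, which takes a constant times `e^{f(k ^ 2) - d (k ^ 2 - u)} ≤ e^{f u}` balls by the
Lipschitz condition. -/
theorem coveringNumber_block_le (hf0 : f 0 = 0) (hmono : ∀ u v, 0 ≤ u → u ≤ v → f u ≤ f v)
    (hlip : ∀ u v, 0 ≤ u → u ≤ v → f v ≤ f u + d * (v - u)) (k : ℕ) {u : ℝ} (hu : 0 ≤ u) :
    (coveringNumber (Real.exp (-u)) (block d f k : Set (E d)) : ℝ) ≤
      gridConst d * Real.exp (f u) := by
  have hd := dim_pos (d := d)
  have hC := one_le_gridConst d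
  rcases le_total ((k : ℝ) ^ 2) u with h | h
  · calc (coveringNumber (Real.exp (-u)) (block d f k : Set (E d)) : ℝ)
        ≤ (block d f k).card := by
          exact_mod_cast coveringNumber_coe_le_card _ (Real.exp_pos _)
      _ = (blockSize d f k : ℝ) ^ d := by
          rw [block, card_gridSet (blockSpacing_pos k)]; push_cast; rfl
      _ ≤ Real.exp (f ((k : ℝ) ^ 2) / d) ^ d := by
          gcongr; exact Nat.floor_le (Real.exp_pos _).le
      _ = Real.exp (f ((k : ℝ) ^ 2)) := exp_div_pow _
      _ ≤ Real.exp (f u) := Real.exp_le_exp.2 (hmono _ _ (by positivity) h)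
      _ ≤ gridConst d * Real.exp (f u) := le_mul_of_one_le_left (Real.exp_pos _).le hC
  · set R := Real.exp (f ((k : ℝ) ^ 2) / d - (k : ℝ) ^ 2) with hR
    have hR0 : 0 < R := Real.exp_pos _
    have hsub : (block d f k : Set (E d)) ⊆ Metric.ball (blockCorner d k) R := by
      intro x hx
      rw [Metric.mem_ball, dist_eq_norm]
      refine (norm_sub_corner_le k hx).trans_lt ?_
      have : (1 / 2 : ℝ) ^ k ≤ 1 := pow_le_one₀ (by norm_num) (by norm_num)
      nlinarith
    have h1 := coveringNumber_mono Metric.isBounded_ball (Real.exp_pos (-u)) hsub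
    have h2 := coveringNumber_ball_le (blockCorner d k) hR0.le (Real.exp_pos (-u))
    have h3 : max 1 (R / Real.exp (-u)) ≤ Real.exp (f u / d) := by
      refine max_le (Real.one_le_exp (div_nonneg (nonneg_of_mono hf0 hmono hu) hd.le)) ?_
      rw [hR, ← Real.exp_sub, Real.exp_le_exp]
      have h4 := hlip u _ hu h
      have h5 : f ((k : ℝ) ^ 2) / d ≤ (f u + d * ((k : ℝ) ^ 2 - u)) / d := by gcongr
      rw [add_div, mul_div_cancel_left₀ _ hd.ne'] at h5
      linarith
    calc (coveringNumber (Real.exp (-u)) (block d f k : Set (E d)) : ℝ)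
        ≤ coveringNumber (Real.exp (-u)) (Metric.ball (blockCorner d k) R) := by exact_mod_cast h1
      _ ≤ gridConst d * max 1 (R / Real.exp (-u)) ^ d := h2
      _ ≤ gridConst d * Real.exp (f u / d) ^ d := by gcongr
      _ = gridConst d * Real.exp (f u) := by rw [exp_div_pow]

theorem logCov_blockUnion_le (hf0 : f 0 = 0) (hmono : ∀ u v, 0 ≤ u → u ≤ v → f u ≤ f v)
    (hlip : ∀ u v, 0 ≤ u → u ≤ v → f v ≤ f u + d * (v - u)) {u : ℝ} (hu : 0 ≤ u) :
    logCov (blockUnion d f) u ≤ f u + (Real.log (2 * u + 2) + Real.log (gridConst d)) := by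
  have hC := one_le_gridConst d
  have hb := isBounded_blockUnion hf0 hlip
  set r := Real.exp (-u) with hr
  have hr0 : 0 < r := Real.exp_pos _
  -- Since `2 log 2 > 1`, the blocks from `n` on lie in the ball of radius `e^{-u}` about the
  -- origin. Only linearly many blocks remain, at the cost of a logarithm.
  set n := ⌈2 * u⌉₊ with hn
  have hnr : (1 / 2 : ℝ) ^ n ≤ r := by
    have h1 : (1 / 2 : ℝ) = Real.exp (-Real.log 2) := by
      rw [Real.exp_neg, Real.exp_log two_pos, one_div]
    rw [h1, ← Real.exp_nat_mul, hr, Real.exp_le_exp]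
    have h2 : 2 * u ≤ n := Nat.le_ceil _
    have := Real.log_two_gt_d9
    nlinarith
  have hsub : blockUnion d f ⊆
      ⋃ o ∈ insert none ((Finset.range n).map Function.Embedding.some),
        (o.elim (Metric.ball 0 r) fun k => (block d f k : Set (E d))) := by
    intro x hx
    obtain ⟨k, hk⟩ := Set.mem_iUnion.1 hx
    rcases lt_or_ge k n with h | h
    · exact Set.mem_iUnion₂.2 ⟨some k, Finset.mem_insert_of_mem (by simpa using h), hk⟩
    · refine Set.mem_iUnion₂.2 ⟨none, Finset.mem_insert_self _ _, ?_⟩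
      rw [Option.elim_none, mem_ball_zero_iff]
      have h1 := (norm_mem_block hf0 hlip k hk).2
      have h2 : (1 / 2 : ℝ) ^ k ≤ (1 / 2) ^ n :=
        pow_le_pow_of_le_one (by norm_num) (by norm_num) h
      linarith
  have h1 := coveringNumber_le_sum _ _ hr0 (fun o _ => by
    cases o with
    | none => exact Metric.isBounded_ball
    | some k => exact (block d f k).finite_toSet.isBounded) hsub
  rw [Finset.sum_insert (by simp), Finset.sum_map] at h1
  have h2 : coveringNumber r (Metric.ball (0 : E d) r) ≤ 1 := by
    have := coveringNumber_le_card (A := Metric.ball (0 : E d) r) (c := {0}) (r := r) (by simp)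
    simpa using this
  have hfu : 1 ≤ Real.exp (f u) := Real.one_le_exp (nonneg_of_mono hf0 hmono hu)
  have h3 : (coveringNumber r (blockUnion d f) : ℝ) ≤
      (2 * u + 2) * (gridConst d * Real.exp (f u)) := by
    calc (coveringNumber r (blockUnion d f) : ℝ)
        ≤ coveringNumber r (Metric.ball (0 : E d) r) +
            ∑ k ∈ Finset.range n, (coveringNumber r (block d f k : Set (E d)) : ℝ) := by
          exact_mod_cast h1
      _ ≤ 1 + ∑ _k ∈ Finset.range n, gridConst d * Real.exp (f u) := by
          gcongr with k hk
          · exact_mod_cast h2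
          · exact coveringNumber_block_le hf0 hmono hlip k hu
      _ = 1 + n * (gridConst d * Real.exp (f u)) := by simp
      _ ≤ (2 * u + 2) * (gridConst d * Real.exp (f u)) := by
          have h4 : (n : ℝ) < 2 * u + 1 := Nat.ceil_lt_add_one (by positivity)
          have h5 : 1 ≤ gridConst d * Real.exp (f u) := one_le_mul_of_one_le_of_one_le hC hfu
          nlinarith
  rw [← exp_logCov hb (blockUnion_nonempty hf0 hmono),
    ← Real.exp_log (show 0 < 2 * u + 2 by linarith),
    ← Real.exp_log (zero_lt_one.trans_le hC), ← Real.exp_add, ← Real.exp_add,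
    Real.exp_le_exp] at h3
  linarith

theorem le_logCov_blockUnion (hf0 : f 0 = 0) (hmono : ∀ u v, 0 ≤ u → u ≤ v → f u ≤ f v)
    (hlip : ∀ u v, 0 ≤ u → u ≤ v → f v ≤ f u + d * (v - u)) {u : ℝ} (hu : 4 ≤ √u)
    (hu' : Real.log (16 * d) + 6 ≤ 5 * √u) :
    f u ≤ logCov (blockUnion d f) u + d * (8 * √u + Real.log 2) := by
  have hd := dim_pos (d := d)
  have hu0 : 0 ≤ u := by
    by_contra! h
    rw [Real.sqrt_eq_zero_of_nonpos h.le] at hu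
    linarith
  have hsq := Real.sq_sqrt hu0
  have hb := isBounded_blockUnion hf0 hlip
  -- The last block that can be certified to be `2 e^{-u}`-separated: the shift by `3` absorbs the
  -- factors `2^{-k}` and `16 d`, while `u - k ^ 2 ≤ 8 √u` is of lower order.
  set k := ⌊√u - 3⌋₊ with hk
  have hk1 : (k : ℝ) ≤ √u - 3 := Nat.floor_le (by linarith)
  have hk2 : √u - 3 < k + 1 := Nat.lt_floor_add_one _
  have hk0 : (0 : ℝ) ≤ k := k.cast_nonneg
  have hspace : 2 * Real.exp (-u) ≤ blockSpacing d k := by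
    have h1 : (1 / 2 : ℝ) ^ k = Real.exp (-(k * Real.log 2)) := by
      rw [Real.exp_neg, Real.exp_nat_mul, Real.exp_log two_pos, one_div, inv_pow]
    have h2 : blockSpacing d k =
        2 * Real.exp (-(k * Real.log 2) - (k : ℝ) ^ 2 - Real.log (16 * d)) := by
      rw [blockSpacing, h1, Real.exp_sub, sub_eq_add_neg, Real.exp_add, Real.exp_log (by positivity)]
      field_simp
      norm_num
    rw [h2]
    gcongr
    have := Real.log_two_lt_d9
    nlinarith
  have hcard : blockSize d f k ^ d ≤ coveringNumber (Real.exp (-u)) (blockUnion d f) := by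
    rw [← card_gridSet (w := blockCorner d k) (blockSpacing_pos (d := d) k)]
    refine card_le_coveringNumber hb (Real.exp_pos _) (Set.subset_iUnion (fun k =>
      (block d f k : Set (E d))) k) fun x hx y hy hxy => ?_
    rw [dist_eq_norm]
    exact hspace.trans (gridSet_separated (blockSpacing_pos k).le hx hy hxy)
  have h1 := one_le_exp_block (d := d) hf0 hmono k
  have h2 : Real.exp (f ((k : ℝ) ^ 2) / d) / 2 ≤ blockSize d f k := by
    have h3 : Real.exp (f ((k : ℝ) ^ 2) / d) < blockSize d f k + 1 := Nat.lt_floor_add_one _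
    have h4 : 1 ≤ blockSize d f k := Nat.floor_pos.2 h1
    have h5 : (1 : ℝ) ≤ blockSize d f k := by exact_mod_cast h4
    linarith
  have h3 : Real.exp (f ((k : ℝ) ^ 2) - d * Real.log 2) ≤ Real.exp (logCov (blockUnion d f) u) := by
    rw [exp_logCov hb (blockUnion_nonempty hf0 hmono)]
    calc Real.exp (f ((k : ℝ) ^ 2) - d * Real.log 2)
        = (Real.exp (f ((k : ℝ) ^ 2) / d) / 2) ^ d := by
          rw [div_pow, exp_div_pow, Real.exp_sub, Real.exp_nat_mul, Real.exp_log two_pos]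
      _ ≤ (blockSize d f k : ℝ) ^ d := by gcongr
      _ ≤ _ := by exact_mod_cast hcard
  rw [Real.exp_le_exp] at h3
  have h4 := hlip ((k : ℝ) ^ 2) u (by positivity) (by nlinarith)
  have h5 : u - (k : ℝ) ^ 2 ≤ 8 * √u := by nlinarith
  have h6 : d * (u - (k : ℝ) ^ 2) ≤ d * (8 * √u) := by gcongr
  linarith

/-- Every nondecreasing function which is Lipschitz with constant `d` is, up to lower order terms,
the covering function of a countable set without accumulation points in itself. -/
theorem eventually_abs_logCov_blockUnion_sub_le (hf0 : f 0 = 0)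
    (hmono : ∀ u v, 0 ≤ u → u ≤ v → f u ≤ f v)
    (hlip : ∀ u v, 0 ≤ u → u ≤ v → f v ≤ f u + d * (v - u)) {ε : ℝ} (hε : 0 < ε) :
    ∀ᶠ u in atTop, |logCov (blockUnion d f) u - f u| ≤ ε * u := by
  have hd := dim_pos (d := d)
  have hlin : Tendsto (fun u : ℝ => 2 * u + 2) atTop atTop :=
    tendsto_atTop_add_const_right _ _ (tendsto_id.const_mul_atTop two_pos)
  have h1 : ∀ᶠ u : ℝ in atTop, ‖Real.log (2 * u + 2)‖ ≤ ε / 8 * ‖2 * u + 2‖ :=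
    hlin.eventually (Real.isLittleO_log_id_atTop.bound (by positivity))
  filter_upwards [h1, eventually_ge_atTop 2, eventually_ge_atTop (2 * Real.log (gridConst d) / ε),
    Real.tendsto_sqrt_atTop.eventually_ge_atTop 4,
    Real.tendsto_sqrt_atTop.eventually_ge_atTop ((Real.log (16 * d) + 6) / 5),
    Real.tendsto_sqrt_atTop.eventually_ge_atTop (16 * d / ε),
    eventually_ge_atTop (2 * d * Real.log 2 / ε)] with u h1 h2 h3 h4 h5 h6 h7
  rw [div_le_iff₀ hε] at h3 h6 h7
  rw [div_le_iff₀ (by norm_num)] at h5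
  rw [Real.norm_of_nonneg (by linarith : (0 : ℝ) ≤ 2 * u + 2)] at h1
  have h8 := (le_abs_self _).trans h1
  have h9 := logCov_blockUnion_le (d := d) hf0 hmono hlip (by linarith : 0 ≤ u)
  have h10 := le_logCov_blockUnion (d := d) hf0 hmono hlip h4 (by linarith)
  have hsq := Real.mul_self_sqrt (by linarith : 0 ≤ u)
  rw [abs_le]
  constructor <;> nlinarith

end Realization

end ConformalIFS

/-! ### Homotheties with prescribed centres and dimension. -/

namespace ConformalIFS

open Filter

/-- Arbitrarily fine grids which carry few enough points for the dimension `h < d`. -/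
theorem exists_fine_grid {d : ℕ} [NeZero d] {h : ℝ} (h0 : 0 < h) (hd : h < d) :
    ∃ m : ℕ, 0 < m ∧ 4 * ((m : ℝ) ^ d)⁻¹ ^ h⁻¹ < 1 / (8 * d * m) := by
  have hd0 := dim_pos (d := d)
  have h1 : 0 < d / h - 1 := by rw [sub_pos, one_lt_div h0]; exact hd
  -- Giving `m ^ d` points equal weights makes the ratio about `m ^ (-d / h)`, which is negligible
  -- against the spacing of order `1 / m` exactly because `h < d`.
  have h2 : Tendsto (fun m : ℕ => 32 * d * (m : ℝ) ^ (-(d / h - 1))) atTop (𝓝 (32 * d * 0)) :=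
    ((tendsto_rpow_neg_atTop h1).comp tendsto_natCast_atTop_atTop).const_mul _
  rw [mul_zero] at h2
  obtain ⟨m, hm, hm0⟩ := ((h2.eventually_lt_const one_pos).and (eventually_gt_atTop 0)).exists
  refine ⟨m, hm0, ?_⟩
  have hm' : (0 : ℝ) < m := by exact_mod_cast hm0
  rw [lt_div_iff₀ (by positivity)]
  have h3 : ((m : ℝ) ^ d)⁻¹ ^ h⁻¹ * m = (m : ℝ) ^ (-(d / h - 1)) := by
    rw [← Real.rpow_natCast, ← Real.rpow_neg hm'.le, ← Real.rpow_mul hm'.le]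
    nth_rewrite 2 [← Real.rpow_one (m : ℝ)]
    rw [← Real.rpow_add hm']
    congr 1
    field_simp
    ring
  calc 4 * ((m : ℝ) ^ d)⁻¹ ^ h⁻¹ * (8 * d * m) = 32 * d * (((m : ℝ) ^ d)⁻¹ ^ h⁻¹ * m) := by ring
    _ < 1 := by rw [h3]; exact hm

/-- Every countable set of isolated points in half of the unit ball is, up to finitely many points,
the set of centres of a system of homotheties with a limit set of prescribed dimension. -/
theorem exists_homSys {d : ℕ} [NeZero d] {h : ℝ} (h0 : 0 < h) (hd : h < d) {A : Set (E d)}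
    (hA : A.Countable) (hA1 : ∀ x ∈ A, ‖x‖ ≤ 1) (hA0 : ∀ x ∈ A, 0 ≤ x 0)
    (hiso : ∀ x ∈ A, ∃ δ > 0, ∀ y ∈ A, y ≠ x → δ ≤ ‖x - y‖) :
    ∃ (G : Finset (E d)) (c : E d → ℝ),
      HomSys (fun x : ↥(A ∪ (G : Set (E d))) => (x : E d)) (fun x => c x) ∧
      HasSum (fun x : ↥(A ∪ (G : Set (E d))) => c x ^ h) 1 := by
  classical
  have hd0 := dim_pos (d := d)
  obtain ⟨ε, hε, s, hs, hs1⟩ := hA.exists_pos_hasSum_le (one_half_pos (α := ℝ))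
  have : ∀ x, ∃ δ > 0, x ∈ A → ∀ y ∈ A, y ≠ x → δ ≤ ‖x - y‖ := fun x => by
    by_cases hx : x ∈ A
    · obtain ⟨δ, hδ, h⟩ := hiso x hx
      exact ⟨δ, hδ, fun _ => h⟩
    · exact ⟨1, one_pos, fun h => absurd h hx⟩
  choose δ hδ hδA using this
  set b : E d → ℝ := fun x => min (min (δ x / 16) (1 / 16)) (ε x ^ h⁻¹) with hb
  have hb0 : ∀ x, 0 < b x := fun x => by
    have := hδ x
    have := hε x
    exact lt_min (lt_min (by positivity) (by norm_num)) (by positivity)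
  have hb1 : ∀ x, b x ≤ δ x / 16 := fun x => (min_le_left _ _).trans (min_le_left _ _)
  have hb2 : ∀ x, b x ≤ 1 / 16 := fun x => (min_le_left _ _).trans (min_le_right _ _)
  have hb3 : ∀ x, b x ^ h ≤ ε x := fun x => by
    calc b x ^ h ≤ (ε x ^ h⁻¹) ^ h := Real.rpow_le_rpow (hb0 x).le (min_le_right _ _) h0.le
      _ = ε x := Real.rpow_inv_rpow (hε x).le h0.ne'
  have hsum : Summable fun x : A => b x ^ h :=
    Summable.of_nonneg_of_le (fun x => Real.rpow_nonneg (hb0 x).le _) (fun x => hb3 x) hs.summable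
  set τ := ∑' x : A, b x ^ h with hτ
  have hτ0 : 0 ≤ τ := tsum_nonneg fun x => Real.rpow_nonneg (hb0 x).le _
  have hτ1 : τ ≤ 1 / 2 := (hsum.tsum_le_tsum (fun x : A => hb3 x) hs.summable).trans
    (hs.tsum_eq.trans_le hs1)
  obtain ⟨m, hm0, hm⟩ := exists_fine_grid h0 hd
  have hm' : (0 : ℝ) < m := by exact_mod_cast hm0
  set η : ℝ := 1 / (8 * d * m) with hη
  have hη0 : 0 < η := by positivity
  -- The auxiliary grid sits in the half of the ball opposite to `A`.
  set w : E d := (-(1 / 2) : ℝ) • EuclideanSpace.single (0 : Fin d) (1 : ℝ) with hw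
  have hwn : ‖w‖ = 1 / 2 := by
    rw [hw, norm_smul, PiLp.norm_single]; norm_num
  have hw0 : w 0 = -(1 / 2) := by simp [hw]
  set G := gridSet w η m with hG
  have hGw : ∀ x ∈ G, ‖x - w‖ ≤ 1 / 8 := fun x hx => by
    refine (norm_sub_le_of_mem_gridSet hη0.le hx).trans_eq ?_
    rw [hη]; field_simp
  have hG1 : ∀ x ∈ G, ‖x‖ ≤ 1 := fun x hx => by
    have := norm_sub_norm_le x w
    linarith [hGw x hx]
  have hG0 : ∀ x ∈ G, x 0 ≤ -(3 / 8) := fun x hx => by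
    have h1 := (PiLp.norm_apply_le (x - w) 0).trans (hGw x hx)
    rw [PiLp.sub_apply, hw0, Real.norm_eq_abs] at h1
    linarith [(abs_le.1 h1).2]
  have hAG : ∀ x ∈ A, ∀ y ∈ G, 3 / 8 ≤ ‖x - y‖ := fun x hx y hy => by
    have h1 := PiLp.norm_apply_le (x - y) 0
    rw [PiLp.sub_apply, Real.norm_eq_abs] at h1
    linarith [le_abs_self (x 0 - y 0), hA0 x hx, hG0 y hy]
  have hGA : ∀ x ∈ G, x ∉ A := fun x hx hxA => by linarith [hA0 x hxA, hG0 x hx]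
  -- Equal ratios on the `m ^ d` grid points, chosen to supply the missing mass `1 - τ`.
  set c₀ : ℝ := ((1 - τ) * ((m : ℝ) ^ d)⁻¹) ^ h⁻¹ with hc₀
  have hτ' : 0 < 1 - τ := by linarith
  have hc₀0 : 0 < c₀ := by positivity
  have hc₀h : c₀ ^ h = (1 - τ) * ((m : ℝ) ^ d)⁻¹ :=
    Real.rpow_inv_rpow (by positivity) h0.ne'
  have hc₀η : 4 * c₀ < η := by
    have h1 : (1 - τ) * ((m : ℝ) ^ d)⁻¹ ≤ ((m : ℝ) ^ d)⁻¹ :=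
      mul_le_of_le_one_left (by positivity) (by linarith)
    have h2 := Real.rpow_le_rpow (by positivity) h1 (inv_nonneg.2 h0.le)
    linarith
  have hη8 : η ≤ 1 / 8 := by
    rw [hη]
    have h1 : (1 : ℝ) ≤ d := by exact_mod_cast Nat.pos_of_neZero d
    have h2 : (1 : ℝ) ≤ m := by exact_mod_cast hm0
    apply one_div_le_one_div_of_le (by norm_num)
    nlinarith
  set c : E d → ℝ := fun x => if x ∈ A then b x else c₀ with hc
  have hcA : ∀ x ∈ A, c x = b x := fun x hx => if_pos hx
  have hcG : ∀ x ∈ G, c x = c₀ := fun x hx => if_neg (hGA x hx)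
  refine ⟨G, c, ⟨?_, ?_, ?_, ?_⟩, ?_⟩
  · rintro ⟨x, hx | hx⟩
    · exact hA1 x hx
    · exact hG1 x hx
  · rintro ⟨x, hx | hx⟩
    · simpa only [hcA x hx] using hb0 x
    · simpa only [hcG x hx] using hc₀0
  · rintro ⟨x, hx | hx⟩
    · simp only [hcA x hx]; linarith [hb2 x]
    · simp only [hcG x hx]; linarith
  · rintro ⟨x, hx | hx⟩ ⟨y, hy | hy⟩ hxy
    · have hne : x ≠ y := fun h => hxy (Subtype.ext h)
      simp only [hcA x hx, hcA y hy]
      have h1 := hδA x hx y hy hne.symm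
      have h2 := hδA y hy x hx hne
      rw [norm_sub_rev] at h2
      linarith [hb1 x, hb1 y, hδ x]
    · simp only [hcA x hx, hcG y hy]
      linarith [hAG x hx y hy, hb2 x]
    · simp only [hcG x hx, hcA y hy]
      rw [norm_sub_rev]
      linarith [hAG y hy x hx, hb2 y]
    · have hne : x ≠ y := fun h => hxy (Subtype.ext h)
      simp only [hcG x hx, hcG y hy]
      linarith [gridSet_separated hη0.le hx hy hne]
  · have hdisj : Disjoint A (G : Set (E d)) :=
      Set.disjoint_left.2 fun x hx hx' => hGA x hx' hx
    have h1 : HasSum ((fun x : E d => c x ^ h) ∘ (Subtype.val : A → E d)) τ := by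
      have heq : (fun x : E d => c x ^ h) ∘ (Subtype.val : A → E d) = fun x : A => b x ^ h :=
        funext fun x => by rw [Function.comp_apply, hcA x x.2]
      rw [heq]
      exact hsum.hasSum
    have h2 : HasSum ((fun x : E d => c x ^ h) ∘ 
        (Subtype.val : ↥(G : Set (E d)) → E d)) (1 - τ) := by
      have h3 := G.hasSum fun x : E d => c x ^ h
      have h4 : ∑ x ∈ G, c x ^ h = 1 - τ := by
        rw [Finset.sum_congr rfl fun x hx => by rw [hcG x hx, hc₀h], Finset.sum_const, hG,
          card_gridSet hη0, nsmul_eq_mul]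
        push_cast
        field_simp
      rw [h4] at h3
      exact h3
    have h5 := h1.add_disjoint hdisj h2
    rw [add_sub_cancel] at h5
    exact h5

theorem logCov_union_finset_le {d : ℕ} {A : Set (E d)} (hA : Bornology.IsBounded A)
    (hne : A.Nonempty) (G : Finset (E d)) (u : ℝ) :
    logCov (A ∪ (G : Set (E d))) u ≤ logCov A u + Real.log (1 + G.card) := by
  have hr := Real.exp_pos (-u)
  have h1 := coveringNumber_union_le hr hA G.finite_toSet.isBounded
  have h2 := coveringNumber_coe_le_card G hr
  have h3 := one_le_coveringNumber hA hr hne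
  have hb : Bornology.IsBounded (A ∪ (G : Set (E d))) := hA.union G.finite_toSet.isBounded
  have h4 : (coveringNumber (Real.exp (-u)) (A ∪ (G : Set (E d))) : ℝ) ≤
      coveringNumber (Real.exp (-u)) A * (1 + G.card) := by
    have h5 : coveringNumber (Real.exp (-u)) (A ∪ (G : Set (E d))) ≤
      coveringNumber (Real.exp (-u)) A * (1 + G.card) := by nlinarith
    exact_mod_cast h5
  have h5 : (0 : ℝ) < 1 + G.card := by positivity
  rw [← exp_logCov hA hne, ← exp_logCov hb (hne.mono Set.subset_union_left)] at h4
  rw [← Real.exp_log h5, ← Real.exp_add, Real.exp_le_exp] at h4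
  exact h4

/-- The existence of a system of similarity maps whose set of fixed points has a prescribed
covering function and whose limit set has a prescribed Hausdorff dimension. -/
theorem exists_homSys_of_logCov {d : ℕ} [NeZero d] {h : ℝ} (h0 : 0 < h) (hd : h < d) {f : ℝ → ℝ}
    (hf0 : f 0 = 0) (hmono : ∀ u v, 0 ≤ u → u ≤ v → f u ≤ f v)
    (hlip : ∀ u v, 0 ≤ u → u ≤ v → f v ≤ f u + d * (v - u)) :
    ∃ (ι : Type) (_ : Countable ι) (_ : Nonempty ι) (a : ι → E d) (c : ι → ℝ),
      HomSys a c ∧ HasSum (fun i => c i ^ h) 1 ∧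
      ∀ ε > 0, ∀ᶠ u in atTop, |logCov (Set.range a) u - f u| ≤ ε * u := by
  have hb := isBounded_blockUnion hf0 hlip
  have hne := blockUnion_nonempty (d := d) hf0 hmono
  have hcount : (blockUnion d f).Countable :=
    Set.countable_iUnion fun k => (block d f k).countable_toSet
  obtain ⟨G, c, hsys, hsum⟩ := exists_homSys h0 hd hcount
    (fun x hx => blockUnion_norm_le hf0 hlip hx) (fun x hx => blockUnion_apply_nonneg hx)
    (fun x hx => blockUnion_isolated hf0 hlip hx)
  refine ⟨↥(blockUnion d f ∪ (G : Set (E d))),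
    (hcount.union G.countable_toSet).to_subtype,
    (hne.mono Set.subset_union_left).to_subtype, _, _, hsys, hsum, fun ε hε => ?_⟩
  rw [Subtype.range_coe]
  have hbG : Bornology.IsBounded (blockUnion d f ∪ (G : Set (E d))) :=
    hb.union G.finite_toSet.isBounded
  filter_upwards [eventually_abs_logCov_blockUnion_sub_le hf0 hmono hlip (half_pos hε),
    eventually_ge_atTop (Real.log (1 + G.card) / (ε / 2))] with u h1 h2
  rw [div_le_iff₀ (half_pos hε)] at h2
  have h3 := logCov_union_finset_le hb hne G u
  have h4 := logCov_mono_set hbG hne Set.subset_union_left u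
  have h5 : 0 ≤ Real.log (1 + G.card) :=
    Real.log_nonneg (by linarith [(Nat.cast_nonneg G.card : (0 : ℝ) ≤ G.card)])
  rw [abs_le] at h1 ⊢
  constructor <;> linarith

end ConformalIFS

/-! ### Profiles with sparse valleys. -/

namespace ConformalIFS

open Filter

/-- A very rapidly increasing sequence of logarithmic scales. -/
noncomputable def valleyScale (k : ℕ) : ℝ := ((k + 1).factorial : ℝ) ^ 2

/-- The level of the `k`-th valley of the covering function. -/
noncomputable def valleyLevel (θ : ℝ) (k : ℕ) : ℝ := (θ + 1 / (k + 1)) * valleyScale k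

/-- The largest nondecreasing function which is Lipschitz with constant `α` and takes at most the
value `valleyLevel θ k` at `valleyScale k`. -/
noncomputable def valley (θ α : ℝ) (k : ℕ) (u : ℝ) : ℝ :=
  max (valleyLevel θ k) (valleyLevel θ k + α * (u - valleyScale k))

/-- A covering function with lower slope `s`, upper slope `t` and valleys of relative
level `θ`. -/
noncomputable def profile (s t α θ u : ℝ) : ℝ :=
  max (s * u) (min (t * u) (⨅ k, valley θ α k u))

theorem one_le_valleyScale (k : ℕ) : 1 ≤ valleyScale k := by
  have : (1 : ℝ) ≤ (k + 1).factorial := by exact_mod_cast Nat.factorial_pos _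
  exact one_le_pow₀ this

theorem valleyScale_pos (k : ℕ) : 0 < valleyScale k := zero_lt_one.trans_le (one_le_valleyScale k)

theorem valleyScale_mono : Monotone valleyScale := fun j k h => by
  unfold valleyScale
  gcongr

theorem valleyScale_succ (k : ℕ) : valleyScale (k + 1) = (k + 2) ^ 2 * valleyScale k := by
  simp only [valleyScale, Nat.factorial_succ (k + 1)]
  push_cast
  ring

theorem le_valleyScale (k : ℕ) : (k : ℝ) ≤ valleyScale k := by
  have h1 : (k : ℝ) ≤ (k + 1).factorial := by
    exact_mod_cast k.le_succ.trans (Nat.self_le_factorial (k + 1))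
  have h2 : (1 : ℝ) ≤ (k + 1).factorial := by exact_mod_cast Nat.factorial_pos _
  unfold valleyScale
  nlinarith

theorem tendsto_valleyScale : Tendsto valleyScale atTop atTop :=
  tendsto_atTop_mono le_valleyScale tendsto_natCast_atTop_atTop

section Profile

variable {s t α θ : ℝ}

theorem valleyLevel_pos (hθ : 0 ≤ θ) (k : ℕ) : 0 < valleyLevel θ k :=
  mul_pos (by positivity) (valleyScale_pos k)

/-- The summand `1 / (k + 1)` in the level alone gives `(k + 1) * valleyScale (k - 1)`. Hence even
for `θ = 0` a valley's level dwarfs all earlier scales, and the valleys do not interact. -/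
theorem mul_valleyScale_le (hθ : 0 ≤ θ) {j k : ℕ} (h : j < k) :
    k * valleyScale j ≤ valleyLevel θ k := by
  obtain ⟨k, rfl⟩ := Nat.exists_eq_add_of_lt h
  set n := j + k with hn
  have h1 : valleyScale j ≤ valleyScale n := valleyScale_mono (by omega)
  have h2 : (1 / ((n + 1 : ℕ) + 1 : ℝ)) * valleyScale (n + 1) ≤ valleyLevel θ (n + 1) := by
    unfold valleyLevel
    have := valleyScale_pos (n + 1)
    gcongr
    linarith
  refine le_trans ?_ h2
  rw [valleyScale_succ, div_mul_eq_mul_div, one_mul, le_div_iff₀ (by positivity)]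
  have h3 := valleyScale_pos j
  push_cast
  have h4 : (0 : ℝ) ≤ n := n.cast_nonneg
  have h5 : ((n : ℝ) + 1) * (n + 2) ≤ (n + 2) ^ 2 := by nlinarith
  calc ((n : ℝ) + 1) * valleyScale j * (n + 1 + 1) = (n + 1) * (n + 2) * valleyScale j := by ring
    _ ≤ (n + 2) ^ 2 * valleyScale n := by gcongr

theorem le_valleyLevel (hθ : 0 ≤ θ) {k : ℕ} (hk : 0 < k) : (k : ℝ) ≤ valleyLevel θ k := by
  have h1 := mul_valleyScale_le hθ hk
  have h2 := one_le_valleyScale 0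
  have : (0 : ℝ) ≤ k := k.cast_nonneg
  nlinarith

theorem valley_nonneg (hθ : 0 ≤ θ) (k : ℕ) (u : ℝ) : 0 ≤ valley θ α k u :=
  (valleyLevel_pos hθ k).le.trans (le_max_left _ _)

theorem bddBelow_valley (hθ : 0 ≤ θ) (u : ℝ) : BddBelow (Set.range fun k => valley θ α k u) :=
  ⟨0, by rintro _ ⟨k, rfl⟩; exact valley_nonneg hθ k u⟩

theorem le_profile_left (s t α θ u : ℝ) : s * u ≤ profile s t α θ u := le_max_left _ _

theorem le_profile {y u : ℝ} (h1 : y ≤ t * u) (h2 : ∀ k, y ≤ valley θ α k u) :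
    y ≤ profile s t α θ u :=
  (le_min h1 (le_ciInf h2)).trans (le_max_right _ _)

theorem profile_le (hst : s ≤ t) {u : ℝ} (hu : 0 ≤ u) : profile s t α θ u ≤ t * u :=
  max_le (by gcongr) (min_le_left _ _)

theorem profile_le_valley (hθ : 0 ≤ θ) (k : ℕ) (u : ℝ) :
    profile s t α θ u ≤ max (s * u) (valley θ α k u) :=
  max_le_max le_rfl ((min_le_right _ _).trans (ciInf_le (bddBelow_valley hθ u) k))

theorem profile_zero (hθ : 0 ≤ θ) : profile s t α θ 0 = 0 := by
  have : 0 ≤ ⨅ k, valley θ α k 0 := le_ciInf fun k => valley_nonneg hθ k 0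
  simp [profile, this]

theorem profile_mono (hs : 0 ≤ s) (ht : 0 ≤ t) (hα : 0 ≤ α) (hθ : 0 ≤ θ) {u v : ℝ}
    (huv : u ≤ v) : profile s t α θ u ≤ profile s t α θ v := by
  unfold profile
  have : ⨅ k, valley θ α k u ≤ ⨅ k, valley θ α k v :=
    ciInf_mono (bddBelow_valley hθ u) fun k => by unfold valley; gcongr
  gcongr

theorem profile_le_add (hst : s ≤ t) (htα : t ≤ α) (hα : 0 ≤ α) (hθ : 0 ≤ θ) {u v : ℝ}
    (huv : u ≤ v) : profile s t α θ v ≤ profile s t α θ u + α * (v - u) := by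
  have h0 : 0 ≤ v - u := by linarith
  have h1 : ⨅ k, valley θ α k v ≤ (⨅ k, valley θ α k u) + α * (v - u) := by
    rw [← sub_le_iff_le_add]
    refine le_ciInf fun k => ?_
    rw [sub_le_iff_le_add]
    refine (ciInf_le (bddBelow_valley hθ v) k).trans ?_
    unfold valley
    refine max_le ?_ ?_
    · linarith [le_max_left (valleyLevel θ k) (valleyLevel θ k + α * (u - valleyScale k)),
        mul_nonneg hα h0]
    · linarith [le_max_right (valleyLevel θ k) (valleyLevel θ k + α * (u - valleyScale k))]
  have hs : s * (v - u) ≤ α * (v - u) := by gcongr; linarith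
  have ht : t * (v - u) ≤ α * (v - u) := by gcongr
  unfold profile
  rw [← max_add_add_right, ← min_add_add_right]
  exact max_le_max (by linarith) (min_le_min (by linarith) h1)

/-- At its own scale a valley equals its level, and `θ ≤ s`. This realises the lower slope `s`. -/
theorem profile_valleyScale_le (hθ : 0 ≤ θ) (hθs : θ ≤ s) (k : ℕ) :
    profile s t α θ (valleyScale k) ≤ (s + 1 / (k + 1)) * valleyScale k := by
  have hU := valleyScale_pos k
  refine (profile_le_valley hθ k _).trans (max_le ?_ ?_)
  · gcongr
    have : (0 : ℝ) ≤ 1 / (k + 1) := by positivity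
    linarith
  · simp only [valley, sub_self, mul_zero, add_zero, max_self, valleyLevel]
    gcongr

/-- Just before a valley the covering function is close to its maximal slope. -/
theorem eventually_le_profile_peak (ht : 0 < t) (htα : t ≤ α) (hθ : 0 ≤ θ)
    {ε : ℝ} (hε : 0 < ε) :
    ∀ᶠ k : ℕ in atTop, (t - ε) * (valleyLevel θ k / t) ≤ profile s t α θ (valleyLevel θ k / t) := by
  have hcast := tendsto_natCast_atTop_atTop (R := ℝ)
  filter_upwards [hcast.eventually_ge_atTop (θ + 1), hcast.eventually_ge_atTop (α * t / ε),
    eventually_gt_atTop 0] with k hk1 hk2 hk0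
  have hk0' : (0 : ℝ) < k := by exact_mod_cast hk0
  have hz := valleyLevel_pos hθ k
  set b := valleyLevel θ k / t with hb
  have hb0 : 0 < b := by positivity
  have hzb : valleyLevel θ k = t * b := by rw [hb]; field_simp
  rw [div_le_iff₀ hε] at hk2
  refine le_profile (by gcongr; linarith) fun j => ?_
  rcases lt_trichotomy j k with h | h | h
  -- Earlier valleys are long past: their lines of slope `α ≥ t` have recovered up to the error `α *
  -- valleyScale j ≤ ε * b`.
  · refine le_trans ?_ (le_max_right _ _)
    have h1 := mul_valleyScale_le hθ h
    have h2 := valleyLevel_pos hθ j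
    rw [hzb] at h1
    have h3 : α * valleyScale j ≤ ε * b := by
      have h4 : k * (α * valleyScale j) ≤ k * (ε * b) := by
        calc k * (α * valleyScale j) = α * (k * valleyScale j) := by ring
          _ ≤ α * (t * b) := by gcongr; linarith
          _ = α * t * b := by ring
          _ ≤ k * ε * b := by gcongr
          _ = k * (ε * b) := by ring
      exact le_of_mul_le_mul_left h4 hk0'
    have h5 : t * b ≤ α * b := by gcongr
    linarith
  · subst h
    refine le_trans ?_ (le_max_left _ _)
    rw [hzb]
    nlinarith
  -- Later valleys have plateaus higher than the level of the current one.
  · refine le_trans ?_ (le_max_left _ _)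
    have h1 := mul_valleyScale_le hθ h
    have h2 : valleyLevel θ k ≤ (θ + 1) * valleyScale k := by
      unfold valleyLevel
      have := valleyScale_pos k
      gcongr
      rw [div_le_one (by positivity)]
      linarith
    have h3 : (k : ℝ) ≤ j := by exact_mod_cast h.le
    have h4 : (θ + 1) * valleyScale k ≤ j * valleyScale k := by
      have := valleyScale_pos k
      gcongr
      linarith
    nlinarith

/-- If no valley is low at `v`, take `u = v`. Otherwise a low valley `k` keeps `v` close to it, and
the peak `u = valleyLevel θ k / t` just before it is a good choice. -/
theorem eventually_exists_conv_ge {h : ℝ} (h0 : 0 ≤ h) (hht : h < t) (hhα : h < α) (htα : t ≤ α)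
    (hθ : 0 < θ) (hθt : θ ≤ t) {ε : ℝ} (hε : 0 < ε) (u₀ : ℝ) :
    ∀ᶠ v in atTop, ∃ u, u₀ ≤ u ∧ u ≤ v ∧
      (topDim h θ t α - ε) * v ≤ h * (v - u) + profile s t α θ u := by
  have ht : 0 < t := by linarith
  have hD := topDim_denom_pos h0 hhα hht hθt
  have hβt : topDim h θ t α ≤ t := by
    have : (t - h) * (α - h) * θ / (α * t - h * θ) ≤ t - h := by
      rw [div_le_iff₀ hD]
      have h1 : (α - h) * θ ≤ α * t - h * θ := by nlinarith
      have h2 : 0 ≤ t - h := by linarith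
      nlinarith
    unfold topDim
    linarith
  obtain ⟨k₀, hk₀⟩ := eventually_atTop.1 ((eventually_le_profile_peak (s := s) ht htα hθ.le hε).and
    ((tendsto_natCast_atTop_atTop (R := ℝ)).eventually_ge_atTop (t * u₀)))
  filter_upwards [eventually_ge_atTop u₀, eventually_gt_atTop 0,
    eventually_ge_atTop (α * valleyScale (k₀ + 1) / ε)] with v hv₀ hv hvU
  rw [div_le_iff₀ hε] at hvU
  by_cases hall : ∀ k, (topDim h θ t α - ε) * v ≤ valley θ α k v
  · refine ⟨v, hv₀, le_rfl, ?_⟩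
    rw [sub_self, mul_zero, zero_add]
    refine le_profile ?_ hall
    gcongr
    linarith
  push Not at hall
  obtain ⟨k, hk⟩ := hall
  have hz := valleyLevel_pos hθ.le k
  have hk1 : valleyLevel θ k < (topDim h θ t α - ε) * v := (le_max_left _ _).trans_lt hk
  have hk2 : valleyLevel θ k + α * (v - valleyScale k) < (topDim h θ t α - ε) * v :=
    (le_max_right _ _).trans_lt hk
  -- For bounded `k` the line of slope `α ≥ topDim h θ t α` is already too high at large `v`.
  have hkk₀ : k₀ + 1 < k := by
    by_contra! hle
    have h1 : α * valleyScale k ≤ α * valleyScale (k₀ + 1) := by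
      have := valleyScale_mono hle
      gcongr
      linarith
    have h2 : topDim h θ t α * v ≤ α * v := by gcongr; linarith
    linarith
  obtain ⟨hpeak, hku₀⟩ := hk₀ k (by omega)
  have hzk := le_valleyLevel hθ.le (k := k) (by omega)
  have hbv : valleyLevel θ k / t ≤ v := by
    rw [div_le_iff₀ ht]
    have : (topDim h θ t α - ε) * v ≤ t * v := by gcongr; linarith
    linarith
  refine ⟨valleyLevel θ k / t, ?_, hbv, ?_⟩
  · rw [le_div_iff₀ ht]; linarith
  have hU : θ * valleyScale k ≤ valleyLevel θ k := by
    unfold valleyLevel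
    have := valleyScale_pos k
    gcongr
    have : (0 : ℝ) ≤ 1 / (k + 1) := by positivity
    linarith
  -- Lowness of valley `k` at `v`, with `θ * valleyScale k ≤ valleyLevel θ k`, bounds `v` by a
  -- multiple of the level. `topDim` is the value for which that multiple is the required one.
  have hcrit : (topDim h θ t α - h) * v ≤ (t - h) * (valleyLevel θ k / t) := by
    have h1 : (α - topDim h θ t α) * v * θ ≤ (α - θ) * valleyLevel θ k := by
      have h2 : (α - topDim h θ t α) * v < α * valleyScale k - valleyLevel θ k := by nlinarith
      have h3 : α * (θ * valleyScale k) ≤ α * valleyLevel θ k := by gcongr; linarith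
      nlinarith
    have h4 : α - topDim h θ t α = (α - h) * t * (α - θ) / (α * t - h * θ) := by
      unfold topDim; field_simp; ring
    rcases (hθt.trans htα).eq_or_lt with heq | hlt
    -- For `θ = α` also `topDim = α`. Lowness would put the level below `α * valleyScale k - ε * v`,
    -- while it is at least `α * valleyScale k`.
    · exfalso
      have h5 : α - topDim h θ t α = 0 := by rw [h4, heq]; simp
      have h6 : θ * valleyScale k < α * valleyScale k - ε * v := by nlinarith
      rw [heq] at h6
      nlinarith
    · have h5 : topDim h θ t α - h = (t - h) * (α - h) * θ / (α * t - h * θ) := by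
        unfold topDim; ring
      have hαθ : 0 < α - θ := by linarith
      rw [h4] at h1
      have h6 : (α - h) * t * θ * v / (α * t - h * θ) ≤ valleyLevel θ k := by
        refine le_of_mul_le_mul_left ?_ hαθ
        calc _ = (α - h) * t * (α - θ) / (α * t - h * θ) * v * θ := by ring
          _ ≤ _ := h1
      rw [h5]
      have h7 : (t - h) * (α - h) * θ / (α * t - h * θ) * v =
          (t - h) * ((α - h) * t * θ * v / (α * t - h * θ) / t) := by
        field_simp
      rw [h7]
      have : 0 ≤ t - h := by linarith
      gcongr
  have h8 : ε * (valleyLevel θ k / t) ≤ ε * v := by gcongr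
  linarith

end Profile

end ConformalIFS

/-! ### Dimensions of the constructed systems and sharpness. -/

namespace ConformalIFS

open Filter

section Profile

variable {d : ℕ} {A : Set (E d)} {s t α θ : ℝ}

theorem lowerBoxDim_eq_of_profile (hθ : 0 ≤ θ) (hθs : θ ≤ s)
    (hA : ∀ ε > 0, ∀ᶠ u in atTop, |logCov A u - profile s t α θ u| ≤ ε * u) :
    lowerBoxDim A = ENNReal.ofReal s := by
  refine le_antisymm (lowerBoxDim_le fun ε hε => ?_) (le_lowerBoxDim fun ε hε => ?_)
  · refine tendsto_valleyScale.frequently (Eventually.frequently ?_)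
    filter_upwards [tendsto_valleyScale.eventually (hA (ε / 2) (half_pos hε)),
      (tendsto_natCast_atTop_atTop (R := ℝ)).eventually_ge_atTop (2 / ε)] with k h1 h2
    have h3 := (abs_le.1 h1).2
    have h4 := profile_valleyScale_le (t := t) (α := α) hθ hθs k
    have h5 : (1 : ℝ) / (k + 1) ≤ ε / 2 := by
      rw [div_le_iff₀ hε] at h2
      rw [div_le_iff₀ (by positivity)]
      linarith
    have h6 : 1 / ((k : ℝ) + 1) * valleyScale k ≤ ε / 2 * valleyScale k :=
      mul_le_mul_of_nonneg_right h5 (valleyScale_pos k).le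
    linarith
  · filter_upwards [hA ε hε] with u h1
    linarith [(abs_le.1 h1).1, le_profile_left s t α θ u]

/-- The slope `t` is approached along the peaks `valleyLevel θ k / t`. -/
theorem upperBoxDim_eq_of_profile (hs : 0 ≤ s) (hst : s ≤ t) (htα : t ≤ α) (hθ : 0 ≤ θ)
    (hA : ∀ ε > 0, ∀ᶠ u in atTop, |logCov A u - profile s t α θ u| ≤ ε * u) :
    upperBoxDim A = ENNReal.ofReal t := by
  refine le_antisymm (upperBoxDim_le fun ε hε => ?_) ?_
  · filter_upwards [hA ε hε, eventually_ge_atTop 0] with u h1 h2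
    linarith [(abs_le.1 h1).2, profile_le (α := α) (θ := θ) hst h2]
  rcases (hs.trans hst).eq_or_lt with h0 | ht
  · simp [← h0]
  refine le_upperBoxDim fun ε hε => ?_
  have htend : Tendsto (fun k => valleyLevel θ k / t) atTop atTop := by
    refine Tendsto.atTop_div_const ht (tendsto_atTop_mono' _ ?_
      (tendsto_natCast_atTop_atTop (R := ℝ)))
    filter_upwards [eventually_gt_atTop 0] with k hk using le_valleyLevel hθ hk
  refine htend.frequently (Eventually.frequently ?_)
  filter_upwards [htend.eventually (hA (ε / 2) (half_pos hε)),
    eventually_le_profile_peak (s := s) ht htα hθ (half_pos hε)] with k h1 h2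
  linarith [(abs_le.1 h1).1]

theorem exists_logCov_le_profile (hb : Bornology.IsBounded A) (hne : A.Nonempty) (hs : 0 ≤ s)
    (hA : ∀ ε > 0, ∀ᶠ u in atTop, |logCov A u - profile s t α θ u| ≤ ε * u)
    {ε : ℝ} (hε : 0 < ε) :
    ∃ C, ∀ u, 0 ≤ u → logCov A u ≤ profile s t α θ u + ε * u + C := by
  obtain ⟨u₀, hu₀⟩ := eventually_atTop.1 (hA ε hε)
  refine ⟨logCov A u₀, fun u hu => ?_⟩
  rcases le_total u₀ u with h1 | h1
  · linarith [(abs_le.1 (hu₀ u h1)).2, logCov_nonneg A u₀]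
  · have h2 := logCov_mono hb hne h1
    have h3 := (mul_nonneg hs hu).trans (le_profile_left s t α θ u)
    have h4 : 0 ≤ ε * u := by positivity
    linarith

end Profile

namespace HomSys

variable {ι : Type*} {d : ℕ} {a : ι → E d} {c : ι → ℝ} {h s t θ : ℝ}

/-- The valleys of the profile have relative level near `θ`, below the lower slope `s` of `F`. So
the bound involves `θ` instead of `s`, with the truncation contributing the slope `σ = s + ε`. -/
theorem lowerBoxDim_limitSet_le [NeZero d] [Countable ι] [Nonempty ι] (H : HomSys a c)
    (h0 : 0 < h) (hc : HasSum (fun i => c i ^ h) 1) (hθ : 0 ≤ θ) (hθs : θ ≤ s) (hst : s ≤ t)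
    (htd : t ≤ d) (hht : h < t)
    (hA : ∀ ε > 0, ∀ᶠ u in atTop, |logCov (Set.range a) u - profile s t d θ u| ≤ ε * u) :
    lowerBoxDim (limitSet (hom a c) (Metric.closedBall 0 1)) ≤
      ENNReal.ofReal (max s (topDim h θ t d)) := by
  have hhd : h < d := hht.trans_le htd
  have hs : 0 ≤ s := hθ.trans hθs
  have hb : Bornology.IsBounded (Set.range a) := by
    rw [← H.fixedPts_eq]; exact H.confSys.isBounded_fixedPts
  have hne := Set.range_nonempty a
  have hlim : Tendsto (fun ε => max (s + ε) (topDim (h + ε) (θ + ε) (t + ε) d)) (𝓝[>] 0)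
      (𝓝 (max s (topDim h θ t d))) := by
    refine Tendsto.max ?_ (tendsto_topDim h0.le hhd hht (hθs.trans hst))
    have : ContinuousAt (fun ε : ℝ => s + ε) 0 := by fun_prop
    simpa using this.tendsto.mono_left nhdsWithin_le_nhds
  refine ge_of_tendsto (ENNReal.tendsto_ofReal hlim) ?_
  filter_upwards [Ioo_mem_nhdsGT (sub_pos.2 hhd)] with ε hε
  obtain ⟨hε0, hεd⟩ := hε
  have hdim : dimH (limitSet (hom a c) (Metric.closedBall 0 1)) < ENNReal.ofReal (h + ε) := by
    rw [H.dimH_limitSet h0 hc]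
    exact (ENNReal.ofReal_lt_ofReal_iff (by positivity)).2 (by linarith)
  obtain ⟨C', -, hg⟩ := H.confSys.exists_logCov_le hdim
  rw [H.fixedPts_eq] at hg
  have hd0 : (0 : ℝ) < d := h0.trans hhd
  have hgap : 0 < d - (h + ε) := by linarith
  -- On the window `u ≤ d / (d - (h + ε)) * valleyScale k` the error `ε' u` is at most `ε / 2 *
  -- valleyScale k`. It fits into the level together with the excess `1 / (k + 1)`.
  set ε' := min ε (ε / 2 * ((d - (h + ε)) / d)) with hε'
  have hε'0 : 0 < ε' := by positivity
  obtain ⟨C, hC⟩ := exists_logCov_le_profile hb hne hs hA hε'0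
  refine lowerBoxDim_le fun δ hδ => ?_
  refine frequently_le_of_valleys (φ := logCov (Set.range a)) (C := C)
    (by positivity) (by linarith) (by linarith) (by positivity) (by linarith) hg
    (fun u hu => ?_) ?_ hδ
  · have h1 : ε' * u ≤ ε * u := by gcongr; exact min_le_left _ _
    linarith [hC u hu, profile_le (α := d) (θ := θ) hst hu]
  refine tendsto_valleyScale.frequently (Eventually.frequently ?_)
  filter_upwards [(tendsto_natCast_atTop_atTop (R := ℝ)).eventually_ge_atTop (2 / ε)] with k hk
  intro u hu hule
  have hU := valleyScale_pos k
  have h1 : ε' * u ≤ ε * u := by gcongr; exact min_le_left _ _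
  have h2 : ε' * u ≤ ε / 2 * valleyScale k := by
    calc ε' * u ≤ ε / 2 * ((d - (h + ε)) / d) * (d / (d - (h + ε)) * valleyScale k) := by
          gcongr; exact min_le_right _ _
      _ = ε / 2 * valleyScale k := by field_simp
  have h3 : (1 : ℝ) / (k + 1) ≤ ε / 2 := by
    rw [div_le_iff₀ hε0] at hk
    rw [div_le_iff₀ (by positivity)]
    linarith
  have h4 : 1 / ((k : ℝ) + 1) * valleyScale k ≤ ε / 2 * valleyScale k :=
    mul_le_mul_of_nonneg_right h3 hU.le
  have h5 : valleyLevel θ k + ε' * u ≤ (θ + ε) * valleyScale k := by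
    unfold valleyLevel
    linarith
  refine (hC u hu).trans ?_
  gcongr
  rw [← le_sub_iff_add_le]
  refine (profile_le_valley hθ k u).trans ?_
  rw [le_sub_iff_add_le]
  unfold valley
  rw [← max_add_add_right, ← max_add_add_right]
  exact max_le_max (by linarith) (max_le_max h5 (by linarith))

/-- The reverse covering estimate is only available for exponents `h - δ`; this changes the value at
scale `v` by at most `δ v`. -/
theorem le_lowerBoxDim_limitSet [NeZero d] [Countable ι] [Nonempty ι] (H : HomSys a c)
    (h0 : 0 < h) (hc : HasSum (fun i => c i ^ h) 1) (hθ : 0 < θ) (hθt : θ ≤ t)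
    (htd : t ≤ d) (hht : h < t)
    (hA : ∀ ε > 0, ∀ᶠ u in atTop, |logCov (Set.range a) u - profile s t d θ u| ≤ ε * u) :
    ENNReal.ofReal (topDim h θ t d) ≤
      lowerBoxDim (limitSet (hom a c) (Metric.closedBall 0 1)) := by
  refine le_lowerBoxDim fun ε hε => ?_
  set δ := min h (ε / 4) with hδ
  have hδ0 : 0 < δ := by positivity
  have hδε : δ ≤ ε / 4 := min_le_right _ _
  obtain ⟨C, u₀, hC⟩ := H.exists_le_logCov (s' := h - δ) (sub_nonneg.2 (min_le_left _ _)) hc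
    (by linarith)
  obtain ⟨u₁, hu₁⟩ := eventually_atTop.1 (hA (ε / 4) (by positivity))
  filter_upwards [eventually_exists_conv_ge (s := s) h0.le hht (hht.trans_le htd) htd hθ hθt
    (show 0 < ε / 4 by positivity) (max 0 (max u₀ u₁)), eventually_ge_atTop (C / (ε / 4))]
    with v ⟨u, hu, huv, hconv⟩ hv
  rw [div_le_iff₀ (by positivity)] at hv
  have hu0 : 0 ≤ u := (le_max_left _ _).trans hu
  have h1 := hC u v ((le_max_left _ _).trans ((le_max_right _ _).trans hu)) huv
  have h2 := (abs_le.1 (hu₁ u ((le_max_right _ _).trans ((le_max_right _ _).trans hu)))).1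
  have h3 : δ * (v - u) ≤ ε / 4 * (v - u) := by gcongr
  have h4 : 0 ≤ ε / 4 * v := mul_nonneg (by positivity) (hu0.trans huv)
  linarith

end HomSys

/-- Intermediate value theorem in `θ`, starting from `topDim h 0 t α = h`. -/
theorem exists_topDim_eq {h s t α β : ℝ} (h0 : 0 ≤ h) (hα : h < α) (ht : h < t) (hs : 0 ≤ s)
    (hst : s ≤ t) (hβ : β ∈ Set.Icc h (topDim h s t α)) :
    ∃ θ ∈ Set.Icc 0 s, topDim h θ t α = β := by
  have hcont : ContinuousOn (fun θ => topDim h θ t α) (Set.Icc 0 s) := by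
    unfold topDim
    refine ContinuousOn.add (by fun_prop) (ContinuousOn.div (by fun_prop) (by fun_prop) ?_)
    exact fun θ hθ => (topDim_denom_pos h0 hα ht (hθ.2.trans hst)).ne'
  have := intermediate_value_Icc hs hcont
  rw [show topDim h 0 t α = h by simp [topDim]] at this
  exact this hβ

/-- Sharpness: all the dimensions allowed by the inclusion are attained by similarity systems. -/
theorem exists_isCIFS_dims_eq {d : ℕ} [NeZero d] {h s t β : ℝ} (h0 : 0 < h) (hhd : h < d)
    (hs : 0 ≤ s) (hst : s ≤ t) (htd : t ≤ d) (hβ : β ∈ interval h s t d) :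
    ∃ (ι : Type) (_ : Countable ι) (_ : Nonempty ι) (S : ι → E d → E d) (X : Set (E d)),
      IsCIFS S X ∧ (∀ i, IsSimilarityMap (S i)) ∧
      dimH (limitSet S X) = ENNReal.ofReal h ∧
      lowerBoxDim (fixedPts S X) = ENNReal.ofReal s ∧
      upperBoxDim (fixedPts S X) = ENNReal.ofReal t ∧
      lowerBoxDim (limitSet S X) = ENNReal.ofReal β := by
  -- The depth of the valleys encodes `β`. For `t ≤ h` the value is forced and the depth is
  -- irrelevant.
  obtain ⟨θ, ⟨hθ, hθs⟩, hβθ⟩ : ∃ θ ∈ Set.Icc 0 s, h < t → topDim h θ t d = β := by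
    rcases le_or_gt t h with hth | hht
    · exact ⟨s, ⟨hs, le_rfl⟩, fun hht => absurd hth hht.not_ge⟩
    · rw [interval, if_neg hht.not_ge] at hβ
      obtain ⟨θ, hθ, hβθ⟩ := exists_topDim_eq h0.le hhd hht hs hst
        ⟨(le_max_left _ _).trans hβ.1, hβ.2⟩
      exact ⟨θ, hθ, fun _ => hβθ⟩
  obtain ⟨ι, hι, hne, a, c, H, hc, hA⟩ := exists_homSys_of_logCov (f := profile s t d θ) h0 hhd
    (profile_zero hθ) (fun u v _ huv => profile_mono hs (hs.trans hst) (by positivity) hθ huv)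
    (fun u v _ huv => profile_le_add hst htd (by positivity) hθ huv)
  have hdim := H.dimH_limitSet h0 hc
  have hlow := lowerBoxDim_eq_of_profile hθ hθs hA
  have hupp := upperBoxDim_eq_of_profile hs hst htd hθ hA
  rw [← H.fixedPts_eq] at hlow hupp
  refine ⟨ι, hι, hne, hom a c, Metric.closedBall 0 1, H.isCIFS, H.isSimilarityMap, hdim, hlow,
    hupp, ?_⟩
  have hhΛ := dimH_le_lowerBoxDim H.confSys.isBounded_limitSet H.confSys.limitSet_nonempty
  rw [hdim] at hhΛ
  unfold interval at hβ
  split_ifs at hβ with hth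
  · rw [Set.mem_singleton_iff.1 hβ]
    refine le_antisymm ((lowerBoxDim_le_upperBoxDim _).trans ?_) hhΛ
    exact H.confSys.upperBoxDim_limitSet_le (a := h.toNNReal) (t := t.toNNReal) hdim hupp
      (Real.toNNReal_le_toNNReal hth)
  · rw [not_le] at hth
    have hβθ := hβθ hth
    refine le_antisymm ?_ ?_
    · have := H.lowerBoxDim_limitSet_le h0 hc hθ hθs hst htd hth hA
      rwa [hβθ, max_eq_right ((le_max_right _ _).trans hβ.1)] at this
    -- The peak argument divides by `θ`; for `θ = 0` the target is `h`, and the Hausdorff dimension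
    -- suffices.
    · rcases hθ.eq_or_lt with rfl | hθ0
      · rwa [← hβθ, show topDim h 0 t d = h by simp [topDim]]
      · rw [← hβθ]
        exact H.le_lowerBoxDim_limitSet h0 hc hθ0 (hθs.trans hst) htd hth hA

end ConformalIFS

theorem theoremD (d : ℕ) (hd : 1 ≤ d) :
    (∀ (ι : Type*) [Countable ι] [Nonempty ι]
        (S : ι → ConformalIFS.E d → ConformalIFS.E d) (X : Set (ConformalIFS.E d)),
      ConformalIFS.IsCIFS S X →
      ∃ h s t β : ℝ≥0,
        dimH (ConformalIFS.limitSet S X) = h ∧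
        ConformalIFS.lowerBoxDim (ConformalIFS.fixedPts S X) = s ∧
        ConformalIFS.upperBoxDim (ConformalIFS.fixedPts S X) = t ∧
        ConformalIFS.lowerBoxDim (ConformalIFS.limitSet S X) = β ∧
        (β : ℝ) ∈ ConformalIFS.interval h s t d) ∧
    (∀ h s t β : ℝ, 0 < h → h < d → 0 ≤ s → s ≤ t → t ≤ d →
      β ∈ ConformalIFS.interval h s t d →
      ∃ (ι : Type) (_ : Countable ι) (_ : Nonempty ι)
        (S : ι → ConformalIFS.E d → ConformalIFS.E d) (X : Set (ConformalIFS.E d)),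
        ConformalIFS.IsCIFS S X ∧
        (∀ i, ConformalIFS.IsSimilarityMap (S i)) ∧
        dimH (ConformalIFS.limitSet S X) = ENNReal.ofReal h ∧
        ConformalIFS.lowerBoxDim (ConformalIFS.fixedPts S X) = ENNReal.ofReal s ∧
        ConformalIFS.upperBoxDim (ConformalIFS.fixedPts S X) = ENNReal.ofReal t ∧
        ConformalIFS.lowerBoxDim (ConformalIFS.limitSet S X) = ENNReal.ofReal β) := by
  have : NeZero d := ⟨by omega⟩
  refine ⟨fun ι _ _ S X hS => hS.exists_dims_mem_interval, ?_⟩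
  intro h s t β h0 hhd hs hst htd hβ
  exact ConformalIFS.exists_isCIFS_dims_eq h0 hhd hs hst htd hβ
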